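/- Let $\mathsf{E}=\mathrm{DTIME}(2^{O(n)})$ be the class of languages over $\{0,1\}$ that are decided by a deterministic one-tape Turing machine in time $2^{O(n)}$, where $n$ is the length of the input word. A guarding game $(\overrightarrow G,V_C,c)$ consists of a finite directed graph $\overrightarrow G=(V,A)$, a non-empty set $V_C\subseteq V$ (the cop-region; $V_R=V\setminus V_C$ is the robber-region) and a number $c\ge 0$ of cops. First the robber-player places Robber on a vertex of $V_R$, then the cop-player places the $c$ cops on vertices of $V_C$ (several cops may share a vertex). From then on the players alternate, the robber-player moving first; in each turn a player may move each of his pawns along an edge or leave it where it is, where cops may move only inside $V_C$ and Robber may move only to vertices with no cop on them. The positions of all pawns are always known to both players. The robber-player wins if Robber enters $V_C$ after finitely many moves; otherwise the cop-player wins. In a guarding game with prescribed starting positions $(\overrightarrow G,V_C,c,S,r)$ the placements $S:\{1,\dots,c\}\to V_C$ of the cops and $r\in V_R$ of Robber are given, and the play starts with Robber's first move. Games are encoded by binary words as follows: $c$ is written in binary; the graph is given by the list of its vertices, each with one bit that tells whether it lies in $V_C$ and with the list of the binary indices of its out-neighbours; prescribed starting positions are given by the binary indices of $r,S(1),\dots,S(c)$.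 All numbers and lists are self-delimiting. The guarding decision problem is the language of all words that encode a guarding game $(\overrightarrow G,V_C,c)$ in which the robber-player has a winning strategy; the guarding decision problem with prescribed starting positions is defined in the same way from the games $(\overrightarrow G,V_C,c,S,r)$. Lemma. The guarding decision problem is in $\mathsf{E}$, and so is the guarding decision problem with prescribed starting positions. -/

import Mathlib

/-! ### Deterministic one-tape Turing machines and the class `E` -/

/-- A deterministic one-tape Turing machine over a finite tape alphabet `Γ` (the blank is `default`)
with a finite set `Λ` of states (the initial state is `default`), working on binary input words.
The letters `0`, `1` are two distinct non-blank symbols.  In each step a `Turing.TM0` machine reads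
the scanned cell, changes its state, and writes a symbol or moves the head by one cell. -/
structure OneTapeTM where
  Γ : Type
  Λ : Type
  [inhabitedΓ : Inhabited Γ]
  [inhabitedΛ : Inhabited Λ]
  [finiteΓ : Finite Γ]
  [finiteΛ : Finite Λ]
  symbol : Bool → Γ
  symbol_injective : Function.Injective symbol
  symbol_ne_blank : ∀ b, symbol b ≠ default
  program : Turing.TM0.Machine Γ Λ
  accepting : Set Λ

namespace OneTapeTM

attribute [instance] inhabitedΓ inhabitedΛ finiteΓ finiteΛ

/-- The configuration after `t` steps on input `w`; it is `none` if the machine has halted after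
fewer than `t` steps. -/
def run (M : OneTapeTM) (w : List Bool) (t : ℕ) : Option (Turing.TM0.Cfg M.Γ M.Λ) :=
  (fun o => o.bind (Turing.TM0.step M.program))^[t]
    (some (Turing.TM0.init (w.map M.symbol)))

/-- `M` decides `L` in time `T`: on every word `w` it halts after at most `T |w|` steps, and the
state in which it halts is accepting if and only if `w ∈ L`. -/
def DecidesInTime (M : OneTapeTM) (L : Language Bool) (T : ℕ → ℕ) : Prop :=
  ∀ w : List Bool, ∃ t ≤ T w.length, ∃ C : Turing.TM0.Cfg M.Γ M.Λ,
    M.run w t = some C ∧ Turing.TM0.step M.program C = none ∧ (C.q ∈ M.accepting ↔ w ∈ L)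

end OneTapeTM

/-- The languages decided by a deterministic one-tape Turing machine in time `O(T(n))`. -/
def DTIME (T : ℕ → ℕ) : Set (Language Bool) :=
  {L | ∃ (M : OneTapeTM) (a : ℕ), M.DecidesInTime L (fun n => a * T n)}

/-- The class `E = DTIME(2 ^ O(n))`. -/
def ClassE : Set (Language Bool) :=
  ⋃ k : ℕ, DTIME (fun n => 2 ^ (k * n))

/-! ### The guarding game -/

/-- A guarding game `(G, V_C, c)` on a directed graph.  The robber-region `V_R` is the complement of
the cop-region. -/
structure GuardingGame where
  order : ℕ
  graph : Digraph (Fin order)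
  copRegion : Finset (Fin order)
  copRegion_nonempty : copRegion.Nonempty
  cops : ℕ

namespace GuardingGame

/-- Positions of all the cops; several cops may share a vertex. -/
abbrev Placement (G : GuardingGame) : Type := Fin G.cops → Fin G.order

/-- A pawn on `u` may stay or move along an edge. -/
def PawnMove (G : GuardingGame) (u v : Fin G.order) : Prop := v = u ∨ G.graph.Adj u v

/-- `S t` is the position of the cops after their `t`-th move, `S 0` being the initial placement.
The cops never leave the cop-region. -/
def IsCopPlay (G : GuardingGame) (S : ℕ → G.Placement) : Prop :=
  (∀ t i, S t i ∈ G.copRegion) ∧ ∀ t i, G.PawnMove (S t i) (S (t + 1) i)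

/-- A strategy of the robber-player: his next vertex, given the positions `S 0, …, S t` of the cops
seen so far (his own earlier positions are determined by these). -/
abbrev RobberStrategy (G : GuardingGame) : Type := List G.Placement → Fin G.order

/-- Position of Robber after his `t`-th move, when he starts on `r`, follows `σ`, and the cops
play `S`.  His move number `t + 1` takes place after the cops have reached `S t`. -/
def robberPlay (G : GuardingGame) (r : Fin G.order) (σ : G.RobberStrategy)
    (S : ℕ → G.Placement) : ℕ → Fin G.order
  | 0 => r
  | t + 1 => σ ((List.range (t + 1)).map S)

/-- In the play with Robber's positions `R` and the cops' positions `S`, Robber enters the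
cop-region after finitely many moves, all of them legal: along an edge or staying, and onto a vertex
with no cop on it. -/
def RobberEnters (G : GuardingGame) (R : ℕ → Fin G.order) (S : ℕ → G.Placement) : Prop :=
  ∃ t, R t ∈ G.copRegion ∧ ∀ s < t, G.PawnMove (R s) (R (s + 1)) ∧ ∀ i, S s i ≠ R (s + 1)

/-- The robber-player has a winning strategy when Robber is on `r`, the cops are placed
as in `S₀`, and Robber is to move. -/
def RobberWinsFrom (G : GuardingGame) (r : Fin G.order) (S₀ : G.Placement) : Prop :=
  ∃ σ : G.RobberStrategy, ∀ S : ℕ → G.Placement, G.IsCopPlay S → S 0 = S₀ →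
    G.RobberEnters (G.robberPlay r σ S) S

/-- The guarding game is robber-win: the robber-player can place Robber in the robber-region so
that he wins against each subsequent placement of the cops in the cop-region. -/
def RobberWins (G : GuardingGame) : Prop :=
  ∃ r : Fin G.order, r ∉ G.copRegion ∧
    ∀ S₀ : G.Placement, (∀ i, S₀ i ∈ G.copRegion) → G.RobberWinsFrom r S₀

end GuardingGame

/-- A guarding game with prescribed starting positions `(G, V_C, c, S, r)`. -/
structure GuardingGamePSP extends GuardingGame where
  copStart : Fin cops → Fin order
  copStart_mem : ∀ i, copStart i ∈ copRegion
  robberStart : Fin order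
  robberStart_notMem : robberStart ∉ copRegion

/-- The game is played from the prescribed positions, Robber moving first. -/
def GuardingGamePSP.RobberWins (G : GuardingGamePSP) : Prop :=
  G.toGuardingGame.RobberWinsFrom G.robberStart G.copStart

/-! ### Binary encodings and the decision problems -/

/-- Self-delimiting binary code of a number: every binary digit `b` (least significant first) is
written as `1b`, and `0` ends the number. -/
def binaryCode (k : ℕ) : List Bool :=
  k.bits.flatMap (fun b => [true, b]) ++ [false]

open Classical in
/-- The entry of the vertex `v` in the adjacency list: one bit that tells whether `v` lies in the
cop-region, then the out-neighbours of `v` in increasing order, each preceded by `1`, then `0`. -/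
noncomputable def GuardingGame.vertexCode (G : GuardingGame) (v : Fin G.order) : List Bool :=
  decide (v ∈ G.copRegion) ::
    ((List.finRange G.order).filter (fun u => G.graph.Adj v u)).flatMap
      (fun u => true :: binaryCode u) ++ [false]

/-- Encoding of `(G, V_C, c)`: the number of cops in binary, then the adjacency list of the graph, the
entry of every vertex being preceded by `1`, then `0`.  For a graph with `m` vertices and `e` edges
the length is `O(m + e log m + log c)`. -/
noncomputable def GuardingGame.code (G : GuardingGame) : List Bool :=
  binaryCode G.cops ++
    (List.finRange G.order).flatMap (fun v => true :: G.vertexCode v) ++ [false]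

/-- Encoding of `(G, V_C, c, S, r)`: the code of `(G, V_C, c)` followed by `r` and by the `c`
positions of the cops. -/
noncomputable def GuardingGamePSP.code (G : GuardingGamePSP) : List Bool :=
  G.toGuardingGame.code ++ binaryCode G.robberStart ++
    (List.ofFn G.copStart).flatMap (fun v => binaryCode v)

/-- The guarding decision problem: the codes of the guarding games that the robber-player wins. -/
def Guard : Language Bool :=
  {w | ∃ G : GuardingGame, G.code = w ∧ G.RobberWins}

/-- The guarding decision problem with prescribed starting positions. -/
def GuardPSP : Language Bool :=
  {w | ∃ G : GuardingGamePSP, G.code = w ∧ G.RobberWins}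

/-! Whether Robber wins depends only on his vertex and on the multiset of the cops' positions,
because the cops are interchangeable. On `m` vertices with `c` cops there are fewer than `2 ^ (m +
c)` such multisets: each is coded by a binary number with at most `m + c` digits
(`exists_codedMultiset`). Counting placements instead would give `m ^ c`, which is not `2 ^ O(n)`
for sparse graphs with many cops. Since `c` is written in binary, `m + c` need not be bounded by the
length `n` of the input; but if `c ≥ m`, the cops can occupy the whole cop-region and never move, so
Robber loses (`RobberWins.cops_lt_order`). If `c < m`, then `m + c ≤ 2 * m ≤ n`. With prescribed
positions the word lists all cops, so again `m + c ≤ n`. Hence all relevant positions are coded by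
numbers below `B = 2 ^ (n + 1)`.

Robber wins from a position iff it lies in the attractor of the cop-region, the least set closed
under "some legal move of Robber enters the region, or leads into the set whatever the cops reply"
(`robberWinsFrom_iff`). A least fixed point on triples of numbers below `B` is reached after at most
`B ^ 3` rounds, so it is computed in time polynomial in `B`, that is, `2 ^ O(n)`.

To carry this out on a Turing machine, parsing, coding and game are all described by relations on
the numbers below `B`. These are built from the letters of the input and from addition by
connectives, quantifiers bounded by `B` and least fixed points. The predicate `Dec` says that a
property is decided by a while program in time polynomial in `B`; it is closed under these
constructions (`Dec.and`, `Dec.ex`, `DecRel.fix`). A while program is compiled to a one-tape machine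
with quadratic slow-down: a register is a mark on the tape cell whose number is its value
(`mem_DTIME_of_cmd`). So it remains to write both decision problems in this form, which is done in
`mem_Guard_iff` and `mem_GuardPSP_iff`. -/

/-! ### Structured programs on a one-sided tape -/

/-- Structured programs for a head on a tape that is infinite to the right. -/
inductive TapeProg (Γ : Type) : Type
  | act (g : Γ → Γ)
  | right
  | left
  | seq (p q : TapeProg Γ)
  | ite (c : Γ → Bool) (p q : TapeProg Γ)
  | loop (c : Γ → Bool) (p : TapeProg Γ)

namespace TapeProg

variable {Γ : Type}

/-- `Exec p f i t f' i'`: started on the tape `f` with the head on cell `i`, the program `p` ends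
after `t` steps on the tape `f'` with the head on cell `i'`, without ever leaving the tape. -/
inductive Exec : TapeProg Γ → (ℕ → Γ) → ℕ → ℕ → (ℕ → Γ) → ℕ → Prop
  | act (g f i) : Exec (act g) f i 1 (Function.update f i (g (f i))) i
  | right (f i) : Exec right f i 1 f (i + 1)
  | left (f i) : Exec left f (i + 1) 1 f i
  | seq {p q f i t f' i' t' f'' i''} : Exec p f i t f' i' → Exec q f' i' t' f'' i'' →
      Exec (seq p q) f i (t + t') f'' i''
  | ite_true {c p q f i t f' i'} : c (f i) = true → Exec p f i t f' i' →
      Exec (ite c p q) f i (t + 1) f' i'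
  | ite_false {c p q f i t f' i'} : c (f i) = false → Exec q f i t f' i' →
      Exec (ite c p q) f i (t + 1) f' i'
  | loop_false {c p f i} : c (f i) = false → Exec (loop c p) f i 1 f i
  | loop_true {c p f i t f' i' t' f₂ i₂} : c (f i) = true → Exec p f i t f' i' →
      Exec (loop c p) f' i' t' f₂ i₂ → Exec (loop c p) f i (t + t' + 1) f₂ i₂

/-- The control states of the machine that runs a program. -/
def State : TapeProg Γ → Type
  | act _ => Unit
  | right => Unit
  | left => Unit
  | seq p q => State p ⊕ State q
  | ite _ p q => Option (State p ⊕ State q)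
  | loop _ p => Option (State p)

theorem finite_state : (p : TapeProg Γ) → Finite (State p)
  | act _ => inferInstanceAs (Finite Unit)
  | right => inferInstanceAs (Finite Unit)
  | left => inferInstanceAs (Finite Unit)
  | seq p q =>
    have := finite_state p
    have := finite_state q
    inferInstanceAs (Finite (State p ⊕ State q))
  | ite _ p q =>
    have := finite_state p
    have := finite_state q
    inferInstanceAs (Finite (Option (State p ⊕ State q)))
  | loop _ p =>
    have := finite_state p
    inferInstanceAs (Finite (Option (State p)))

/-- The state in which the execution of a program starts. -/
def entry : (p : TapeProg Γ) → State p
  | act _ => ()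
  | right => ()
  | left => ()
  | seq p _ => Sum.inl (entry p)
  | ite _ _ _ => none
  | loop _ _ => none

open Turing in
/-- The transition function; the next state `none` means that the program has ended. -/
def trans : (p : TapeProg Γ) → State p → Γ → Option (State p) × TM0.Stmt Γ
  | act g, _, a => (none, .write (g a))
  | right, _, _ => (none, .move .right)
  | left, _, _ => (none, .move .left)
  | seq p q, Sum.inl s, a =>
      (some ((trans p s a).1.elim (Sum.inr (entry q)) Sum.inl), (trans p s a).2)
  | seq _ q, Sum.inr s, a => ((trans q s a).1.map Sum.inr, (trans q s a).2)
  | ite c p q, none, a =>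
      (some (some (if c a then Sum.inl (entry p) else Sum.inr (entry q))), .write a)
  | ite _ p _, some (Sum.inl s), a =>
      ((trans p s a).1.map (fun s' => some (Sum.inl s')), (trans p s a).2)
  | ite _ _ q, some (Sum.inr s), a =>
      ((trans q s a).1.map (fun s' => some (Sum.inr s')), (trans q s a).2)
  | loop c p, none, a => (if c a then some (some (entry p)) else none, .write a)
  | loop _ p, some s, a => (some (trans p s a).1, (trans p s a).2)

end TapeProg

/-! ### Machines on a one-sided tape -/

section HalfTape

open Turing

variable {Q Q' : Type} {Γ : Type}

/-- One step of a machine with transition function `δ` on a one-sided tape. -/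
inductive HalfStep (δ : Q → Γ → Option Q × TM0.Stmt Γ) :
    Q → (ℕ → Γ) → ℕ → Option Q → (ℕ → Γ) → ℕ → Prop
  | write {q f i q' a} : δ q (f i) = (q', .write a) →
      HalfStep δ q f i q' (Function.update f i a) i
  | right {q f i q'} : δ q (f i) = (q', .move .right) → HalfStep δ q f i q' f (i + 1)
  | left {q f i q₁} : δ q (f (i + 1)) = (q₁, .move .left) → HalfStep δ q f (i + 1) q₁ f i

/-- Runs of a given length of a machine on a one-sided tape. -/
inductive HalfReach (δ : Q → Γ → Option Q × TM0.Stmt Γ) :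
    ℕ → Option Q → (ℕ → Γ) → ℕ → Option Q → (ℕ → Γ) → ℕ → Prop
  | refl (x f i) : HalfReach δ 0 x f i x f i
  | head {q f i x f' i' t y f'' i''} : HalfStep δ q f i x f' i' →
      HalfReach δ t x f' i' y f'' i'' → HalfReach δ (t + 1) (some q) f i y f'' i''

theorem HalfReach.trans {δ : Q → Γ → Option Q × TM0.Stmt Γ} {t x f i y f' i' t' z f'' i''}
    (h : HalfReach δ t x f i y f' i') (h' : HalfReach δ t' y f' i' z f'' i'') :
    HalfReach δ (t + t') x f i z f'' i'' := by
  induction h with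
  | refl => simpa using h'
  | @head q f i x f' i' t y f'' i'' hs _ ih =>
    have := HalfReach.head hs (ih h')
    rwa [Nat.add_right_comm] at this

/-- The states of a part are embedded into those of the whole by `e`. The map `φ` is separate
because the end of a part need not be the end of the whole: in `seq` it becomes the entry of the
second program, in `loop` the return to the test. -/
theorem HalfReach.map {δ : Q → Γ → Option Q × TM0.Stmt Γ} {δ' : Q' → Γ → Option Q' × TM0.Stmt Γ}
    (e : Q → Q') (φ : Option Q → Option Q') (hφ : ∀ q, φ (some q) = some (e q))
    (hδ : ∀ q a, δ' (e q) a = (φ (δ q a).1, (δ q a).2)) {t x f i y f' i'}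
    (h : HalfReach δ t x f i y f' i') : HalfReach δ' t (φ x) f i (φ y) f' i' := by
  induction h with
  | refl => exact .refl _ _ _
  | head hs _ ih =>
    rw [hφ]
    refine HalfReach.head ?_ ih
    cases hs with
    | write h => exact .write (by rw [hδ, h])
    | right h => exact .right (by rw [hδ, h])
    | left h => exact .left (by rw [hδ, h])

theorem HalfReach.single {δ : Q → Γ → Option Q × TM0.Stmt Γ} {q f i x f' i'}
    (h : HalfStep δ q f i x f' i') : HalfReach δ 1 (some q) f i x f' i' :=
  .head h (.refl _ _ _)

/-- A step that leaves the tape unchanged. -/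
theorem HalfStep.idle {δ : Q → Γ → Option Q × TM0.Stmt Γ} {q : Q} {f : ℕ → Γ} {i : ℕ}
    {x : Option Q} (h : δ q (f i) = (x, .write (f i))) : HalfStep δ q f i x f i := by
  have := HalfStep.write h
  rwa [Function.update_eq_self] at this

theorem TapeProg.Exec.halfReach {p : TapeProg Γ} {f i t f' i'} (h : p.Exec f i t f' i') :
    HalfReach p.trans t (some p.entry) f i none f' i' := by
  induction h with
  | act g f i => exact .single (.write rfl)
  | right f i => exact .single (.right rfl)
  | left f i => exact .single (.left rfl)
  | @seq p q f i t f' i' t' f'' i'' _ _ ih₁ ih₂ =>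
    have h₁ := ih₁.map (δ' := (TapeProg.seq p q).trans) Sum.inl
      (fun x => some (x.elim (Sum.inr q.entry) Sum.inl)) (fun _ => rfl) (fun _ _ => rfl)
    have h₂ := ih₂.map (δ' := (TapeProg.seq p q).trans) Sum.inr
      (Option.map Sum.inr) (fun _ => rfl) (fun _ _ => rfl)
    exact h₁.trans h₂
  | @ite_true c p q f i t f' i' hc _ ih =>
    have h₁ := ih.map (δ' := (TapeProg.ite c p q).trans) (fun s => some (Sum.inl s))
      (Option.map (fun s => some (Sum.inl s))) (fun _ => rfl) (fun _ _ => rfl)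
    exact .head (.idle (by simp only [TapeProg.trans, TapeProg.entry, hc]; rfl)) h₁
  | @ite_false c p q f i t f' i' hc _ ih =>
    have h₁ := ih.map (δ' := (TapeProg.ite c p q).trans) (fun s => some (Sum.inr s))
      (Option.map (fun s => some (Sum.inr s))) (fun _ => rfl) (fun _ _ => rfl)
    exact .head (.idle (by simp only [TapeProg.trans, TapeProg.entry, hc]; rfl)) h₁
  | @loop_false c p f i hc =>
    exact .single (.idle (by simp [TapeProg.trans, TapeProg.entry, hc]))
  | @loop_true c p f i t f' i' t' f'' i'' hc _ _ ih₁ ih₂ =>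
    have h₁ := ih₁.map (δ' := (TapeProg.loop c p).trans) some some (fun _ => rfl) (fun _ _ => rfl)
    exact .head (.idle (by simp only [TapeProg.trans, TapeProg.entry, hc]; rfl)) (h₁.trans ih₂)

/-! ### Simulation of the half-line on a two-sided tape -/

/-- The two-sided tape `T` agrees with the one-sided tape `f` with the head on cell `i`. -/
def TapeAgrees [Inhabited Γ] (T : Tape Γ) (f : ℕ → Γ) (i : ℕ) : Prop :=
  ∀ j : ℕ, T.nth ((j : ℤ) - i) = f j

theorem TapeAgrees.head [Inhabited Γ] {T : Tape Γ} {f : ℕ → Γ} {i : ℕ} (h : TapeAgrees T f i) :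
    T.head = f i := by
  have := h i
  simpa using this

theorem TapeAgrees.write [Inhabited Γ] {T : Tape Γ} {f : ℕ → Γ} {i : ℕ} (h : TapeAgrees T f i)
    (a : Γ) : TapeAgrees (T.write a) (Function.update f i a) i := by
  intro j
  rw [Tape.write_nth, Function.update_apply]
  have : (j : ℤ) - i = 0 ↔ j = i := by omega
  simp only [this, h j]

theorem TapeAgrees.right [Inhabited Γ] {T : Tape Γ} {f : ℕ → Γ} {i : ℕ} (h : TapeAgrees T f i) :
    TapeAgrees (T.move .right) f (i + 1) := by
  intro j
  rw [Tape.move_right_nth, ← h j]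
  congr 1
  push_cast
  ring

theorem TapeAgrees.left [Inhabited Γ] {T : Tape Γ} {f : ℕ → Γ} {i : ℕ}
    (h : TapeAgrees T f (i + 1)) : TapeAgrees (T.move .left) f i := by
  intro j
  rw [Tape.move_left_nth, ← h j]
  congr 1
  push_cast
  ring

/-- The input starts on cell `0`, and `getI` supplies the blank beyond its end. The cells to the
left of the origin remain unspecified, since an execution never visits them. -/
theorem tapeAgrees_mk₁ [Inhabited Γ] (l : List Γ) :
    TapeAgrees (Tape.mk₁ l) (fun j => l.getI j) 0 := by
  intro j
  cases l with
  | nil => cases j <;> simp [Tape.mk₁, Tape.mk₂, Tape.mk', Tape.nth] <;> rfl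
  | cons a l => cases j <;> simp [Tape.mk₁, Tape.mk₂, Tape.mk', Tape.nth] <;> rfl

end HalfTape

/-! ### One-tape machines from structured programs -/

section Machine

open Turing

/-- The machine that runs `p` and then accepts if the scanned symbol satisfies `ans`. -/
def TapeProg.machine {Γ : Type} [Inhabited Γ] [Finite Γ] (sym : Bool → Γ)
    (hinj : Function.Injective sym) (hne : ∀ b, sym b ≠ default) (p : TapeProg Γ)
    (ans : Γ → Bool) : OneTapeTM :=
  haveI := p.finite_state
  { Γ := Γ
    Λ := Option p.State ⊕ Bool
    inhabitedΛ := ⟨Sum.inl (some p.entry)⟩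
    symbol := sym
    symbol_injective := hinj
    symbol_ne_blank := hne
    program := fun q a => match q with
      | Sum.inl (some s) => some (Sum.inl (p.trans s a).1, (p.trans s a).2)
      | Sum.inl none => some (Sum.inr (ans a), .write a)
      | Sum.inr _ => none
    accepting := {Sum.inr true} }

theorem OneTapeTM.run_succ (M : OneTapeTM) (w : List Bool) (t : ℕ) :
    M.run w (t + 1) = (M.run w t).bind (TM0.step M.program) := by
  simp only [OneTapeTM.run, Function.iterate_succ_apply']

variable {Γ : Type} [Inhabited Γ] [Finite Γ] {sym : Bool → Γ} {hinj : Function.Injective sym}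
  {hne : ∀ b, sym b ≠ default} {p : TapeProg Γ} {ans : Γ → Bool}

theorem TapeProg.machine_run_halfReach (w : List Bool) {t₀ t x f i y f' i'}
    (h : HalfReach p.trans t x f i y f' i') (T : Tape Γ) (hT : TapeAgrees T f i)
    (hrun : (p.machine sym hinj hne ans).run w t₀ = some ⟨Sum.inl x, T⟩) :
    ∃ T', TapeAgrees T' f' i' ∧
      (p.machine sym hinj hne ans).run w (t₀ + t) = some ⟨Sum.inl y, T'⟩ := by
  induction h generalizing t₀ T with
  | refl => exact ⟨T, hT, hrun⟩
  | @head q f i x f' i' t y f'' i'' hs _ ih =>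
    have hh : T.head = f i := hT.head
    have key : ∀ T', TapeAgrees T' f' i' → TM0.step (p.machine sym hinj hne ans).program
        ⟨Sum.inl (some q), T⟩ = some ⟨Sum.inl x, T'⟩ → ∃ T', TapeAgrees T' f'' i'' ∧
      (p.machine sym hinj hne ans).run w (t₀ + (t + 1)) = some ⟨Sum.inl y, T'⟩ := by
      intro T' hT' hstep
      have h1 : (p.machine sym hinj hne ans).run w (t₀ + 1) = some ⟨Sum.inl x, T'⟩ := by
        rw [OneTapeTM.run_succ, hrun]
        exact hstep
      obtain ⟨T'', h2, h3⟩ := ih T' hT' h1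
      exact ⟨T'', h2, by rw [← h3]; congr 1; omega⟩
    cases hs with
    | write h =>
      refine key _ (hT.write _) ?_
      simp only [TM0.step, TapeProg.machine]
      rw [hh, h]
      rfl
    | right h =>
      refine key _ hT.right ?_
      simp only [TM0.step, TapeProg.machine]
      rw [hh, h]
      rfl
    | left h =>
      refine key _ hT.left ?_
      simp only [TM0.step, TapeProg.machine]
      rw [hh, h]
      rfl

theorem TapeProg.machine_decides {L : Language Bool} {T : ℕ → ℕ}
    (h : ∀ w : List Bool, ∃ t f' i', t + 1 ≤ T w.length ∧
      p.Exec (fun j => (w.map sym).getI j) 0 t f' i' ∧ (ans (f' i') = true ↔ w ∈ L)) :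
    (p.machine sym hinj hne ans).DecidesInTime L T := by
  intro w
  obtain ⟨t, f', i', ht, hex, hL⟩ := h w
  obtain ⟨T', hT', hrun⟩ := TapeProg.machine_run_halfReach (sym := sym) (hinj := hinj) (hne := hne)
    (ans := ans) w (t₀ := 0) hex.halfReach (Tape.mk₁ (w.map sym)) (tapeAgrees_mk₁ _) rfl
  -- After the run of `p` one more step stores the answer in the control state, where no transition
  -- is defined.
  refine ⟨t + 1, ht, ⟨Sum.inr (ans (f' i')), T'.write T'.head⟩, ?_, rfl, ?_⟩
  · rw [OneTapeTM.run_succ]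
    rw [Nat.zero_add] at hrun
    rw [hrun, ← hT'.head]
    rfl
  · rw [← hL]
    exact Sum.inr_injective.eq_iff

end Machine

/-! ### A while language with registers and bit arrays -/

/-- A memory state: registers with natural numbers, bit arrays and a flag. -/
structure RAM where
  reg : ℕ → ℕ
  arr : ℕ → ℕ → Bool
  flag : Bool

namespace RAM

/-- The state in which `v` is written into register `x`. -/
def setReg (s : RAM) (x v : ℕ) : RAM := { s with reg := Function.update s.reg x v }

/-- The state in which `b` is written into cell `i` of array `a`. -/
def setArr (s : RAM) (a i : ℕ) (b : Bool) : RAM :=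
  { s with arr := Function.update s.arr a (Function.update (s.arr a) i b) }

/-- The state in which the flag is set to `b`. -/
def setFlag (s : RAM) (b : Bool) : RAM := { s with flag := b }

@[simp] theorem setReg_reg (s : RAM) (x v y : ℕ) :
    (s.setReg x v).reg y = if y = x then v else s.reg y := by
  simp [setReg, Function.update_apply]

@[simp] theorem setReg_arr (s : RAM) (x v : ℕ) : (s.setReg x v).arr = s.arr := rfl
@[simp] theorem setReg_flag (s : RAM) (x v : ℕ) : (s.setReg x v).flag = s.flag := rfl
@[simp] theorem setArr_reg (s : RAM) (a i : ℕ) (b : Bool) : (s.setArr a i b).reg = s.reg := rfl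
@[simp] theorem setArr_flag (s : RAM) (a i : ℕ) (b : Bool) : (s.setArr a i b).flag = s.flag := rfl

@[simp] theorem setArr_arr (s : RAM) (a i : ℕ) (b : Bool) (a' i' : ℕ) :
    (s.setArr a i b).arr a' i' = if a' = a ∧ i' = i then b else s.arr a' i' := by
  by_cases h : a' = a
  · subst h
    simp [setArr, Function.update_apply]
  · simp [setArr, h]

@[simp] theorem setFlag_reg (s : RAM) (b : Bool) : (s.setFlag b).reg = s.reg := rfl
@[simp] theorem setFlag_arr (s : RAM) (b : Bool) : (s.setFlag b).arr = s.arr := rfl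
@[simp] theorem setFlag_flag (s : RAM) (b : Bool) : (s.setFlag b).flag = b := rfl

end RAM

/-- Elementary operations. -/
inductive Op : Type
  | copy (x y : ℕ)
  | inc (x : ℕ)
  | testNe (x y : ℕ)
  | testInp (o : Option Bool) (x : ℕ)
  | testArr (a x : ℕ)
  | setArr (a x : ℕ) (b : Bool)
  | setFlag (b : Bool)
  | negFlag

/-- The effect of an elementary operation; `w` is the input word. -/
def Op.apply (w : List Bool) (s : RAM) : Op → RAM
  | copy x y => s.setReg x (s.reg y)
  | inc x => s.setReg x (s.reg x + 1)
  | testNe x y => s.setFlag (decide (s.reg x ≠ s.reg y))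
  | testInp o x => s.setFlag (decide (w[s.reg x]? = o))
  | testArr a x => s.setFlag (s.arr a (s.reg x))
  | setArr a x b => s.setArr a (s.reg x) b
  | setFlag b => s.setFlag b
  | negFlag => s.setFlag !s.flag

/-- Programs of the while language; branching and loops are controlled by the flag. -/
inductive Cmd : Type
  | op (o : Op)
  | seq (p q : Cmd)
  | ite (p q : Cmd)
  | loop (p : Cmd)

/-- `Exec w p s t s'`: on the input `w`, started in `s`, the program `p` ends in `s'` after `t`
steps. -/
inductive Cmd.Exec (w : List Bool) : Cmd → RAM → ℕ → RAM → Prop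
  | op (o s) : Exec w (op o) s 1 (o.apply w s)
  | seq {p q s t s' t' s''} : Exec w p s t s' → Exec w q s' t' s'' → Exec w (seq p q) s (t + t') s''
  | ite_true {p q s t s'} : s.flag = true → Exec w p s t s' → Exec w (ite p q) s (t + 1) s'
  | ite_false {p q s t s'} : s.flag = false → Exec w q s t s' → Exec w (ite p q) s (t + 1) s'
  | loop_false {p s} : s.flag = false → Exec w (loop p) s 1 s
  | loop_true {p s t s' t₂ s₂} : s.flag = true → Exec w p s t s' → Exec w (loop p) s' t₂ s₂ →
      Exec w (loop p) s (t + t₂ + 1) s₂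

/-- All registers and arrays of the operation have numbers at most `K`. -/
def Op.Bounded (K : ℕ) : Op → Prop
  | copy x y => x ≤ K ∧ y ≤ K
  | inc x => x ≤ K
  | testNe x y => x ≤ K ∧ y ≤ K
  | testInp _ x => x ≤ K
  | testArr a x => a ≤ K ∧ x ≤ K
  | setArr a x _ => a ≤ K ∧ x ≤ K
  | setFlag _ => True
  | negFlag => True

/-- All registers and arrays of the program have numbers at most `K`. -/
def Cmd.Bounded (K : ℕ) : Cmd → Prop
  | op o => o.Bounded K
  | seq p q => p.Bounded K ∧ q.Bounded K
  | ite p q => p.Bounded K ∧ q.Bounded K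
  | loop p => p.Bounded K

theorem Op.exists_bounded (o : Op) : ∃ K₀, ∀ K ≥ K₀, o.Bounded K := by
  cases o with
  | copy x y => exact ⟨x + y, fun K h => ⟨by omega, by omega⟩⟩
  | inc x => exact ⟨x, fun K h => h⟩
  | testNe x y => exact ⟨x + y, fun K h => ⟨by omega, by omega⟩⟩
  | testInp _ x => exact ⟨x, fun K h => h⟩
  | testArr a x => exact ⟨a + x, fun K h => ⟨by omega, by omega⟩⟩
  | setArr a x _ => exact ⟨a + x, fun K h => ⟨by omega, by omega⟩⟩
  | setFlag _ => exact ⟨0, fun K h => trivial⟩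
  | negFlag => exact ⟨0, fun K h => trivial⟩

/-- A program mentions finitely many registers and arrays, so a number of tracks independent of the
input suffices and the tape alphabet is finite. -/
theorem Cmd.exists_bounded (p : Cmd) : ∃ K₀, ∀ K ≥ K₀, p.Bounded K := by
  induction p with
  | op o => exact o.exists_bounded
  | seq p q hp hq =>
    obtain ⟨a, ha⟩ := hp
    obtain ⟨b, hb⟩ := hq
    exact ⟨a + b, fun K h => ⟨ha K (by omega), hb K (by omega)⟩⟩
  | ite p q hp hq =>
    obtain ⟨a, ha⟩ := hp
    obtain ⟨b, hb⟩ := hq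
    exact ⟨a + b, fun K h => ⟨ha K (by omega), hb K (by omega)⟩⟩
  | loop p hp => exact hp

/-! ### Memory states on a tape -/

theorem TapeProg.Exec.of_eq {Γ : Type} {p : TapeProg Γ} {f f' f'' : ℕ → Γ} {i i' t t' : ℕ}
    (h : p.Exec f i t f' i') (ht : t = t') (hf : f' = f'') : p.Exec f i t' f'' i' := by
  subst ht hf
  exact h


/-- The tracks of the tape: one for each register and each array, one for the flag (`false`) and
one that marks the first cell (`true`). -/
abbrev Track (K : ℕ) : Type := Fin (K + 1) ⊕ Fin (K + 1) ⊕ Bool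

/-- The tape symbols: a letter of the input word, if any, and a bit on each track. -/
abbrev Cell (K : ℕ) : Type := Option Bool × (Track K → Bool)

section Layout

variable {K : ℕ}

/-- The track of register `x`. -/
def regTrack (K x : ℕ) : Track K := Sum.inl (Fin.ofNat (K + 1) x)

/-- The track of array `a`. -/
def arrTrack (K a : ℕ) : Track K := Sum.inr (Sum.inl (Fin.ofNat (K + 1) a))

/-- The track of the flag. -/
def flagTrack (K : ℕ) : Track K := Sum.inr (Sum.inr false)

/-- The track that marks the first cell. -/
def originTrack (K : ℕ) : Track K := Sum.inr (Sum.inr true)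

/-- The tape with given input word and tracks. -/
def layout (w : List Bool) (T : Track K → ℕ → Bool) : ℕ → Cell K := fun i => (w[i]?, fun τ => T τ i)

/-- The tracks that represent a memory state: a register is represented by a mark on the cell whose
number is the value of the register. -/
def RAM.tracks (s : RAM) : Track K → ℕ → Bool
  | Sum.inl x, i => decide (s.reg x = i)
  | Sum.inr (Sum.inl a), i => s.arr a i
  | Sum.inr (Sum.inr true), i => decide (i = 0)
  | Sum.inr (Sum.inr false), i => decide (i = 0) && s.flag

/-- Write a bit on one cell of a track. -/
def setTrack (T : Track K → ℕ → Bool) (τ : Track K) (i : ℕ) (b : Bool) : Track K → ℕ → Bool :=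
  Function.update T τ (Function.update (T τ) i b)

open TapeProg in
/-- Write a bit on a track of the scanned cell. -/
def writeBit (τ : Track K) (b : Bool) : TapeProg (Cell K) :=
  act fun c => (c.1, Function.update c.2 τ b)

open TapeProg in
/-- Go right to the first cell that is marked on a track. -/
def seek (τ : Track K) : TapeProg (Cell K) := loop (fun c => !c.2 τ) right

open TapeProg in
/-- Go left to the first cell. -/
def home (K : ℕ) : TapeProg (Cell K) := loop (fun c => !c.2 (originTrack K)) left

theorem exec_writeBit (w : List Bool) (T : Track K → ℕ → Bool) (τ : Track K) (b : Bool) (i : ℕ) :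
    (writeBit τ b).Exec (layout w T) i 1 (layout w (setTrack T τ i b)) i := by
  refine (TapeProg.Exec.act (fun c : Cell K => (c.1, Function.update c.2 τ b)) (layout w T)
    i).of_eq rfl ?_
  funext j
  simp only [layout, setTrack, Function.update_apply]
  split_ifs with hj
  · subst hj
    refine Prod.ext rfl (funext fun σ => ?_)
    by_cases h : σ = τ
    · subst h; simp
    · simp [h]
  · refine Prod.ext rfl (funext fun σ => ?_)
    by_cases h : σ = τ
    · subst h; simp [hj]
    · simp [h]

/-- The only mark of the track is on cell `j`, so the search stops there; each cell passed costs a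
test and a move. -/
theorem exec_seek (w : List Bool) (T : Track K → ℕ → Bool) (τ : Track K) (j : ℕ)
    (h : ∀ l, T τ l = decide (j = l)) :
    (seek τ).Exec (layout w T) 0 (2 * j + 1) (layout w T) j := by
  have key : ∀ n i, i + n = j → (seek τ).Exec (layout w T) i (2 * n + 1) (layout w T) j := by
    intro n
    induction n with
    | zero =>
      rintro i rfl
      exact .loop_false (by simp [layout, h])
    | succ n ih =>
      intro i hi
      have := TapeProg.Exec.loop_true (c := fun c : Cell K => !c.2 τ) (f := layout w T) (i := i)
        (by simp [layout, h]; omega) (.right _ _) (ih (i + 1) (by omega))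
      exact this.of_eq (by omega) rfl
  exact key j 0 (by omega)

theorem exec_home (w : List Bool) (T : Track K → ℕ → Bool) (i : ℕ)
    (h : ∀ l, T (originTrack K) l = decide (l = 0)) :
    (home K).Exec (layout w T) i (2 * i + 1) (layout w T) 0 := by
  induction i with
  | zero => exact .loop_false (by simp [layout, h])
  | succ i ih =>
    have := TapeProg.Exec.loop_true (c := fun c : Cell K => !c.2 (originTrack K)) (f := layout w T)
      (i := i + 1) (by simp [layout, h]) (.left _ _) ih
    exact this.of_eq (by omega) rfl

open TapeProg in
/-- Test the marked cell of register `x` and record the result as the flag. -/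
def testAt (K x : ℕ) (c : Cell K → Bool) : TapeProg (Cell K) :=
  seq (seek (regTrack K x)) (ite c (seq (home K) (writeBit (flagTrack K) true))
    (seq (home K) (writeBit (flagTrack K) false)))

open TapeProg in
/-- The tape program of an elementary operation. -/
def Op.compile (K : ℕ) : Op → TapeProg (Cell K)
  | copy x y =>
    if x = y then act id else
      seq (seek (regTrack K x)) (seq (writeBit (regTrack K x) false) (seq (home K)
        (seq (seek (regTrack K y)) (seq (writeBit (regTrack K x) true) (home K)))))
  | inc x =>
    seq (seek (regTrack K x)) (seq (writeBit (regTrack K x) false) (seq right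
      (seq (writeBit (regTrack K x) true) (home K))))
  | testNe x y => testAt K x fun c => !c.2 (regTrack K y)
  | testInp o x => testAt K x fun c => decide (c.1 = o)
  | testArr a x => testAt K x fun c => c.2 (arrTrack K a)
  | setArr a x b => seq (seek (regTrack K x)) (seq (writeBit (arrTrack K a) b) (home K))
  | setFlag b => writeBit (flagTrack K) b
  | negFlag => ite (fun c => c.2 (flagTrack K)) (writeBit (flagTrack K) false)
      (writeBit (flagTrack K) true)

theorem tracks_regTrack (s : RAM) {x : ℕ} (hx : x ≤ K) (i : ℕ) :
    s.tracks (regTrack K x) i = decide (s.reg x = i) := by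
  simp [regTrack, RAM.tracks, Nat.mod_eq_of_lt (Nat.lt_succ_of_le hx)]

theorem tracks_arrTrack (s : RAM) {a : ℕ} (ha : a ≤ K) (i : ℕ) :
    s.tracks (arrTrack K a) i = s.arr a i := by
  simp [arrTrack, RAM.tracks, Nat.mod_eq_of_lt (Nat.lt_succ_of_le ha)]

theorem tracks_flagTrack (s : RAM) (i : ℕ) :
    s.tracks (flagTrack K) i = (decide (i = 0) && s.flag) := rfl

theorem setTrack_of_ne (T : Track K → ℕ → Bool) {σ τ : Track K} (h : σ ≠ τ) (i : ℕ) (b : Bool) :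
    setTrack T τ i b σ = T σ := Function.update_of_ne h _ _

theorem setTrack_self (T : Track K → ℕ → Bool) (τ : Track K) (i : ℕ) (b : Bool) :
    setTrack T τ i b τ = Function.update (T τ) i b := Function.update_self _ _ _

theorem exists_regTrack {x : ℕ} (hx : x ≤ K) :
    ∃ e : Fin (K + 1), regTrack K x = Sum.inl e ∧ (e : ℕ) = x :=
  ⟨_, rfl, by simp [Nat.mod_eq_of_lt (Nat.lt_succ_of_le hx)]⟩

theorem exists_arrTrack {a : ℕ} (ha : a ≤ K) :
    ∃ e : Fin (K + 1), arrTrack K a = Sum.inr (Sum.inl e) ∧ (e : ℕ) = a :=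
  ⟨_, rfl, by simp [Nat.mod_eq_of_lt (Nat.lt_succ_of_le ha)]⟩

theorem setTrack_flagTrack (s : RAM) (b : Bool) :
    setTrack s.tracks (flagTrack K) 0 b = (s.setFlag b).tracks := by
  funext τ i
  by_cases h : τ = flagTrack K
  · subst h
    rw [setTrack_self, Function.update_apply, tracks_flagTrack, tracks_flagTrack]
    by_cases hi : i = 0 <;> simp [hi]
  · rw [setTrack_of_ne _ h]
    rcases τ with x | a | _ | _
    · rfl
    · rfl
    · exact absurd rfl h
    · rfl

theorem setTrack_arrTrack (s : RAM) {a : ℕ} (ha : a ≤ K) (i : ℕ) (b : Bool) :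
    setTrack s.tracks (arrTrack K a) i b = (s.setArr a i b).tracks := by
  funext τ j
  by_cases h : τ = arrTrack K a
  · subst h
    rw [setTrack_self, Function.update_apply, tracks_arrTrack _ ha, tracks_arrTrack _ ha,
      RAM.setArr_arr]
    simp
  · rw [setTrack_of_ne _ h]
    rcases τ with x | a' | _ | _
    · rfl
    · obtain ⟨e, he, hv⟩ := exists_arrTrack ha
      have h' : (a' : ℕ) ≠ a := fun e' => h (by rw [he, Fin.ext (e'.trans hv.symm)])
      simp [RAM.tracks, h']
    · rfl
    · rfl

/-- A register changes its value by moving its single mark. The mark is erased before it is set, so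
the case in which `j` is the old value is no exception. -/
theorem setTrack_regTrack_move (s : RAM) {x : ℕ} (hx : x ≤ K) (j : ℕ) :
    setTrack (setTrack s.tracks (regTrack K x) (s.reg x) false) (regTrack K x) j true =
      (s.setReg x j).tracks := by
  funext τ i
  by_cases h : τ = regTrack K x
  · subst h
    rw [setTrack_self, setTrack_self, Function.update_apply, Function.update_apply,
      tracks_regTrack _ hx, tracks_regTrack _ hx, RAM.setReg_reg, if_pos rfl]
    split_ifs with h1 h2
    · simp [h1]
    · simp [Ne.symm h1]
    · simp [Ne.symm h1, Ne.symm h2]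
  · rw [setTrack_of_ne _ h, setTrack_of_ne _ h]
    rcases τ with y | a' | _ | _
    · obtain ⟨e, he, hv⟩ := exists_regTrack hx
      have h' : (y : ℕ) ≠ x := fun e' => h (by rw [he, Fin.ext (e'.trans hv.symm)])
      simp [RAM.tracks, h']
    · rfl
    · rfl
    · rfl

theorem exec_testAt (w : List Bool) (s : RAM) {x : ℕ} (hx : x ≤ K) (c : Cell K → Bool) (b : Bool)
    (hb : c (layout w s.tracks (s.reg x)) = b) :
    (testAt K x c).Exec (layout w s.tracks) 0 (4 * s.reg x + 4)
      (layout w (s.setFlag b).tracks) 0 := by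
  have h₁ := exec_seek w s.tracks (regTrack K x) (s.reg x) (fun l => tracks_regTrack s hx l)
  have h₂ := exec_home w (K := K) s.tracks (s.reg x) (fun l => rfl)
  have h₃ := fun b => exec_writeBit w s.tracks (flagTrack K) b 0
  simp only [setTrack_flagTrack] at h₃
  cases b with
  | true =>
    have := h₁.seq (.ite_true (q := .seq (home K) (writeBit (flagTrack K) false)) hb
      (h₂.seq (h₃ true)))
    exact this.of_eq (by omega) rfl
  | false =>
    have := h₁.seq (.ite_false (p := .seq (home K) (writeBit (flagTrack K) true)) hb
      (h₂.seq (h₃ false)))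
    exact this.of_eq (by omega) rfl

theorem Op.exec_compile (w : List Bool) (s : RAM) (o : Op) (ho : o.Bounded K) {N : ℕ}
    (hN : ∀ x ≤ K, s.reg x ≤ N) :
    ∃ t ≤ 8 * (N + 1), (o.compile K).Exec (layout w s.tracks) 0 t
      (layout w (o.apply w s).tracks) 0 := by
  cases o with
  | copy x y =>
    have hx := hN x ho.1
    have hy := hN y ho.2
    -- For `x = y` the general program would erase the very mark that it seeks next, hence the
    -- separate idle step.
    by_cases hxy : x = y
    · subst hxy
      refine ⟨1, by omega, ?_⟩
      have h := TapeProg.Exec.act id (layout w (K := K) s.tracks) 0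
      rw [id, Function.update_eq_self] at h
      simp only [Op.compile, if_true, Op.apply]
      convert h using 2
      simp [RAM.setReg]
    · have h₁ := exec_seek w s.tracks (regTrack K x) (s.reg x) (fun l => tracks_regTrack s ho.1 l)
      have h₂ := exec_writeBit w s.tracks (regTrack K x) false (s.reg x)
      have h₃ := exec_home w (setTrack s.tracks (regTrack K x) (s.reg x) false) (s.reg x)
        (fun l => by simp [setTrack, regTrack, originTrack, RAM.tracks])
      have hne : regTrack K y ≠ regTrack K x := by
        obtain ⟨e, he, hv⟩ := exists_regTrack ho.1
        obtain ⟨e', he', hv'⟩ := exists_regTrack ho.2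
        rw [he, he', ne_eq, Sum.inl.injEq]
        rintro rfl
        exact hxy (hv.symm.trans hv')
      have h₄ := exec_seek w (setTrack s.tracks (regTrack K x) (s.reg x) false) (regTrack K y)
        (s.reg y) (fun l => by
          rw [setTrack, Function.update_of_ne hne, tracks_regTrack s ho.2])
      have h₅ := exec_writeBit w (setTrack s.tracks (regTrack K x) (s.reg x) false)
        (regTrack K x) true (s.reg y)
      rw [setTrack_regTrack_move s ho.1] at h₅
      have h₆ := exec_home w (K := K) (s.setReg x (s.reg y)).tracks (s.reg y) (fun l => rfl)
      have := h₁.seq (h₂.seq (h₃.seq (h₄.seq (h₅.seq h₆))))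
      simp only [Op.compile, if_neg hxy, Op.apply]
      exact ⟨_, by omega, this⟩
  | inc x =>
    have hx := hN x ho
    have h₁ := exec_seek w s.tracks (regTrack K x) (s.reg x) (fun l => tracks_regTrack s ho l)
    have h₂ := exec_writeBit w s.tracks (regTrack K x) false (s.reg x)
    have h₅ := exec_writeBit w (setTrack s.tracks (regTrack K x) (s.reg x) false)
      (regTrack K x) true (s.reg x + 1)
    rw [setTrack_regTrack_move s ho] at h₅
    have h₆ := exec_home w (K := K) (s.setReg x (s.reg x + 1)).tracks (s.reg x + 1) (fun l => rfl)
    exact ⟨_, by omega, h₁.seq (h₂.seq ((TapeProg.Exec.right _ _).seq (h₅.seq h₆)))⟩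
  | testNe x y =>
    have hx := hN x ho.1
    exact ⟨_, by omega, exec_testAt w s ho.1 _ _
      (by simp [layout, tracks_regTrack s ho.2, eq_comm])⟩
  | testInp o x =>
    have hx := hN x ho
    exact ⟨_, by omega, exec_testAt w s ho _ _ (by simp only [layout]; rfl)⟩
  | testArr a x =>
    have hx := hN x ho.2
    exact ⟨_, by omega, exec_testAt w s ho.2 _ _ (by simp [layout, tracks_arrTrack s ho.1])⟩
  | setArr a x b =>
    have hx := hN x ho.2
    have h₁ := exec_seek w s.tracks (regTrack K x) (s.reg x) (fun l => tracks_regTrack s ho.2 l)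
    have h₂ := exec_writeBit w s.tracks (arrTrack K a) b (s.reg x)
    rw [setTrack_arrTrack s ho.1] at h₂
    have h₃ := exec_home w (K := K) (s.setArr a (s.reg x) b).tracks (s.reg x) (fun l => rfl)
    exact ⟨_, by omega, h₁.seq (h₂.seq h₃)⟩
  | setFlag b =>
    have h := exec_writeBit w s.tracks (flagTrack K) b 0
    rw [setTrack_flagTrack] at h
    exact ⟨1, by omega, h⟩
  | negFlag =>
    have h := fun b => exec_writeBit w s.tracks (flagTrack K) b 0
    simp only [setTrack_flagTrack] at h
    cases hf : s.flag with
    | true =>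
      refine ⟨2, by omega, ?_⟩
      simp only [Op.apply, hf]
      exact .ite_true (by simp [layout, tracks_flagTrack, hf]) (h false)
    | false =>
      refine ⟨2, by omega, ?_⟩
      simp only [Op.apply, hf]
      exact .ite_false (by simp [layout, tracks_flagTrack, hf]) (h true)

/-- An operation raises the largest register by at most one. Time therefore bounds all registers,
and with them the distance that the head travels. -/
theorem Op.apply_reg_le (w : List Bool) (s : RAM) (o : Op) (ho : o.Bounded K) {m : ℕ}
    (hm : ∀ x ≤ K, s.reg x ≤ m) : ∀ x ≤ K, (o.apply w s).reg x ≤ m + 1 := by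
  intro z hz
  have h := hm z hz
  cases o with
  | copy x y =>
    have hy := hm y ho.2
    simp only [Op.apply, RAM.setReg_reg]
    split_ifs <;> omega
  | inc x =>
    have hy := hm x ho
    simp only [Op.apply, RAM.setReg_reg]
    split_ifs <;> omega
  | testNe x y => exact h.trans (Nat.le_succ m)
  | testInp o x => exact h.trans (Nat.le_succ m)
  | testArr a x => exact h.trans (Nat.le_succ m)
  | setArr a x b => exact h.trans (Nat.le_succ m)
  | setFlag b => exact h.trans (Nat.le_succ m)
  | negFlag => exact h.trans (Nat.le_succ m)

/-- The tape program of a program. -/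
def Cmd.compile (K : ℕ) : Cmd → TapeProg (Cell K)
  | op o => o.compile K
  | seq p q => .seq (p.compile K) (q.compile K)
  | ite p q => .ite (fun c => c.2 (flagTrack K)) (p.compile K) (q.compile K)
  | loop p => .loop (fun c => c.2 (flagTrack K)) (p.compile K)

/-- All registers stay below `m + t ≤ N` throughout, so every step of the program costs at most `8 *
(N + 1)` steps on the tape: the slow-down is quadratic. -/
theorem Cmd.Exec.compile {w : List Bool} {p : Cmd} {s s' : RAM} {t : ℕ} (h : p.Exec w s t s')
    (hp : p.Bounded K) {m N : ℕ} (hm : ∀ x ≤ K, s.reg x ≤ m) (hN : m + t ≤ N) :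
    (∀ x ≤ K, s'.reg x ≤ m + t) ∧ ∃ t' ≤ 8 * (N + 1) * t,
      (p.compile K).Exec (layout w s.tracks) 0 t' (layout w s'.tracks) 0 := by
  induction h generalizing m with
  | op o s =>
    refine ⟨o.apply_reg_le w s hp hm, ?_⟩
    rw [mul_one]
    exact o.exec_compile w s hp (fun x hx => (hm x hx).trans (by omega))
  | @seq p q s t s' t' s'' _ _ ih₁ ih₂ =>
    obtain ⟨h₁, t₁, ht₁, he₁⟩ := ih₁ hp.1 hm (by omega)
    obtain ⟨h₂, t₂, ht₂, he₂⟩ := ih₂ hp.2 h₁ (by omega)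
    refine ⟨fun x hx => (h₂ x hx).trans (by omega), _, ?_, he₁.seq he₂⟩
    rw [mul_add]
    omega
  | @ite_true p q s t s' hf _ ih =>
    obtain ⟨h₁, t₁, ht₁, he₁⟩ := ih hp.1 hm (by omega)
    refine ⟨fun x hx => (h₁ x hx).trans (by omega), _, ?_,
      .ite_true (by simp [layout, tracks_flagTrack, hf]) he₁⟩
    rw [mul_add]
    omega
  | @ite_false p q s t s' hf _ ih =>
    obtain ⟨h₁, t₁, ht₁, he₁⟩ := ih hp.2 hm (by omega)
    refine ⟨fun x hx => (h₁ x hx).trans (by omega), _, ?_,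
      .ite_false (by simp [layout, tracks_flagTrack, hf]) he₁⟩
    rw [mul_add]
    omega
  | @loop_false p s hf =>
    exact ⟨fun x hx => (hm x hx).trans (by omega), _, by omega,
      .loop_false (by simp [layout, tracks_flagTrack, hf])⟩
  | @loop_true p s t s' t' s'' hf _ _ ih₁ ih₂ =>
    obtain ⟨h₁, t₁, ht₁, he₁⟩ := ih₁ hp hm (by omega)
    obtain ⟨h₂, t₂, ht₂, he₂⟩ := ih₂ hp h₁ (by omega)
    refine ⟨fun x hx => (h₂ x hx).trans (by omega), _, ?_,
      .loop_true (by simp [layout, tracks_flagTrack, hf]) he₁ he₂⟩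
    rw [mul_add, mul_add]
    omega

end Layout

/-! ### Deciding languages by programs -/

/-- The initial memory state. -/
def RAM.initial : RAM := ⟨fun _ => 0, fun _ _ => false, false⟩

/-- The tape program that writes the initial memory state on the tape and then runs `p`. -/
def Cmd.tapeProg (K : ℕ) (p : Cmd) : TapeProg (Cell K) :=
  .seq (.act fun c => (c.1, fun τ => τ.elim (fun _ => true)
    (fun τ => τ.elim (fun _ => false) id))) (p.compile K)

theorem mem_DTIME_of_cmd {L : Language Bool} {T : ℕ → ℕ} (p : Cmd)
    (h : ∀ w : List Bool, ∃ t s, t ≤ T w.length ∧ p.Exec w RAM.initial t s ∧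
      (s.flag = true ↔ w ∈ L)) :
    L ∈ DTIME (fun n => (T n + 1) ^ 2) := by
  obtain ⟨K, hK⟩ := p.exists_bounded
  let sym : Bool → Cell K := fun b => (some b, fun _ => false)
  have hinj : Function.Injective sym := fun a b e => Option.some_injective _ (congrArg Prod.fst e)
  have hne : ∀ b, sym b ≠ default := fun b e => Option.some_ne_none b (congrArg Prod.fst e)
  -- The `8` comes from the compiled steps, the `2` from the initialisation of the tape and the
  -- final answer.
  refine ⟨(p.tapeProg K).machine sym hinj hne (fun c => c.2 (flagTrack K)), 8 + 2, ?_⟩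
  apply TapeProg.machine_decides
  intro w
  obtain ⟨t, s, ht, hex, hL⟩ := h w
  obtain ⟨-, t', ht', he⟩ := hex.compile (hK K le_rfl) (m := 0) (N := t) (fun _ _ => le_rfl)
    (by omega)
  have hinit : (fun j => (w.map sym).getI j) = layout (K := K) w (fun _ _ => false) := by
    funext j
    simp only [layout, List.getI_eq_getElem?_getD, List.getElem?_map]
    cases w[j]? <;> rfl
  have hact := TapeProg.Exec.act (fun c : Cell K => (c.1, fun τ : Track K =>
    τ.elim (fun _ => true) (fun τ => τ.elim (fun _ => false) id))) (layout w (fun _ _ => false)) 0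
  -- Initially all registers are `0`, so their marks all lie on the first cell. There `id` on the
  -- `Bool` summand sets the origin mark and leaves the flag unset.
  have hlay : Function.update (layout (K := K) w (fun _ _ => false)) 0
      ((layout (K := K) w (fun _ _ => false) 0).1, fun τ : Track K =>
        τ.elim (fun _ => true) (fun τ => τ.elim (fun _ => false) id)) =
      layout w RAM.initial.tracks := by
    funext j
    rw [Function.update_apply]
    split_ifs with hj
    · subst hj
      refine Prod.ext rfl (funext fun τ => ?_)
      rcases τ with x | a | _ | _ <;> simp [layout, RAM.tracks, RAM.initial]
    · refine Prod.ext rfl (funext fun τ => ?_)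
      rcases τ with x | a | _ | _ <;> simp [layout, RAM.tracks, RAM.initial, hj, Ne.symm hj]
  rw [hlay] at hact
  refine ⟨1 + t', layout w s.tracks, 0, ?_, ?_, ?_⟩
  · have h1 : 8 * (t + 1) * t ≤ 8 * (T w.length + 1) * (T w.length + 1) := by gcongr; omega
    have h2 : 1 ≤ (T w.length + 1) ^ 2 := Nat.one_le_pow _ _ (by omega)
    nlinarith
  · rw [hinit]
    exact hact.seq he
  · rw [← hL]
    simp [layout, tracks_flagTrack]

/-! ### Polynomial bounds -/

/-- `f` is bounded by a power on the numbers `≥ 2`. -/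
def PolyBounded (f : ℕ → ℕ) : Prop := ∃ d, ∀ B, 2 ≤ B → f B ≤ B ^ d

namespace PolyBounded

/-- Because `B ≥ 2`, constants and sums are absorbed by a larger exponent, so pure powers can
replace polynomials. -/
theorem const (c : ℕ) : PolyBounded (fun _ => c) :=
  ⟨c, fun _ hB => (Nat.lt_two_pow_self.le : c ≤ 2 ^ c).trans (Nat.pow_le_pow_left hB c)⟩

theorem id : PolyBounded (fun B => B) := ⟨1, fun _ _ => by simp⟩

theorem add {f g : ℕ → ℕ} (hf : PolyBounded f) (hg : PolyBounded g) :
    PolyBounded (fun B => f B + g B) := by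
  obtain ⟨d, hd⟩ := hf
  obtain ⟨e, he⟩ := hg
  refine ⟨d + e + 1, fun B hB => ?_⟩
  have h₁ : B ^ d ≤ B ^ (d + e) := Nat.pow_le_pow_right (by omega) (by omega)
  have h₂ : B ^ e ≤ B ^ (d + e) := Nat.pow_le_pow_right (by omega) (by omega)
  have h₃ : B ^ (d + e) * 2 ≤ B ^ (d + e) * B := Nat.mul_le_mul_left _ hB
  have := hd B hB
  have := he B hB
  simp only [pow_succ]
  omega

theorem mul {f g : ℕ → ℕ} (hf : PolyBounded f) (hg : PolyBounded g) :
    PolyBounded (fun B => f B * g B) := by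
  obtain ⟨d, hd⟩ := hf
  obtain ⟨e, he⟩ := hg
  refine ⟨d + e, fun B hB => ?_⟩
  rw [pow_add]
  exact Nat.mul_le_mul (hd B hB) (he B hB)

end PolyBounded

/-! ### Verification of programs -/

namespace Cmd

/-- Started in `s`, the program `p` ends after at most `T` steps in a state with property `Q`. -/
def Runs (w : List Bool) (p : Cmd) (s : RAM) (T : ℕ) (Q : RAM → Prop) : Prop :=
  ∃ t s', p.Exec w s t s' ∧ t ≤ T ∧ Q s'

variable {w : List Bool} {p q : Cmd} {s : RAM} {T T₁ T₂ : ℕ} {Q Q' : RAM → Prop}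

theorem Runs.op {o : Op} (h : Q (o.apply w s)) : (Cmd.op o).Runs w s 1 Q :=
  ⟨1, _, .op o s, le_rfl, h⟩

theorem Runs.mono (h : p.Runs w s T₁ Q) (hT : T₁ ≤ T₂) (hQ : ∀ s', Q s' → Q' s') :
    p.Runs w s T₂ Q' := by
  obtain ⟨t, s', he, ht, hq⟩ := h
  exact ⟨t, s', he, ht.trans hT, hQ s' hq⟩

theorem Runs.seq (h : p.Runs w s T₁ Q) (h' : ∀ s', Q s' → q.Runs w s' T₂ Q') :
    (Cmd.seq p q).Runs w s (T₁ + T₂) Q' := by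
  obtain ⟨t, s', he, ht, hq⟩ := h
  obtain ⟨t', s'', he', ht', hq'⟩ := h' s' hq
  exact ⟨_, s'', he.seq he', by omega, hq'⟩

theorem Runs.op_seq {o : Op} {s' : RAM} (hs : o.apply w s = s') (h : q.Runs w s' T Q) :
    (Cmd.seq (.op o) q).Runs w s (1 + T) Q :=
  (Runs.op (Q := fun s'' => s'' = s') hs).seq fun _ h' => h' ▸ h

theorem Runs.ite (h : s.flag = true → p.Runs w s T Q) (h' : s.flag = false → q.Runs w s T Q) :
    (Cmd.ite p q).Runs w s (T + 1) Q := by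
  cases hf : s.flag with
  | true =>
    obtain ⟨t, s', he, ht, hq⟩ := h hf
    exact ⟨_, s', .ite_true hf he, by omega, hq⟩
  | false =>
    obtain ⟨t, s', he, ht, hq⟩ := h' hf
    exact ⟨_, s', .ite_false hf he, by omega, hq⟩

theorem Runs.loop_false (hf : s.flag = false) (h : Q s) : (Cmd.loop p).Runs w s 1 Q :=
  ⟨1, s, .loop_false hf, le_rfl, h⟩

theorem Runs.loop_true (hf : s.flag = true) (h : p.Runs w s T₁ Q')
    (h' : ∀ s', Q' s' → (Cmd.loop p).Runs w s' T₂ Q) : (Cmd.loop p).Runs w s (T₁ + T₂ + 1) Q := by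
  obtain ⟨t, s', he, ht, hq⟩ := h
  obtain ⟨t', s'', he', ht', hq'⟩ := h' s' hq
  exact ⟨_, s'', .loop_true hf he he', by omega, hq'⟩

/-- Run `p` with the values `0, 1, …` in register `x`, up to the value of register `y` (exclusive).
Register `1` is supposed to contain `0`. -/
def forLoop (x y : ℕ) (p : Cmd) : Cmd :=
  .seq (.op (.copy x 1)) (.seq (.op (.testNe x y))
    (.loop (.seq p (.seq (.op (.inc x)) (.op (.testNe x y))))))

/-- The property does not depend on register `x` and on the flag. -/
def Ignores (x : ℕ) (I : RAM → Prop) : Prop :=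
  ∀ s v b, I s → I ((s.setReg x v).setFlag b)

/-- The invariant must ignore register `x` and the flag, since the loop overwrites both. Besides the
body, a round costs three steps: increment, comparison and loop test. -/
theorem Runs.forLoop {x y N : ℕ} (I : ℕ → RAM → Prop) (hxy : x ≠ y) (hy : s.reg y = N)
    (hs : s.reg 1 = 0) (hI : ∀ i, Ignores x (I i)) (h0 : I 0 s)
    (step : ∀ i < N, ∀ s', s'.reg x = i → s'.reg y = N → I i s' →
      p.Runs w s' T (fun s'' => s''.reg x = i ∧ s''.reg y = N ∧ I (i + 1) s'')) :
    (forLoop x y p).Runs w s (N * (T + 3) + 3) (I N) := by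
  have key : ∀ n i, i + n = N → ∀ s', s'.reg x = i → s'.reg y = N → s'.flag = decide (i ≠ N) →
      I i s' → (Cmd.loop (.seq p (.seq (.op (.inc x)) (.op (.testNe x y))))).Runs w s'
        (n * (T + 3) + 1) (I N) := by
    intro n
    induction n with
    | zero =>
      intro i hi s' _ _ hf h
      obtain rfl : i = N := by omega
      exact (Runs.loop_false (by simpa using hf) h).mono (by omega) fun _ h => h
    | succ n ih =>
      intro i hi s' hx' hy' hf h
      have hne : i ≠ N := by omega
      refine (Runs.loop_true (Q' := fun s'' => s''.reg x = i + 1 ∧ s''.reg y = N ∧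
        s''.flag = decide (i + 1 ≠ N) ∧ I (i + 1) s'') (T₁ := T + (1 + 1)) (by simpa [hne] using hf)
        ?_ ?_).mono (T₁ := T + (1 + 1) + (n * (T + 3) + 1) + 1) (by rw [Nat.succ_mul]; omega)
        fun _ h => h
      · refine (step i (by omega) s' hx' hy' h).seq fun s₁ h₁ => ?_
        refine Runs.op_seq (s' := s₁.setReg x (i + 1)) (by simp [Op.apply, h₁.1])
          (Runs.op ⟨by simp [Op.apply], ?_, ?_, ?_⟩)
        · simp [Op.apply, hxy.symm, h₁.2.1]
        · simp [Op.apply, hxy.symm, h₁.2.1]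
        · exact hI _ _ _ _ h₁.2.2
      · rintro s₁ ⟨h₁, h₂, h₃, h₄⟩
        exact ih (i + 1) (by omega) s₁ h₁ h₂ h₃ h₄
  refine (Runs.op_seq (s' := s.setReg x 0) (by simp [Op.apply, hs])
    (Runs.op_seq (s' := (s.setReg x 0).setFlag (decide (0 ≠ N)))
    (by simp [Op.apply, hxy.symm, hy]) (key N 0 (by omega) _ (by simp) (by simp [hxy.symm, hy])
      (by simp) (hI _ _ _ _ h0)))).mono (by omega) fun _ h => h

end Cmd

/-! ### Decidability of properties of memory states -/

/-- The size of the universe: register `0` is supposed to contain this number. -/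
def univSize (w : List Bool) : ℕ := 2 ^ (w.length + 1)

theorem two_le_univSize (w : List Bool) : 2 ≤ univSize w := by
  have : 2 ^ 1 ≤ 2 ^ (w.length + 1) := Nat.pow_le_pow_right (by omega) (by omega)
  simpa [univSize] using this

/-- Agreement on the first `k` registers and the first `a` arrays. -/
def Agree (k a : ℕ) (s s' : RAM) : Prop :=
  (∀ i < k, s'.reg i = s.reg i) ∧ ∀ b < a, s'.arr b = s.arr b

/-- Register `0` contains the size of the universe, register `1` contains `0` and the other
registers below `k` contain elements of the universe. -/
structure Valid (k : ℕ) (w : List Bool) (s : RAM) : Prop where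
  two_le : 2 ≤ k
  reg_zero : s.reg 0 = univSize w
  reg_one : s.reg 1 = 0
  reg_lt : ∀ i < k, 0 < i → s.reg i < univSize w

theorem Agree.refl (k a : ℕ) (s : RAM) : Agree k a s s := ⟨fun _ _ => rfl, fun _ _ => rfl⟩

theorem Agree.symm {k a : ℕ} {s s' : RAM} (h : Agree k a s s') : Agree k a s' s :=
  ⟨fun i hi => (h.1 i hi).symm, fun b hb => (h.2 b hb).symm⟩

theorem Agree.trans {k a : ℕ} {s s' s'' : RAM} (h : Agree k a s s') (h' : Agree k a s' s'') :
    Agree k a s s'' :=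
  ⟨fun i hi => (h'.1 i hi).trans (h.1 i hi), fun b hb => (h'.2 b hb).trans (h.2 b hb)⟩

theorem Agree.mono {k a k' a' : ℕ} {s s' : RAM} (h : Agree k a s s') (hk : k' ≤ k) (ha : a' ≤ a) :
    Agree k' a' s s' :=
  ⟨fun i hi => h.1 i (by omega), fun b hb => h.2 b (by omega)⟩

theorem Agree.setReg {k a x : ℕ} {s s' : RAM} (h : Agree k a s s') (hx : k ≤ x) (v : ℕ) :
    Agree k a s (s'.setReg x v) :=
  ⟨fun i hi => by rw [RAM.setReg_reg, if_neg (by omega), h.1 i hi], h.2⟩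

theorem Agree.setFlag {k a : ℕ} {s s' : RAM} (h : Agree k a s s') (b : Bool) :
    Agree k a s (s'.setFlag b) := h

theorem Agree.setArr {k a x : ℕ} {s s' : RAM} (h : Agree k a s s') (hx : a ≤ x) (i : ℕ) (b : Bool) :
    Agree k a s (s'.setArr x i b) :=
  ⟨h.1, fun c hc => by
    rw [← h.2 c hc]
    funext j
    rw [RAM.setArr_arr, if_neg (by omega)]⟩

theorem Valid.agree {k a : ℕ} {w : List Bool} {s s' : RAM} (h : Valid k w s) (h' : Agree k a s s') :
    Valid k w s' where
  two_le := h.two_le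
  reg_zero := by rw [h'.1 0 (by have := h.two_le; omega), h.reg_zero]
  reg_one := by rw [h'.1 1 (by have := h.two_le; omega), h.reg_one]
  reg_lt i hi h0 := by rw [h'.1 i hi]; exact h.reg_lt i hi h0

theorem Valid.succ {k : ℕ} {w : List Bool} {s : RAM} (h : Valid k w s)
    (hv : s.reg k < univSize w) : Valid (k + 1) w s where
  two_le := by have := h.two_le; omega
  reg_zero := h.reg_zero
  reg_one := h.reg_one
  reg_lt i hi h0 := by
    rcases Nat.lt_succ_iff_lt_or_eq.1 hi with h' | rfl
    · exact h.reg_lt i h' h0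
    · exact hv

theorem Valid.setReg {k : ℕ} {w : List Bool} {s : RAM} (h : Valid k w s) {v : ℕ}
    (hv : v < univSize w) : Valid (k + 1) w (s.setReg k v) :=
  (h.agree (Agree.setReg (Agree.refl k 0 s) le_rfl v)).succ (by simpa using hv)

/-- A property of memory states, dependent on the input word, is decided by a program in time
polynomial in the size of the universe.  It depends only on the first `k` registers and the first
`a` arrays, and these are preserved by the program. -/
def Dec (k a : ℕ) (Φ : List Bool → RAM → Prop) : Prop :=
  (∀ w s s', Valid k w s → Agree k a s s' → (Φ w s ↔ Φ w s')) ∧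
  ∃ (p : Cmd) (T : ℕ → ℕ), PolyBounded T ∧ ∀ w s, Valid k w s →
    p.Runs w s (T (univSize w)) (fun s' => Agree k a s s' ∧ (s'.flag = true ↔ Φ w s))

namespace Dec

variable {k a : ℕ} {Φ Ψ : List Bool → RAM → Prop}

/-- Equivalence is required on valid states only, where register `1` can be read as the constant `0`
and the other registers above `0` are known to be below `B`. -/
theorem congr (h : Dec k a Φ) (h' : ∀ w s, Valid k w s → (Φ w s ↔ Ψ w s)) : Dec k a Ψ := by
  obtain ⟨hr, p, T, hT, hp⟩ := h
  refine ⟨fun w s s' hv ha => ?_, p, T, hT, fun w s hv => ?_⟩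
  · rw [← h' w s hv, ← h' w s' (hv.agree ha)]
    exact hr w s s' hv ha
  · refine (hp w s hv).mono le_rfl fun s' hs => ?_
    rw [← h' w s hv]
    exact hs

theorem not (h : Dec k a Φ) : Dec k a (fun w s => ¬ Φ w s) := by
  obtain ⟨hr, p, T, hT, hp⟩ := h
  refine ⟨fun w s s' hv ha => not_congr (hr w s s' hv ha), .seq p (.op .negFlag), _,
    hT.add (.const 1), fun w s hv => ?_⟩
  refine (hp w s hv).seq fun s' hs => Cmd.Runs.op ⟨hs.1, ?_⟩
  simp only [← hs.2]
  simp [Op.apply]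

theorem and (h : Dec k a Φ) (h' : Dec k a Ψ) : Dec k a (fun w s => Φ w s ∧ Ψ w s) := by
  obtain ⟨hr, p, T, hT, hp⟩ := h
  obtain ⟨hr', p', T', hT', hp'⟩ := h'
  refine ⟨fun w s s' hv ha => and_congr (hr w s s' hv ha) (hr' w s s' hv ha),
    .seq p (.ite p' (.op (.setFlag false))), _,
    hT.add ((hT'.add (.const 1)).add (.const 1)), fun w s hv => ?_⟩
  refine (hp w s hv).seq fun s' hs => Cmd.Runs.ite (fun hf => ?_) (fun hf => ?_)
  · refine (hp' w s' (hv.agree hs.1)).mono (by omega) fun s'' hs' => ⟨hs.1.trans hs'.1, ?_⟩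
    simp only [hs'.2, ← hr' w s s' hv hs.1, ← hs.2]
    simp [hf]
  · refine (Cmd.Runs.op ⟨hs.1.setFlag _, ?_⟩).mono (by omega) fun _ h => h
    simp only [← hs.2]
    simp [Op.apply, hf]

theorem or (h : Dec k a Φ) (h' : Dec k a Ψ) : Dec k a (fun w s => Φ w s ∨ Ψ w s) :=
  (h.not.and h'.not).not.congr fun w s _ => by tauto

theorem imp (h : Dec k a Φ) (h' : Dec k a Ψ) : Dec k a (fun w s => Φ w s → Ψ w s) :=
  (h.and h'.not).not.congr fun w s _ => by tauto

/-- Exhaustive search with register `k` as the bound variable. A witness clears the flag and so ends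
the loop with the witness still in register `k`; without one the register runs up to `B`. The last
comparison with register `0` tells the two cases apart. -/
theorem ex (h : Dec (k + 1) a Φ) :
    Dec k a (fun w s => ∃ v < univSize w, Φ w (s.setReg k v)) := by
  obtain ⟨hr, p, T, hT, hp⟩ := h
  -- The body may spoil registers above `k`, so later rounds start from states that only agree with
  -- `s` on the first `k` registers.
  have hresp : ∀ w s s', Valid k w s → Agree k a s s' → ∀ v < univSize w,
      (Φ w (s.setReg k v) ↔ Φ w (s'.setReg k v)) := by
    intro w s s' hv ha v hlt
    refine hr w _ _ (hv.setReg hlt) ⟨fun i hi => ?_, ha.2⟩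
    simp only [RAM.setReg_reg]
    split_ifs with h
    · rfl
    · exact ha.1 i (by omega)
  refine ⟨fun w s s' hv ha => exists_congr fun v => and_congr_right fun hlt =>
      hresp w s s' hv ha v hlt,
    .seq (.op (.copy k 1)) (.seq (.op (.setFlag true)) (.seq
      (.loop (.seq p (.ite (.op (.setFlag false)) (.seq (.op (.inc k)) (.op (.testNe k 0))))))
      (.op (.testNe k 0)))), fun B => 1 + (1 + (B * (T B + 4) + 1 + 1)),
      (PolyBounded.const 1).add ((PolyBounded.const 1).add
        (((PolyBounded.id.mul (hT.add (.const 4))).add (.const 1)).add (.const 1))),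
      fun w s hv => ?_⟩
  have hk : k ≠ 0 := by have := hv.two_le; omega
  have key : ∀ n i, i + n = univSize w → (∀ v < i, ¬ Φ w (s.setReg k v)) → ∀ s', Agree k a s s' →
      s'.reg k = i → s'.flag = decide (i ≠ univSize w) →
      (Cmd.loop (.seq p (.ite (.op (.setFlag false)) (.seq (.op (.inc k))
        (.op (.testNe k 0)))))).Runs w s' (n * (T (univSize w) + 4) + 1) (fun s'' =>
        Agree k a s s'' ∧ (s''.reg k ≠ univSize w ↔ ∃ v < univSize w, Φ w (s.setReg k v))) := by
    intro n
    induction n with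
    | zero =>
      intro i hi hno s' ha hk' hf
      obtain rfl : i = univSize w := by omega
      refine (Cmd.Runs.loop_false (by simpa using hf) ⟨ha, ?_⟩).mono (by omega) fun _ h => h
      simp only [hk', ne_eq, not_true_eq_false, false_iff, not_exists, not_and]
      exact hno
    | succ n ih =>
      intro i hi hno s' ha hk' hf
      have hlt : i < univSize w := by omega
      have hv' : Valid (k + 1) w s' := (hv.agree ha).succ (by omega)
      have hΦ : Φ w s' ↔ Φ w (s.setReg k i) := by
        have : s'.setReg k i = s' := by
          rw [← hk']
          simp [RAM.setReg]
        rw [hresp w s s' hv ha i hlt, this]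
      refine (Cmd.Runs.loop_true (T₁ := T (univSize w) + (2 + 1))
        (T₂ := n * (T (univSize w) + 4) + 1) (Q' := fun s'' => Agree k a s s'' ∧
        ((s''.reg k = i ∧ s''.flag = false ∧ Φ w (s.setReg k i)) ∨ (s''.reg k = i + 1 ∧
          s''.flag = decide (i + 1 ≠ univSize w) ∧ ¬ Φ w (s.setReg k i))))
        (by simpa [hlt.ne] using hf) ?_ ?_).mono (by rw [Nat.succ_mul]; omega) fun _ h => h
      · refine (hp w s' hv').seq fun s₁ hs₁ => Cmd.Runs.ite (fun hf' => ?_) (fun hf' => ?_)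
        · refine (Cmd.Runs.op ⟨ha.trans (hs₁.1.mono (by omega) le_rfl), Or.inl ⟨?_, rfl, ?_⟩⟩).mono
            (by omega) fun _ h => h
          · rw [← hk']
            exact hs₁.1.1 k (by omega)
          · rw [← hΦ]
            exact hs₁.2.1 hf'
        · have hk₁ : s₁.reg k = i := by rw [← hk']; exact hs₁.1.1 k (by omega)
          have h0 : s₁.reg 0 = univSize w := by
            rw [hs₁.1.1 0 (by omega)]
            exact hv'.reg_zero
          refine Cmd.Runs.op_seq (s' := s₁.setReg k (i + 1)) (by simp [Op.apply, hk₁])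
            (Cmd.Runs.op ⟨(ha.trans (hs₁.1.mono (by omega) le_rfl)).setReg le_rfl _,
            Or.inr ⟨by simp [Op.apply], ?_, ?_⟩⟩)
          · simp [Op.apply, hk.symm, h0]
          · rw [← hΦ, ← hs₁.2]
            simp [hf']
      · rintro s₁ ⟨ha₁, ⟨h₁, h₂, h₃⟩ | ⟨h₁, h₂, h₃⟩⟩
        · refine (Cmd.Runs.loop_false h₂ ⟨ha₁, ?_⟩).mono (by omega) fun _ h => h
          exact iff_of_true (by omega) ⟨i, hlt, h₃⟩
        · refine ih (i + 1) (by omega) (fun v hv => ?_) s₁ ha₁ h₁ h₂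
          rcases Nat.lt_succ_iff_lt_or_eq.1 hv with h' | rfl
          · exact hno v h'
          · exact h₃
  refine Cmd.Runs.op_seq (s' := s.setReg k 0) (by simp [Op.apply, hv.reg_one])
    (Cmd.Runs.op_seq (s' := (s.setReg k 0).setFlag true) rfl ?_)
  refine (key (univSize w) 0 (by omega) (by simp) _ (((Agree.refl k a s).setReg le_rfl _).setFlag _)
    (by simp) ?_).seq fun s₁ hs₁ => Cmd.Runs.op ⟨hs₁.1.setFlag _, ?_⟩
  · have := two_le_univSize w
    simp
    omega
  · simp only [← hs₁.2]
    have : s₁.reg 0 = univSize w := (hv.agree hs₁.1).reg_zero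
    simp [Op.apply, this]

theorem all (h : Dec (k + 1) a Φ) :
    Dec k a (fun w s => ∀ v < univSize w, Φ w (s.setReg k v)) :=
  h.not.ex.not.congr fun w s _ => by push Not; rfl

theorem inp (o : Option Bool) (x : ℕ) (hx : x < k := by omega) : Dec k a (fun w s => w[s.reg x]? = o) := by
  refine ⟨fun w s s' _ ha => by simp only [ha.1 x hx], .op (.testInp o x), _, .const 1, fun w s _ =>
    Cmd.Runs.op ⟨Agree.refl _ _ _, by simp [Op.apply]⟩⟩

end Dec

/-! ### Arithmetic -/

namespace Cmd

variable {w : List Bool} {s : RAM}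

/-- Increase register `k` by the value of register `y`, counting in register `x`. -/
def addReg (k x y : ℕ) : Cmd := forLoop x y (.op (.inc k))

theorem runs_addReg {k x y : ℕ} (hkx : k < x) (hy : y < k) (hs : s.reg 1 = 0) :
    (addReg k x y).Runs w s (s.reg y * 4 + 3) (fun s' => (∀ i < x, i ≠ k → s'.reg i = s.reg i) ∧
      s'.arr = s.arr ∧ s'.reg k = s.reg k + s.reg y) := by
  refine Runs.forLoop (T := 1) (I := fun i s' => (∀ i < x, i ≠ k → s'.reg i = s.reg i) ∧
      s'.arr = s.arr ∧ s'.reg k = s.reg k + i) (by omega) rfl hs ?_ ⟨fun _ _ _ => rfl, rfl, rfl⟩ ?_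
  · rintro i s' v b ⟨h₁, h₂, h₃⟩
    refine ⟨fun j hj hjk => ?_, h₂, ?_⟩
    · simp [hj.ne, h₁ j hj hjk]
    · simp [hkx.ne, h₃]
  · rintro i hi s' hx hy' ⟨h₁, h₂, h₃⟩
    refine Runs.op ⟨?_, ?_, fun j hj hjk => ?_, h₂, ?_⟩
    · simp [Op.apply, hkx.ne', hx]
    · simp [Op.apply, hy.ne, hy']
    · simp [Op.apply, hjk, h₁ j hj hjk]
    · simp [Op.apply, h₃, add_assoc]

/-- Write `m * B + z` into register `k`, where `m` and `z` are the values of the registers `m` and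
`z`, and `B` is the value of register `0`. -/
def mulAdd (k m z : ℕ) : Cmd :=
  .seq (.op (.copy k 1)) (.seq (forLoop (k + 1) m (addReg k (k + 2) 0)) (addReg k (k + 1) z))

/-- Multiplication is repeated addition, with `k + 1` and `k + 2` as counters. The value of register
`m` need not lie in the universe, which allows the call to be iterated in `packRegs`. -/
theorem runs_mulAdd {k m z : ℕ} (hk : 1 < k) (hm : m < k) (hz : z < k) (hs : s.reg 1 = 0) :
    (mulAdd k m z).Runs w s (1 + ((s.reg m * (s.reg 0 * 4 + 3 + 3) + 3) + (s.reg z * 4 + 3)))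
      (fun s' => (∀ i < k, s'.reg i = s.reg i) ∧ s'.arr = s.arr ∧
        s'.reg k = s.reg m * s.reg 0 + s.reg z) := by
  refine Runs.op_seq (s' := s.setReg k 0) (by simp [Op.apply, hs]) ?_
  refine Runs.seq (Runs.forLoop (I := fun i s' => (∀ i < k, s'.reg i = s.reg i) ∧
      s'.arr = s.arr ∧ s'.reg k = i * s.reg 0) (by omega)
      (by simp [hm.ne]) (by simp [hk.ne, hs]) ?_ ?_ ?_) ?_
  · rintro i s' v b ⟨h₁, h₂, h₃⟩
    refine ⟨fun j hj => ?_, h₂, ?_⟩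
    · have : j ≠ k + 1 := by omega
      simp [this, h₁ j hj]
    · simp [h₃]
  · exact ⟨fun j hj => by simp [hj.ne], rfl, by simp⟩
  · rintro i hi s' hx hy ⟨h₁, h₂, h₃⟩
    have h0 := h₁ 0 (by omega)
    refine (runs_addReg (by omega) (by omega) (by rw [h₁ 1 hk, hs])).mono
      (by rw [h0]) ?_
    rintro s'' ⟨g₁, g₂, g₃⟩
    refine ⟨?_, ?_, fun j hj => ?_, g₂.trans h₂, ?_⟩
    · rw [g₁ _ (by omega) (by omega), hx]
    · rw [g₁ _ (by omega) (by omega), hy]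
    · rw [g₁ _ (by omega) (by omega), h₁ j hj]
    · rw [g₃, h₃, h0, Nat.succ_mul]
  · rintro s' ⟨h₁, h₂, h₃⟩
    refine (runs_addReg (by omega) hz (by rw [h₁ 1 hk, hs])).mono (by rw [h₁ z hz]) ?_
    rintro s'' ⟨g₁, g₂, g₃⟩
    refine ⟨fun j hj => ?_, g₂.trans h₂, ?_⟩
    · rw [g₁ _ (by omega) (by omega), h₁ j hj]
    · rw [g₃, h₃, h₁ z hz]

end Cmd

/-- The number of a triple in the lexicographic enumeration of the triples of numbers below `B`. -/
def pack (B x y z : ℕ) : ℕ := (x * B + y) * B + z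

theorem pack_lt {B x y z : ℕ} (hx : x < B) (hy : y < B) (hz : z < B) : pack B x y z < B * B * B := by
  have h₁ : (x + 1) * B ≤ B * B := Nat.mul_le_mul_right _ hx
  have h₂ : (x * B + y + 1) * B ≤ B * B * B := by
    refine Nat.mul_le_mul_right _ ?_
    rw [Nat.succ_mul] at h₁
    omega
  rw [Nat.succ_mul] at h₂
  unfold pack
  omega

theorem mul_add_inj {B m m' z z' : ℕ} (hz : z < B) (hz' : z' < B) (h : m * B + z = m' * B + z') :
    m = m' ∧ z = z' := by
  have hm : m = m' := by
    have h₁ : (m * B + z) / B = m := by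
      rw [Nat.mul_comm, Nat.mul_add_div (by omega), Nat.div_eq_of_lt hz, Nat.add_zero]
    have h₂ : (m' * B + z') / B = m' := by
      rw [Nat.mul_comm, Nat.mul_add_div (by omega), Nat.div_eq_of_lt hz', Nat.add_zero]
    rw [← h₁, h, h₂]
  subst hm
  exact ⟨rfl, by omega⟩

theorem pack_inj {B x y z x' y' z' : ℕ} (hy : y < B) (hz : z < B) (hy' : y' < B)
    (hz' : z' < B) (h : pack B x y z = pack B x' y' z') : x = x' ∧ y = y' ∧ z = z' := by
  obtain ⟨h₁, h₂⟩ := mul_add_inj hz hz' h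
  obtain ⟨h₃, h₄⟩ := mul_add_inj hy hy' h₁
  exact ⟨h₃, h₄, h₂⟩

/-! ### Packing triples and looping over them -/

namespace Cmd

/-- Write the number of the triple of the values of the registers `x`, `y`, `z` into register
`k + 1`. -/
def packRegs (k x y z : ℕ) : Cmd := .seq (mulAdd k x y) (mulAdd (k + 1) k z)

/-- A bound for the running time of `packRegs`. -/
def packTime (B : ℕ) : ℕ :=
  (1 + ((B * (B * 4 + 3 + 3) + 3) + (B * 4 + 3))) +
    (1 + (((B * B + B) * (B * 4 + 3 + 3) + 3) + (B * 4 + 3)))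

theorem polyBounded_packTime : PolyBounded packTime := by
  have h : ∀ c, PolyBounded (fun _ => c) := .const
  have hB := PolyBounded.id
  have h₁ := ((hB.mul (h 4)).add (h 3)).add (h 3)
  have h₂ := (hB.mul (h 4)).add (h 3)
  exact ((h 1).add (((hB.mul h₁).add (h 3)).add h₂)).add
    ((h 1).add (((((hB.mul hB).add hB).mul h₁).add (h 3)).add h₂))

theorem runs_packRegs {w : List Bool} {s : RAM} {k x y z : ℕ} (hv : Valid k w s) (hx : x < k)
    (hy : y < k) (hz : z < k) (hx0 : 0 < x) (hy0 : 0 < y) (hz0 : 0 < z) :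
    (packRegs k x y z).Runs w s (packTime (univSize w)) (fun s' =>
      (∀ i < k, s'.reg i = s.reg i) ∧ s'.arr = s.arr ∧
        s'.reg (k + 1) = pack (univSize w) (s.reg x) (s.reg y) (s.reg z)) := by
  have hk := hv.two_le
  have h0 := hv.reg_zero
  have hx' := (hv.reg_lt x hx hx0).le
  have hy' := (hv.reg_lt y hy hy0).le
  have hz' := (hv.reg_lt z hz hz0).le
  refine Runs.seq ((runs_mulAdd (by omega) hx hy hv.reg_one).mono (by rw [h0]; gcongr)
    fun _ h => h) ?_
  rintro s' ⟨h₁, h₂, h₃⟩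
  have e0 : s'.reg 0 = univSize w := by rw [h₁ 0 (by omega), h0]
  -- The intermediate value `x * B + y` can exceed `B`; this bound is the factor in the second half
  -- of `packTime`.
  have ek : s'.reg k ≤ univSize w * univSize w + univSize w := by
    rw [h₃, h0]
    gcongr
  refine (runs_mulAdd (by omega) (by omega) (by omega) (by rw [h₁ 1 (by omega), hv.reg_one])).mono
    (by rw [e0, h₁ z hz]; gcongr) ?_
  rintro s'' ⟨g₁, g₂, g₃⟩
  refine ⟨fun i hi => by rw [g₁ i (by omega), h₁ i hi], g₂.trans h₂, ?_⟩
  rw [g₃, h₃, h₁ z hz, e0, h0]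
  rfl

/-- Run `p` with all triples of elements of the universe in the registers `k`, `k + 1`, `k + 2`. -/
def forTriples (k : ℕ) (p : Cmd) : Cmd := forLoop k 0 (forLoop (k + 1) 0 (forLoop (k + 2) 0 p))

/-- The running time of `forTriples` if the body runs in time `T`. -/
def triplesTime (B T : ℕ) : ℕ := B * (B * (B * (T + 3) + 3 + 3) + 3 + 3) + 3

theorem polyBounded_triplesTime {T : ℕ → ℕ} (hT : PolyBounded T) :
    PolyBounded (fun B => triplesTime B (T B)) := by
  have h3 := PolyBounded.const 3
  have hB := PolyBounded.id
  exact (hB.mul ((((hB.mul ((((hB.mul (hT.add h3)).add h3)).add h3)).add h3)).add h3)).add h3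

/-- The number of a triple equals the number of triples treated before it, so one index serves the
invariants of all three nested loops. When an inner loop is exhausted, the carry `pack B i j B =
pack B i (j + 1) 0` passes the invariant on. -/
theorem Runs.forTriples {w : List Bool} {s : RAM} {k a T : ℕ} {p : Cmd} (hv : Valid k w s)
    (I : ℕ → RAM → Prop) (hI : ∀ n x, k ≤ x → Ignores x (I n))
    (hagree : ∀ n s', I n s' → Agree k a s s') (h0 : I 0 s)
    (step : ∀ i j l, i < univSize w → j < univSize w → l < univSize w → ∀ s',
      s'.reg k = i → s'.reg (k + 1) = j → s'.reg (k + 2) = l → Valid (k + 3) w s' →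
      I (pack (univSize w) i j l) s' → p.Runs w s' T (fun s'' =>
        s''.reg k = i ∧ s''.reg (k + 1) = j ∧ s''.reg (k + 2) = l ∧
        I (pack (univSize w) i j l + 1) s'')) :
    (forTriples k p).Runs w s (triplesTime (univSize w) T)
      (I (univSize w * univSize w * univSize w)) := by
  have hk := hv.two_le
  have hv' : ∀ n s', I n s' → Valid k w s' := fun n s' h => hv.agree (hagree n s' h)
  have hset : ∀ n s' x v b, k ≤ x → I n s' → I n ((s'.setReg x v).setFlag b) :=
    fun n s' x v b hx h => hI n x hx s' v b h
  set B := univSize w with hB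
  refine (Runs.forLoop (I := fun i s' => I (pack B i 0 0) s') (by omega)
    hv.reg_zero hv.reg_one (fun i => hI _ _ le_rfl) ?_ ?_).mono le_rfl ?_
  · simpa [pack] using h0
  · intro i hi s₁ hk₁ hr₁ h₁
    refine (Runs.forLoop (I := fun j s' => s'.reg k = i ∧ I (pack B i j 0) s') (by omega)
      hr₁ (hv' _ _ h₁).reg_one ?_ ⟨hk₁, h₁⟩ ?_).mono le_rfl ?_
    · rintro j s' v b ⟨h, h'⟩
      exact ⟨by simp [h], hset _ _ _ _ _ (by omega) h'⟩
    · rintro j hj s₂ hk₂ hr₂ ⟨hi₂, h₂⟩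
      refine (Runs.forLoop (I := fun l s' => s'.reg k = i ∧ s'.reg (k + 1) = j ∧ I (pack B i j l) s')
        (by omega) hr₂ (hv' _ _ h₂).reg_one ?_ ⟨hi₂, hk₂, h₂⟩ ?_).mono le_rfl ?_
      · rintro l s' v b ⟨h, h', h''⟩
        exact ⟨by simp [h], by simp [h'], hset _ _ _ _ _ (by omega) h''⟩
      · rintro l hl s₃ hk₃ hr₃ ⟨hi₃, hj₃, h₃⟩
        have hval : Valid (k + 3) w s₃ := (((hv' _ _ h₃).succ (by omega)).succ (by omega)).succ
          (by rw [show k + 1 + 1 = k + 2 from rfl]; omega)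
        refine (step i j l hi hj hl s₃ hi₃ hj₃ hk₃ hval h₃).mono le_rfl ?_
        rintro s₄ ⟨g₁, g₂, g₃, g₄⟩
        exact ⟨g₃, (hv' _ _ g₄).reg_zero, g₁, g₂, g₄⟩
      · rintro s₄ ⟨g₁, g₂, g₃⟩
        refine ⟨g₂, (hv' _ _ g₃).reg_zero, g₁, ?_⟩
        have : pack B i (j + 1) 0 = pack B i j B := by unfold pack; ring
        rwa [this]
    · rintro s₄ ⟨g₁, g₂⟩
      refine ⟨g₁, (hv' _ _ g₂).reg_zero, ?_⟩
      have : pack B (i + 1) 0 0 = pack B i B 0 := by unfold pack; ring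
      rwa [this]
  · intro s₄ h
    have : B * B * B = pack B B 0 0 := by unfold pack; ring
    rwa [this]

end Cmd

/-! ### Decidable equations between registers -/

namespace Dec

variable {k a : ℕ}

/-- Increase register `k` by `c`. -/
def incBy (k : ℕ) : ℕ → Cmd
  | 0 => .op (.setFlag false)
  | c + 1 => .seq (.op (.inc k)) (incBy k c)

theorem runs_incBy {w : List Bool} (k c : ℕ) (s : RAM) : (incBy k c).Runs w s (c + 1) (fun s' =>
    s' = (s.setReg k (s.reg k + c)).setFlag false) := by
  induction c generalizing s with
  | zero => exact Cmd.Runs.op (by simp [Op.apply, RAM.setReg])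
  | succ c ih =>
    refine (Cmd.Runs.op_seq rfl (ih _)).mono (by omega) fun s' h => ?_
    rw [h]
    simp [Op.apply, RAM.setReg, add_assoc, add_comm 1 c]

/-- Arithmetic enters only through such equations. The sum is formed in register `k` and compared,
so it does no harm if it exceeds `B`. -/
theorem add (x y c z : ℕ) (hx : x < k := by omega) (hy : y < k := by omega)
    (hz : z < k := by omega) (hy0 : 0 < y := by omega) :
    Dec k a (fun _ s => s.reg x + s.reg y + c = s.reg z) := by
  refine ⟨fun w s s' _ ha => by simp only [ha.1 x hx, ha.1 y hy, ha.1 z hz],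
    .seq (.op (.copy k x)) (.seq (Cmd.addReg k (k + 1) y) (.seq (incBy k c)
      (.seq (.op (.testNe k z)) (.op .negFlag)))), fun B => 1 + ((B * 4 + 3) + ((c + 1) + (1 + 1))),
    (PolyBounded.const 1).add (((PolyBounded.id.mul (.const 4)).add (.const 3)).add (.const _)),
    fun w s hv => ?_⟩
  have hk := hv.two_le
  refine Cmd.Runs.op_seq rfl (Cmd.Runs.seq ((Cmd.runs_addReg (by omega) hy ?_).mono
    ?_ fun _ h => h) ?_)
  · have : 1 ≠ k := by omega
    simp [Op.apply, this, hv.reg_one]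
  · have := (hv.reg_lt y hy hy0).le
    simp only [Op.apply, RAM.setReg_reg, hy.ne, if_false]
    gcongr
  · rintro s₁ ⟨h₁, h₂, h₃⟩
    refine (runs_incBy k c s₁).seq ?_
    rintro s₂ rfl
    refine Cmd.Runs.op_seq rfl (Cmd.Runs.op ⟨⟨fun i hi => ?_, fun b _ => congrFun h₂ b⟩, ?_⟩)
    · simp [Op.apply, hi.ne, h₁ i (by omega) hi.ne]
    · have hz' : s₁.reg z = s.reg z := by
        rw [h₁ z (by omega) hz.ne]
        simp [Op.apply, hz.ne]
      have hk' : s₁.reg k = s.reg x + s.reg y := by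
        rw [h₃]
        simp [Op.apply, hy.ne]
      simp [Op.apply, hz.ne, hz', hk']

theorem eq (x y : ℕ) (hx : x < k := by omega) (hy : y < k := by omega) :
    Dec k a (fun _ s => s.reg x = s.reg y) :=
  ⟨fun w s s' _ ha => by simp only [ha.1 x hx, ha.1 y hy],
    .seq (.op (.testNe x y)) (.op .negFlag), _, .const 2, fun w s _ =>
      Cmd.Runs.op_seq rfl (Cmd.Runs.op ⟨Agree.refl k a s, by simp [Op.apply]⟩)⟩

theorem eq_zero (x : ℕ) (hx : x < k := by omega) : Dec k a (fun _ s => s.reg x = 0) := by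
  refine ⟨fun w s s' _ ha => by simp only [ha.1 x hx],
    .seq (.op (.testNe x 1)) (.op .negFlag), _, .const 2, fun w s hv =>
      Cmd.Runs.op_seq rfl (Cmd.Runs.op ⟨Agree.refl k a s, by simp [Op.apply, hv.reg_one]⟩)⟩

theorem add_const (x c z : ℕ) (hx : x < k := by omega) (hz : z < k := by omega) :
    Dec k a (fun _ s => s.reg x + c = s.reg z) := by
  -- Register `1` serves as the summand `0`. For `k < 2` no state is valid.
  by_cases hk : 2 ≤ k
  · exact (Dec.add x 1 c z).congr fun w s hv => by
      rw [hv.reg_one, add_zero]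
  · refine ⟨fun w s s' hv => absurd hv.two_le hk, .op .negFlag, _, .const 0, fun w s hv =>
      absurd hv.two_le hk⟩

/-- Membership of a triple in the relation stored in array `b`. -/
theorem arr {b x y z : ℕ} (hb : b < a) (hx : x < k) (hy : y < k) (hz : z < k) (hx0 : 0 < x)
    (hy0 : 0 < y) (hz0 : 0 < z) : Dec k a (fun w s =>
      s.arr b (pack (univSize w) (s.reg x) (s.reg y) (s.reg z)) = true) := by
  refine ⟨fun w s s' _ ha => by simp only [ha.1 x hx, ha.1 y hy, ha.1 z hz, ha.2 b hb],
    .seq (Cmd.packRegs k x y z) (.op (.testArr b (k + 1))), _,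
    Cmd.polyBounded_packTime.add (.const 1), fun w s hv => ?_⟩
  refine (Cmd.runs_packRegs hv hx hy hz hx0 hy0 hz0).seq ?_
  rintro s' ⟨h₁, h₂, h₃⟩
  refine Cmd.Runs.op ⟨⟨h₁, fun b _ => congrFun h₂ b⟩, ?_⟩
  simp only [Op.apply, RAM.setFlag_flag, h₂, h₃]

end Dec

/-! ### Least fixed points -/

/-- A ternary relation on the universe, dependent on the input word, is decidable in time
polynomial in the size of the universe. -/
def DecRel (R : List Bool → ℕ → ℕ → ℕ → Prop) : Prop :=
  ∀ k a x y z, x < k → y < k → z < k → 0 < x → 0 < y → 0 < z →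
    Dec k a (fun w s => R w (s.reg x) (s.reg y) (s.reg z))

theorem DecRel.dec {R : List Bool → ℕ → ℕ → ℕ → Prop} (h : DecRel R) {k a : ℕ} (x y z : ℕ)
    (hx : x < k := by omega) (hy : y < k := by omega) (hz : z < k := by omega)
    (hx0 : 0 < x := by omega) (hy0 : 0 < y := by omega) (hz0 : 0 < z := by omega) :
    Dec k a (fun w s => R w (s.reg x) (s.reg y) (s.reg z)) :=
  h k a x y z hx hy hz hx0 hy0 hz0

/-- The relation stored in array `a`. -/
def RAM.rel (s : RAM) (w : List Bool) (a : ℕ) (x y z : ℕ) : Prop :=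
  s.arr a (pack (univSize w) x y z) = true

theorem RAM.rel_congr {s s' : RAM} {w : List Bool} {a : ℕ} (h : s'.arr a = s.arr a) :
    s'.rel w a = s.rel w a := by
  funext x y z
  simp only [RAM.rel, h]

/-- All triples of elements of the universe in `X` are in `Y`. -/
def SubRel (w : List Bool) (X Y : ℕ → ℕ → ℕ → Prop) : Prop :=
  ∀ x y z, x < univSize w → y < univSize w → z < univSize w → X x y z → Y x y z

namespace Cmd

/-- Fill array `a` with `false`. -/
def clearArr (k a : ℕ) : Cmd :=
  forTriples k (.seq (packRegs (k + 3) k (k + 1) (k + 2)) (.op (.setArr a (k + 4) false)))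

theorem runs_clearArr {w : List Bool} {s : RAM} {k a : ℕ} (hv : Valid k w s) :
    (clearArr k a).Runs w s (triplesTime (univSize w) (packTime (univSize w) + 1)) (fun s' =>
      Agree k a s s' ∧ ∀ m < univSize w * univSize w * univSize w, s'.arr a m = false) := by
  have hk := hv.two_le
  refine Runs.forTriples (a := a) (I := fun n s' => Agree k a s s' ∧ ∀ m < n, s'.arr a m = false) hv
    ?_ (fun n s' h => h.1) ⟨Agree.refl _ _ _, by simp⟩ ?_
  · rintro n x hx s' v b ⟨h₁, h₂⟩
    exact ⟨(h₁.setReg hx _).setFlag _, h₂⟩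
  · rintro i j l hi hj hl s' rfl rfl rfl hv' ⟨h₁, h₂⟩
    refine (runs_packRegs hv' (by omega) (by omega) (by omega) (by omega) (by omega)
      (by omega)).seq ?_
    rintro s'' ⟨g₁, g₂, g₃⟩
    refine Runs.op ⟨g₁ _ (by omega), g₁ _ (by omega), g₁ _ (by omega), ?_, fun m hm => ?_⟩
    · refine Agree.setArr (h₁.trans ⟨fun i hi => g₁ i (by omega), fun b _ => by rw [g₂]⟩) le_rfl _ _
    · simp only [Op.apply, RAM.setArr_arr, g₂, g₃, true_and]
      split_ifs with h
      · rfl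
      · exact h₂ m (by omega)

/-- One round of the computation of a fixed point: the triples that satisfy the property decided by
`p` are added to the relation stored in array `a`. -/
def extendRel (k a : ℕ) (p : Cmd) : Cmd :=
  forTriples k (.seq p (.ite (.seq (packRegs (k + 3) k (k + 1) (k + 2))
    (.op (.setArr a (k + 4) true))) (.op (.setFlag false))))

/-- Triples are added in place, so `F` is evaluated on a relation that grows during the round.
`sound` keeps every stage inside `R`, and monotonicity of `F` is not needed: as long as nothing new
was added, `F` was evaluated on the initial relation. Hence the round either changes nothing and
proves closedness, or enlarges the relation. -/
theorem runs_extendRel {w : List Bool} {s : RAM} {k a T : ℕ} {p : Cmd}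
    {F : (ℕ → ℕ → ℕ → Prop) → ℕ → ℕ → ℕ → Prop} {R : ℕ → ℕ → ℕ → Prop} (hv : Valid k w s)
    (hp : ∀ s', Valid (k + 3) w s' → p.Runs w s' T (fun s'' => Agree (k + 3) (a + 1) s' s'' ∧
      (s''.flag = true ↔ F (s'.rel w a) (s'.reg k) (s'.reg (k + 1)) (s'.reg (k + 2)))))
    (sound : ∀ X, SubRel w X R → SubRel w (F X) R) (hs : SubRel w (s.rel w a) R) :
    (extendRel k a p).Runs w s
      (triplesTime (univSize w) (T + (packTime (univSize w) + 1 + 1))) (fun s' =>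
      Agree k a s s' ∧ SubRel w (s'.rel w a) R ∧
      ((s'.arr a = s.arr a ∧ SubRel w (F (s.rel w a)) (s.rel w a)) ∨
        (¬ SubRel w (F (s.rel w a)) (s.rel w a) ∧ (∀ m, s.arr a m = true → s'.arr a m = true) ∧
          ∃ m < univSize w * univSize w * univSize w, s'.arr a m = true ∧ s.arr a m = false))) := by
  have hk := hv.two_le
  refine (Runs.forTriples (a := a) (I := fun n s' => Agree k a s s' ∧ SubRel w (s'.rel w a) R ∧
      ((s'.arr a = s.arr a ∧ ∀ x y z, x < univSize w → y < univSize w → z < univSize w →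
        pack (univSize w) x y z < n → F (s.rel w a) x y z → s.rel w a x y z) ∨
        (¬ SubRel w (F (s.rel w a)) (s.rel w a) ∧ (∀ m, s.arr a m = true → s'.arr a m = true) ∧
          ∃ m < univSize w * univSize w * univSize w, s'.arr a m = true ∧ s.arr a m = false))) hv
    ?_ (fun n s' h => h.1) ⟨Agree.refl _ _ _, hs, Or.inl ⟨rfl, by simp⟩⟩ ?_).mono le_rfl ?_
  · rintro n x hx s' v b ⟨h₁, h₂⟩
    exact ⟨(h₁.setReg hx _).setFlag _, h₂⟩
  · rintro i j l hi hj hl s' rfl rfl rfl hv' ⟨h₁, h₂, h₃⟩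
    refine (hp s' hv').seq fun s₁ hs₁ => Runs.ite (fun hf => ?_) (fun hf => ?_)
    · have hF := hs₁.2.1 hf
      have hR := sound _ h₂ _ _ _ hi hj hl hF
      have e₁ : s₁.arr a = s'.arr a := hs₁.1.2 a (by omega)
      refine (runs_packRegs (hv'.agree hs₁.1) (by omega) (by omega) (by omega) (by omega) (by omega)
        (by omega)).seq ?_
      rintro s₂ ⟨g₁, g₂, g₃⟩
      rw [hs₁.1.1 k (by omega), hs₁.1.1 (k + 1) (by omega), hs₁.1.1 (k + 2) (by omega)] at g₃
      set m := pack (univSize w) (s'.reg k) (s'.reg (k + 1)) (s'.reg (k + 2)) with hm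
      have hmlt := pack_lt hi hj hl
      have harr : ∀ n, (s₂.setArr a m true).arr a n = if n = m then true else s'.arr a n := by
        intro n
        rw [RAM.setArr_arr, g₂, e₁]
        simp
      have hkeep : ∀ i < k + 3, s₂.reg i = s'.reg i := fun i hi => by rw [g₁ i hi, hs₁.1.1 i hi]
      refine Runs.op ⟨hkeep _ (by omega), hkeep _ (by omega), hkeep _ (by omega), ?_, ?_, ?_⟩
      · refine Agree.setArr (h₁.trans ⟨fun i hi => hkeep i (by omega), fun b hb => ?_⟩) le_rfl _ _
        rw [g₂, hs₁.1.2 b (by omega)]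
      · intro x y z hx hy hz hX
        simp only [Op.apply, RAM.rel, g₃] at hX
        rw [harr] at hX
        split_ifs at hX with h
        · obtain ⟨rfl, rfl, rfl⟩ := pack_inj hy hz hj hl h
          exact hR
        · exact h₂ x y z hx hy hz hX
      · simp only [Op.apply, g₃]
        rcases h₃ with ⟨h₃, h₄⟩ | ⟨h₃, h₄, n, hn, h₅, h₆⟩
        · by_cases hin : s.rel w a (s'.reg k) (s'.reg (k + 1)) (s'.reg (k + 2))
          · refine Or.inl ⟨?_, fun x y z hx hy hz hlt hF' => ?_⟩
            · funext n
              rw [harr, h₃]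
              split_ifs with h
              · rw [h]
                exact hin.symm
              · rfl
            · rcases Nat.lt_succ_iff_lt_or_eq.1 hlt with h | h
              · exact h₄ x y z hx hy hz h hF'
              · obtain ⟨rfl, rfl, rfl⟩ := pack_inj hy hz hj hl h
                exact hin
          · refine Or.inr ⟨fun hsub => hin (hsub _ _ _ hi hj hl ?_), fun n hn => ?_, m, hmlt, ?_, ?_⟩
            · rwa [RAM.rel_congr h₃] at hF
            · rw [harr, h₃, hn]
              simp
            · rw [harr, if_pos rfl]
            · simpa [RAM.rel] using hin
        · refine Or.inr ⟨h₃, fun n hn => ?_, n, hn, ?_, h₆⟩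
          · rw [harr, h₄ n hn]
            simp
          · rw [harr, h₅]
            simp
    · have hF : ¬ F (s'.rel w a) (s'.reg k) (s'.reg (k + 1)) (s'.reg (k + 2)) := by
        rw [← hs₁.2, hf]
        simp
      have e₁ : s₁.arr a = s'.arr a := hs₁.1.2 a (by omega)
      refine (Runs.op ⟨hs₁.1.1 _ (by omega), hs₁.1.1 _ (by omega), hs₁.1.1 _ (by omega),
        (h₁.trans (hs₁.1.mono (by omega) (by omega))).setFlag _, ?_, ?_⟩).mono (by omega)
        fun _ h => h
      · change SubRel w (s₁.rel w a) R
        rwa [RAM.rel_congr (s := s') e₁]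
      · simp only [Op.apply, RAM.setFlag_arr, e₁]
        rcases h₃ with ⟨h₃, h₄⟩ | h₃
        · refine Or.inl ⟨h₃, fun x y z hx hy hz hlt hF' => ?_⟩
          rcases Nat.lt_succ_iff_lt_or_eq.1 hlt with h | h
          · exact h₄ x y z hx hy hz h hF'
          · obtain ⟨rfl, rfl, rfl⟩ := pack_inj hy hz hj hl h
            rw [RAM.rel_congr h₃] at hF
            exact absurd hF' hF
        · exact Or.inr h₃
  · rintro s' ⟨h₁, h₂, h₃ | h₃⟩
    · exact ⟨h₁, h₂, Or.inl ⟨h₃.1, fun x y z hx hy hz => h₃.2 x y z hx hy hz (pack_lt hx hy hz)⟩⟩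
    · exact ⟨h₁, h₂, Or.inr h₃⟩

/-- Compute the least fixed point of an operator in array `a`. -/
def fixRel (k a : ℕ) (p : Cmd) : Cmd :=
  .seq (clearArr k a) (forTriples k (extendRel (k + 3) a p))

/-- Each round on a relation that is not closed adds a triple, so after `n` rounds the relation is
closed or has at least `n` elements. There are only `B ^ 3` triples, so `B ^ 3` rounds suffice, and
the triple loop serves as their counter. -/
theorem runs_fixRel {w : List Bool} {s : RAM} {k a T : ℕ} {p : Cmd}
    {F : (ℕ → ℕ → ℕ → Prop) → ℕ → ℕ → ℕ → Prop} {R : ℕ → ℕ → ℕ → Prop} (hv : Valid k w s)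
    (hp : ∀ s', Valid (k + 6) w s' → p.Runs w s' T (fun s'' => Agree (k + 6) (a + 1) s' s'' ∧
      (s''.flag = true ↔ F (s'.rel w a) (s'.reg (k + 3)) (s'.reg (k + 4)) (s'.reg (k + 5)))))
    (sound : ∀ X, SubRel w X R → SubRel w (F X) R)
    (complete : ∀ X, SubRel w (F X) X → SubRel w R X) :
    (fixRel k a p).Runs w s (triplesTime (univSize w) (packTime (univSize w) + 1) +
      triplesTime (univSize w)
        (triplesTime (univSize w) (T + (packTime (univSize w) + 1 + 1)))) (fun s' =>
      Agree k a s s' ∧ SubRel w (s'.rel w a) R ∧ SubRel w R (s'.rel w a)) := by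
  classical
  have hk := hv.two_le
  set N := univSize w * univSize w * univSize w with hN
  let C : RAM → Finset ℕ := fun s' => (Finset.range N).filter fun m => s'.arr a m = true
  refine (runs_clearArr hv).seq fun s₀ hs₀ => ?_
  have hsub₀ : SubRel w (s₀.rel w a) R := by
    intro x y z hx hy hz h
    have := hs₀.2 _ (pack_lt hx hy hz)
    simp [RAM.rel, this] at h
  refine (Runs.forTriples (a := a) (I := fun n s' => Agree k a s s' ∧ SubRel w (s'.rel w a) R ∧
    (SubRel w (F (s'.rel w a)) (s'.rel w a) ∨ n ≤ (C s').card)) (hv.agree hs₀.1) ?_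
    (fun n s' h => hs₀.1.symm.trans h.1) ⟨hs₀.1, hsub₀, Or.inr (Nat.zero_le _)⟩ ?_).mono le_rfl ?_
  · rintro n x hx s' v b ⟨h₁, h₂⟩
    exact ⟨(h₁.setReg hx _).setFlag _, h₂⟩
  · rintro i j l hi hj hl s' rfl rfl rfl hv' ⟨h₁, h₂, h₃⟩
    refine (runs_extendRel (F := F) hv' hp sound h₂).mono le_rfl ?_
    rintro s'' ⟨g₁, g₂, g₃⟩
    refine ⟨g₁.1 _ (by omega), g₁.1 _ (by omega), g₁.1 _ (by omega),
      h₁.trans (g₁.mono (by omega) le_rfl), g₂, ?_⟩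
    rcases g₃ with ⟨g₃, g₄⟩ | ⟨g₃, g₄, m, hm, g₅, g₆⟩
    · left
      rwa [RAM.rel_congr g₃]
    · right
      have hcard := h₃.resolve_left g₃
      have hlt : C s' ⊂ C s'' := by
        refine Finset.ssubset_iff_subset_ne.2 ⟨fun n hn => ?_, fun e => ?_⟩
        · simp only [C, Finset.mem_filter] at hn ⊢
          exact ⟨hn.1, g₄ n hn.2⟩
        · have : m ∈ C s'' := by simp [C, g₅, hN, hm]
          rw [← e] at this
          simp [C, g₆] at this
      have := Finset.card_lt_card hlt
      omega
  · rintro s' ⟨h₁, h₂, h₃⟩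
    refine ⟨h₁, h₂, complete _ ?_⟩
    rcases h₃ with h₃ | h₃
    · exact h₃
    -- The array is full, and the full relation is closed.
    · intro x y z hx hy hz _
      have hall : C s' = Finset.range N := by
        refine Finset.eq_of_subset_of_card_le (Finset.filter_subset _ _) ?_
        rwa [Finset.card_range]
      have : pack (univSize w) x y z ∈ C s' := by
        rw [hall]
        exact Finset.mem_range.2 (pack_lt hx hy hz)
      exact (Finset.mem_filter.1 this).2

end Cmd

/-- A relation is decidable if it is the least fixed point of a decidable operator. -/
theorem DecRel.fix {R : List Bool → ℕ → ℕ → ℕ → Prop}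
    (F : List Bool → (ℕ → ℕ → ℕ → Prop) → ℕ → ℕ → ℕ → Prop)
    (hF : ∀ k a x y z, x < k → y < k → z < k → 0 < x → 0 < y → 0 < z →
      Dec k (a + 1) (fun w s => F w (s.rel w a) (s.reg x) (s.reg y) (s.reg z)))
    (sound : ∀ w X, SubRel w X (R w) → SubRel w (F w X) (R w))
    (complete : ∀ w X, SubRel w (F w X) X → SubRel w (R w) X) : DecRel R := by
  intro k a x y z hx hy hz hx0 hy0 hz0
  -- Registers `k` to `k + 2` count the rounds and `k + 3` to `k + 5` hold the triple under test, so
  -- the operator works above `k + 6`. It preserves array `a`; fixed points nested inside it use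
  -- later arrays.
  obtain ⟨-, p, T, hT, hp⟩ := hF (k + 6) a (k + 3) (k + 4) (k + 5) (by omega) (by omega) (by omega)
    (by omega) (by omega) (by omega)
  refine ⟨fun w s s' _ ha => by simp only [ha.1 x hx, ha.1 y hy, ha.1 z hz],
    .seq (Cmd.fixRel k a p) (.seq (Cmd.packRegs k x y z) (.op (.testArr a (k + 1)))), _,
    ((Cmd.polyBounded_triplesTime (Cmd.polyBounded_packTime.add (.const 1))).add
      (Cmd.polyBounded_triplesTime (Cmd.polyBounded_triplesTime
        (hT.add ((Cmd.polyBounded_packTime.add (.const 1)).add (.const 1)))))).add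
      (Cmd.polyBounded_packTime.add (.const 1)), fun w s hv => ?_⟩
  refine (Cmd.runs_fixRel (F := F w) (R := R w) hv (fun s' hv' => hp w s' hv') (sound w)
    (complete w)).seq ?_
  rintro s₁ ⟨h₁, h₂, h₃⟩
  refine (Cmd.runs_packRegs (hv.agree h₁) hx hy hz hx0 hy0 hz0).seq ?_
  rintro s₂ ⟨g₁, g₂, g₃⟩
  refine Cmd.Runs.op ⟨h₁.trans ⟨g₁, fun b _ => congrFun g₂ b⟩, ?_⟩
  simp only [Op.apply, RAM.setFlag_flag, g₂, g₃, h₁.1 x hx, h₁.1 y hy, h₁.1 z hz]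
  have hx' := hv.reg_lt x hx hx0
  have hy' := hv.reg_lt y hy hy0
  have hz' := hv.reg_lt z hz hz0
  exact ⟨h₂ _ _ _ hx' hy' hz', h₃ _ _ _ hx' hy' hz'⟩

/-! ### Languages in `E` -/

namespace Cmd

/-- Double register `0` for each letter of the input word. -/
def doublings : Cmd :=
  .loop (.seq (.op (.copy 3 0)) (.seq (forLoop 4 3 (.op (.inc 0)))
    (.seq (.op (.inc 2)) (.seq (.op (.testInp none 2)) (.op .negFlag)))))

/-- Write the size of the universe into register `0`. -/
def prepare : Cmd :=
  .seq (.op (.inc 0)) (.seq (.op (.inc 0)) (.seq (.op (.testInp none 2)) (.seq (.op .negFlag)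
    doublings)))

/-- Register `0` holds `2 ^ (i + 1)` after `i` letters; it is doubled by incrementing it as often as
its copy in register `3` says. Reading `none` signals the end of the word. -/
theorem runs_doublings {w : List Bool} (n i : ℕ) (hi : i + n = w.length) (s : RAM)
    (h0 : s.reg 0 = 2 ^ (i + 1)) (h1 : s.reg 1 = 0) (h2 : s.reg 2 = i)
    (hf : s.flag = decide (i ≠ w.length)) :
    doublings.Runs w s (n * (univSize w * 4 + 8) + 1)
      (fun s' => s'.reg 0 = univSize w ∧ s'.reg 1 = 0) := by
  induction n generalizing i s with
  | zero =>
    obtain rfl : i = w.length := by omega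
    exact (Runs.loop_false (by simpa using hf) ⟨h0, h1⟩).mono (by omega) fun _ h => h
  | succ n ih =>
    have hlt : i < w.length := by omega
    refine (Runs.loop_true (T₁ := 1 + ((2 ^ (i + 1) * (1 + 3) + 3) + (1 + (1 + 1))))
      (Q' := fun s' => s'.reg 0 = 2 ^ (i + 1 + 1) ∧ s'.reg 1 = 0 ∧ s'.reg 2 = i + 1 ∧
        s'.flag = decide (i + 1 ≠ w.length)) (by simpa [hlt.ne] using hf) ?_
      fun s' h => ih (i + 1) (by omega) s' h.1 h.2.1 h.2.2.1 h.2.2.2).mono ?_ fun _ h => h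
    · refine Runs.op_seq (s' := s.setReg 3 (2 ^ (i + 1))) (by simp [Op.apply, h0]) ?_
      refine Runs.seq (Runs.forLoop (N := 2 ^ (i + 1)) (I := fun m s' =>
        s'.reg 0 = 2 ^ (i + 1) + m ∧ s'.reg 1 = 0 ∧ s'.reg 2 = i) (by omega) (by simp)
        (by simp [h1]) ?_ (by simp [h0, h1, h2]) ?_) ?_
      · rintro m s' v b ⟨g0, g1, g2⟩
        simp [g0, g1, g2]
      · rintro m hm s' g4 g3 ⟨g0, g1, g2⟩
        refine Runs.op ?_
        simp [Op.apply, g0, g1, g2, g3, g4, add_assoc]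
      · rintro s' ⟨g0, g1, g2⟩
        refine Runs.op_seq rfl (Runs.op_seq rfl (Runs.op ?_))
        simp only [Op.apply, RAM.setFlag_reg, RAM.setFlag_flag, RAM.setReg_reg]
        refine ⟨?_, by simp [g1], by simp [g2], ?_⟩
        · simp only [g0]
          norm_num
          ring
        · simp only [if_true, g2, List.getElem?_eq_none_iff]
          by_cases h : i + 1 = w.length
          · simp [h]
          · have : ¬ w.length ≤ i + 1 := by omega
            simp [h, this]
    · have : 2 ^ (i + 1) ≤ univSize w := Nat.pow_le_pow_right (by omega) (by omega)
      rw [Nat.succ_mul]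
      omega

theorem runs_prepare (w : List Bool) : prepare.Runs w RAM.initial
    (univSize w * (univSize w * 4 + 8) + 5) (Valid 2 w) := by
  refine (Runs.op_seq rfl (Runs.op_seq rfl (Runs.op_seq rfl (Runs.op_seq rfl
    (runs_doublings w.length 0 (by omega) _ ?_ ?_ ?_ ?_))))).mono ?_ fun s h => ⟨le_rfl, h.1, h.2, ?_⟩
  · simp [Op.apply, RAM.initial]
  · simp [Op.apply, RAM.initial]
  · simp [Op.apply, RAM.initial]
  · simp only [Op.apply, RAM.initial, RAM.setFlag_flag, RAM.setReg_reg]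
    cases w <;> simp
  · have h₁ : w.length ≤ univSize w := by
      have : w.length + 1 < 2 ^ (w.length + 1) := Nat.lt_two_pow_self
      unfold univSize
      omega
    have h₂ : w.length * (univSize w * 4 + 8) ≤ univSize w * (univSize w * 4 + 8) := by gcongr
    omega
  · intro i hi h0
    obtain rfl : i = 1 := by omega
    rw [h.2]
    have := two_le_univSize w
    omega

end Cmd

theorem DTIME_mono {T T' : ℕ → ℕ} (c : ℕ) (h : ∀ n, T n ≤ c * T' n) : DTIME T ⊆ DTIME T' := by
  rintro L ⟨M, a, hM⟩
  refine ⟨M, a * c, fun w => ?_⟩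
  obtain ⟨t, ht, C, hC⟩ := hM w
  refine ⟨t, ht.trans ?_, C, hC⟩
  simp only [mul_assoc]
  exact Nat.mul_le_mul_left a (h _)

/-- A language that is decidable in time polynomial in the size of the universe is in `E`. -/
theorem mem_ClassE_of_dec {L : Language Bool} (h : Dec 2 0 (fun w _ => w ∈ L)) : L ∈ ClassE := by
  obtain ⟨-, p, T, hT, hp⟩ := h
  obtain ⟨d, hd⟩ := (((PolyBounded.id.mul ((PolyBounded.id.mul (.const 4)).add (.const 8))).add
    (.const 5)).add hT)
  have hmem := mem_DTIME_of_cmd (L := L) (T := fun n => (2 ^ (n + 1)) ^ d) (.seq Cmd.prepare p) (by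
    intro w
    obtain ⟨t, s, he, ht, hs⟩ := (Cmd.runs_prepare w).seq (fun s hs =>
      (hp w s hs).mono le_rfl (Q' := fun s' => s'.flag = true ↔ w ∈ L) fun s' h => h.2)
    exact ⟨t, s, ht.trans (hd _ (two_le_univSize w)), he, hs⟩)
  -- The program runs in time `B ^ d` with `B = 2 ^ (n + 1)`, and squaring gives at most `4 * B ^ (2
  -- * d)`.
  refine Set.mem_iUnion.2 ⟨2 * d, DTIME_mono (2 ^ (2 * d) * 4) (fun n => ?_) hmem⟩
  have h1 : 1 ≤ (2 ^ (n + 1)) ^ d := Nat.one_le_pow _ _ (by positivity)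
  calc ((2 ^ (n + 1)) ^ d + 1) ^ 2 ≤ ((2 ^ (n + 1)) ^ d + (2 ^ (n + 1)) ^ d) ^ 2 := by gcongr
    _ = 2 ^ (2 * d) * 4 * 2 ^ (2 * d * n) := by ring

/-! ### Winning strategies and the attractor of the cop-region -/

namespace GuardingGame

variable (G : GuardingGame)

/-- The cops can move from `S` to `T` in one turn. -/
def CopTurn (S T : G.Placement) : Prop :=
  (∀ i, T i ∈ G.copRegion) ∧ ∀ i, G.PawnMove (S i) (T i)

/-- Robber, being on `r` and to move, can force his way into the cop-region. -/
inductive Forces : Fin G.order → G.Placement → Prop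
  | enter {r r' S} : G.PawnMove r r' → (∀ i, S i ≠ r') → r' ∈ G.copRegion → Forces r S
  | move {r r' S} : G.PawnMove r r' → (∀ i, S i ≠ r') → (∀ S', G.CopTurn S S' → Forces r' S') →
      Forces r S

variable {G}

/-- Robber makes the forced move and then follows the strategy belonging to the cops' reply. That
reply is the second entry of the history; the first is dropped, so that the later strategy sees a
play starting from the reply. -/
theorem Forces.robberWinsFrom {r : Fin G.order} {S₀ : G.Placement} (h : G.Forces r S₀) :
    G.RobberWinsFrom r S₀ := by
  induction h with
  | @enter r r' S₀ hm hS hr =>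
    refine ⟨fun _ => r', fun S _ hS₀ => ⟨1, hr, fun s hs => ?_⟩⟩
    obtain rfl : s = 0 := by omega
    rw [hS₀]
    exact ⟨hm, hS⟩
  | @move r r' S₀ hm hS _ ih =>
    -- Illegal replies get an arbitrary strategy, so that `choose` yields a function of the reply.
    have : ∀ S', ∃ σ : G.RobberStrategy, G.CopTurn S₀ S' → ∀ S : ℕ → G.Placement, G.IsCopPlay S →
        S 0 = S' → G.RobberEnters (G.robberPlay r' σ S) S := by
      intro S'
      by_cases h : G.CopTurn S₀ S'
      · obtain ⟨σ, hσ⟩ := ih S' h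
        exact ⟨σ, fun _ => hσ⟩
      · exact ⟨fun _ => r', fun h' => absurd h' h⟩
    choose σ' hσ' using this
    let σ : G.RobberStrategy := fun l => match l with
      | _ :: S' :: l => σ' S' (S' :: l)
      | _ => r'
    refine ⟨σ, fun S hS' hS₀ => ?_⟩
    have hplay : ∀ t, G.robberPlay r σ S (t + 1) =
        G.robberPlay r' (σ' (S 1)) (fun t => S (t + 1)) t := by
      intro t
      cases t with
      | zero => rfl
      | succ t =>
        simp only [robberPlay, List.range_succ_eq_map, List.map_cons, List.map_map, σ]
        rfl
    obtain ⟨t, ht, hlegal⟩ := hσ' (S 1) ⟨hS'.1 1, by rw [← hS₀]; exact hS'.2 0⟩ (fun t => S (t + 1))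
      ⟨fun t => hS'.1 (t + 1), fun t => hS'.2 (t + 1)⟩ rfl
    refine ⟨t + 1, by rwa [hplay], fun s hs => ?_⟩
    cases s with
    | zero =>
      rw [hS₀]
      exact ⟨hm, hS⟩
    | succ s =>
      rw [hplay, hplay]
      exact hlegal s (by omega)

/-- Determinacy: outside the attractor, the cops answer each move of a given strategy so that the
new position is again outside. Such a reply exists, for otherwise Robber's move would have shown the
old position to be in the attractor. Against this play Robber never legally enters the region. -/
theorem RobberWinsFrom.forces {r : Fin G.order} {S₀ : G.Placement} (hr : r ∉ G.copRegion)
    (hS₀ : ∀ i, S₀ i ∈ G.copRegion) (h : G.RobberWinsFrom r S₀) : G.Forces r S₀ := by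
  classical
  by_contra hnot
  obtain ⟨σ, hσ⟩ := h
  let good : List G.Placement → G.Placement → Prop := fun l S' =>
    G.CopTurn (l.getLastD S₀) S' ∧ ¬ G.Forces (σ l) S'
  let next : List G.Placement → G.Placement := fun l =>
    if h : ∃ S', good l S' then h.choose else l.getLastD S₀
  let hist : ℕ → List G.Placement := fun t => Nat.rec [S₀] (fun _ l => l ++ [next l]) t
  let S : ℕ → G.Placement := fun t => (hist t).getLastD S₀
  have hsucc : ∀ t, hist (t + 1) = hist t ++ [next (hist t)] := fun _ => rfl
  have hS : ∀ t, S (t + 1) = next (hist t) := fun t => by simp [S, hsucc]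
  have hhist : ∀ t, hist t = (List.range (t + 1)).map S := by
    intro t
    induction t with
    | zero => rfl
    | succ t ih => rw [hsucc, ih, List.range_succ (n := t + 1), List.map_append, ← ih, ← hS]; rfl
  have hturn : ∀ t, (∀ i, S t i ∈ G.copRegion) → G.CopTurn (S t) (S (t + 1)) := by
    intro t ht
    rw [hS]
    by_cases h : ∃ S', good (hist t) S'
    · simp only [next, dif_pos h]
      exact h.choose_spec.1
    · simp only [next, dif_neg h]
      exact ⟨ht, fun i => Or.inl rfl⟩
  have hregion : ∀ t i, S t i ∈ G.copRegion := by
    intro t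
    induction t with
    | zero => exact hS₀
    | succ t ih => exact (hturn t ih).1
  obtain ⟨t, ht, hlegal⟩ := hσ S ⟨hregion, fun t => (hturn t (hregion t)).2⟩ rfl
  have key : ∀ u ≤ t, G.robberPlay r σ S u ∉ G.copRegion ∧
      ¬ G.Forces (G.robberPlay r σ S u) (S u) := by
    intro u hu
    induction u with
    | zero => exact ⟨hr, hnot⟩
    | succ u ih =>
      obtain ⟨-, h₂⟩ := ih (by omega)
      obtain ⟨hm, hfree⟩ := hlegal u (by omega)
      refine ⟨fun h => h₂ (.enter hm hfree h), fun h => ?_⟩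
      have hex : ∃ S', good (hist u) S' := by
        by_contra hno
        refine h₂ (.move hm hfree fun S' hS' => ?_)
        by_contra hF
        refine hno ⟨S', hS', ?_⟩
        rw [hhist]
        exact hF
      have := hex.choose_spec.2
      rw [hS] at h
      simp only [next, dif_pos hex] at h
      have e : G.robberPlay r σ S (u + 1) = σ (hist u) := by rw [hhist]; rfl
      exact this (e ▸ h)
  exact (key t le_rfl).1 ht

theorem robberWinsFrom_iff {r : Fin G.order} {S₀ : G.Placement} (hr : r ∉ G.copRegion)
    (hS₀ : ∀ i, S₀ i ∈ G.copRegion) : G.RobberWinsFrom r S₀ ↔ G.Forces r S₀ :=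
  ⟨fun h => h.forces hr hS₀, fun h => h.robberWinsFrom⟩

/-- If there are enough cops to occupy all vertices, then Robber loses. -/
theorem RobberWins.cops_lt_order (h : G.RobberWins) : G.cops < G.order := by
  classical
  by_contra hlt
  obtain ⟨r, hr, hwin⟩ := h
  obtain ⟨v₀, hv₀⟩ := G.copRegion_nonempty
  -- Cop number `i` stands on vertex `i` if it lies in the cop-region. With at least `order` cops
  -- this blocks the entire region, and the cops simply stay.
  let S₀ : G.Placement := fun i =>
    if h : ∃ hi : (i : ℕ) < G.order, (⟨i, hi⟩ : Fin G.order) ∈ G.copRegion then ⟨i, h.choose⟩ else v₀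
  have hS₀ : ∀ i, S₀ i ∈ G.copRegion := by
    intro i
    simp only [S₀]
    split_ifs with h
    · exact h.choose_spec
    · exact hv₀
  obtain ⟨σ, hσ⟩ := hwin S₀ hS₀
  obtain ⟨t, ht, hlegal⟩ := hσ (fun _ => S₀) ⟨fun _ => hS₀, fun _ _ => Or.inl rfl⟩ rfl
  cases t with
  | zero => exact hr ht
  | succ t =>
    refine (hlegal t (by omega)).2 ⟨G.robberPlay r σ (fun _ => S₀) (t + 1), by omega⟩ ?_
    simp only [S₀]
    exact dif_pos ⟨Fin.isLt _, ht⟩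

end GuardingGame

/-! ### Coding of multisets by numbers -/

/-- The multiset coded by a number: reading its binary digits from the least significant one, a
digit `1` stands for an element and a digit `0` for the passage to the next number. -/
def codedMultiset (x : ℕ) : Multiset ℕ :=
  if _h : x = 0 then 0
  else if x % 2 = 1 then 0 ::ₘ codedMultiset (x / 2)
  else (codedMultiset (x / 2)).map Nat.succ
decreasing_by all_goals omega

@[simp] theorem codedMultiset_zero : codedMultiset 0 = 0 := by
  rw [codedMultiset]
  simp

theorem codedMultiset_odd (x : ℕ) : codedMultiset (2 * x + 1) = 0 ::ₘ codedMultiset x := by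
  rw [codedMultiset, dif_neg (by omega), if_pos (by omega)]
  congr 2
  omega

theorem codedMultiset_even (x : ℕ) :
    codedMultiset (2 * x) = (codedMultiset x).map Nat.succ := by
  rcases Nat.eq_zero_or_pos x with rfl | hx
  · simp
  · rw [codedMultiset, dif_neg (by omega), if_neg (by omega)]
    congr 2
    omega

theorem zero_notMem_codedMultiset_even (x : ℕ) : 0 ∉ codedMultiset (2 * x) := by
  rw [codedMultiset_even]
  simp

theorem codedMultiset_eq_zero {x : ℕ} (h : codedMultiset x = 0) : x = 0 := by
  induction x using Nat.strong_induction_on with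
  | _ x ih =>
    obtain ⟨y, rfl | rfl⟩ := Nat.even_or_odd' x
    · rw [codedMultiset_even, Multiset.map_eq_zero] at h
      rcases Nat.eq_zero_or_pos y with rfl | hy
      · rfl
      · have := ih y (by omega) h
        omega
    · rw [codedMultiset_odd] at h
      exact absurd h (Multiset.cons_ne_zero)

/-- The lowest digit is determined by whether `0` belongs to the multiset; strip it and recurse. -/
theorem codedMultiset_injective : Function.Injective codedMultiset := by
  intro x
  induction x using Nat.strong_induction_on with
  | _ x ih =>
    intro y h
    obtain ⟨x', rfl | rfl⟩ := Nat.even_or_odd' x <;> obtain ⟨y', rfl | rfl⟩ := Nat.even_or_odd' y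
    · rcases Nat.eq_zero_or_pos x' with rfl | hx
      · exact (codedMultiset_eq_zero (by rw [← h]; simp)).symm
      · rw [codedMultiset_even, codedMultiset_even] at h
        rw [ih x' (by omega) (Multiset.map_injective Nat.succ_injective h)]
    · refine absurd ?_ (zero_notMem_codedMultiset_even x')
      rw [h, codedMultiset_odd]
      exact Multiset.mem_cons_self _ _
    · refine absurd ?_ (zero_notMem_codedMultiset_even y')
      rw [← h, codedMultiset_odd]
      exact Multiset.mem_cons_self _ _
    · rw [codedMultiset_odd, codedMultiset_odd, Multiset.cons_inj_right] at h
      rw [ih x' (by omega) h]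

/-- The code needs a digit `1` for every element and at most `m` digits `0` for the passages. The
induction is on this number of digits: either an element `0` is removed, or all elements are lowered
by one. -/
theorem exists_codedMultiset (m : ℕ) (M : Multiset ℕ) (hM : ∀ u ∈ M, u < m) :
    ∃ x < 2 ^ (m + M.card), codedMultiset x = M := by
  generalize hn : m + M.card = n
  induction n generalizing m M with
  | zero =>
    have : M = 0 := Multiset.card_eq_zero.1 (by omega)
    exact ⟨0, by simp, by simp [this]⟩
  | succ n ih =>
    by_cases h0 : 0 ∈ M
    · obtain ⟨M', rfl⟩ := Multiset.exists_cons_of_mem h0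
      rw [Multiset.card_cons] at hn
      obtain ⟨x, hx, hd⟩ := ih m M' (fun u hu => hM u (Multiset.mem_cons_of_mem hu)) (by omega)
      exact ⟨2 * x + 1, by rw [pow_succ]; omega, by rw [codedMultiset_odd, hd]⟩
    · have hM' : (M.map Nat.pred).map Nat.succ = M := by
        rw [Multiset.map_map]
        conv_rhs => rw [← Multiset.map_id M]
        refine Multiset.map_congr rfl fun u hu => ?_
        exact Nat.succ_pred_eq_of_ne_zero fun h => h0 (h ▸ hu)
      cases m with
      | zero =>
        have : M = 0 := Multiset.eq_zero_of_forall_notMem fun u hu => absurd (hM u hu) (by omega)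
        exact ⟨0, by positivity, by simp [this]⟩
      | succ m =>
        obtain ⟨x, hx, hd⟩ := ih m (M.map Nat.pred) (fun u hu => by
          obtain ⟨v, hv, rfl⟩ := Multiset.mem_map.1 hu
          have h₁ := hM v hv
          have h₂ : v ≠ 0 := fun h => h0 (h ▸ hv)
          rw [Nat.pred_eq_sub_one]
          omega) (by rw [Multiset.card_map]; omega)
        exact ⟨2 * x, by rw [pow_succ]; omega, by rw [codedMultiset_even, hd, hM']⟩

/-- Removing an element deletes a digit `1`, below which `u` zeros stand. Thus sub-multisets and
elements of a multiset with code in the universe are again in the universe, as the bounded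
quantifiers require. -/
theorem codedMultiset_cons_lt {x x' u : ℕ} (h : codedMultiset x = u ::ₘ codedMultiset x') :
    x' < x ∧ u < x := by
  induction x using Nat.strong_induction_on generalizing x' u with
  | _ x ih =>
    obtain ⟨y, rfl | rfl⟩ := Nat.even_or_odd' x
    · rcases Nat.eq_zero_or_pos y with rfl | hy
      · simp at h
      · have h0 := zero_notMem_codedMultiset_even y
        rw [h, Multiset.mem_cons, not_or] at h0
        obtain ⟨y', rfl | rfl⟩ := Nat.even_or_odd' x'
        · obtain ⟨v, rfl⟩ := Nat.exists_eq_succ_of_ne_zero (Ne.symm h0.1)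
          rw [codedMultiset_even, codedMultiset_even, ← Multiset.map_cons] at h
          have := ih y (by omega) (Multiset.map_injective Nat.succ_injective h)
          omega
        · rw [codedMultiset_odd] at h0
          exact absurd (Multiset.mem_cons_self _ _) h0.2
    · rw [codedMultiset_odd] at h
      rcases Nat.eq_zero_or_pos u with rfl | hu
      · rw [Multiset.cons_inj_right] at h
        have := codedMultiset_injective h
        omega
      · have h0 : 0 ∈ codedMultiset x' := by
          have : 0 ∈ u ::ₘ codedMultiset x' := h ▸ Multiset.mem_cons_self _ _
          exact (Multiset.mem_cons.1 this).resolve_left (by omega)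
        obtain ⟨y', rfl | rfl⟩ := Nat.even_or_odd' x'
        · exact absurd h0 (zero_notMem_codedMultiset_even y')
        · rw [codedMultiset_odd, Multiset.cons_swap, Multiset.cons_inj_right] at h
          have := ih y (by omega) h
          omega

theorem exists_codedMultiset_of_cons {x u : ℕ} {M : Multiset ℕ}
    (h : codedMultiset x = u ::ₘ M) : ∃ x' < x, codedMultiset x' = M := by
  -- Any bound for the elements will do; the sum is one.
  obtain ⟨x', -, rfl⟩ := exists_codedMultiset (M.sum + 1) M
    (fun v hv => Nat.lt_succ_of_le (Multiset.le_sum_of_mem hv))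
  exact ⟨x', (codedMultiset_cons_lt h).1, rfl⟩

/-! ### The game on coded positions -/

section CodedGame

variable (InC : ℕ → Prop) (Adj : ℕ → ℕ → Prop) (B : ℕ)

/-- A single cop can move from `u` to `v`. -/
def CopStep (u v : ℕ) : Prop := InC u ∧ InC v ∧ (v = u ∨ Adj u v)

/-- The cops can move in one turn from the positions coded by `x` to those coded by `y`. -/
def CodedTurn (x y : ℕ) : Prop :=
  Multiset.Rel (CopStep InC Adj) (codedMultiset x) (codedMultiset y)

/-- Robber, being on `r` and to move, can force his way into the cop-region, when the positions of
the cops are coded by `x` and only codes below `B` are considered. -/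
inductive CodedForces : ℕ → ℕ → Prop
  | enter {r r' x} : r' < B → (r' = r ∨ Adj r r') → r' ∉ codedMultiset x → InC r' →
      CodedForces r x
  | move {r r' x} : r' < B → (r' = r ∨ Adj r r') → r' ∉ codedMultiset x →
      (∀ y < B, CodedTurn InC Adj x y → CodedForces r' y) → CodedForces r x

end CodedGame

/-- A relation between multisets is realised by a function on the indices; `Nodup` permits
redefining it at one index without affecting the others. The function `g₀` serves only the empty
case. -/
theorem exists_of_rel_map {α β γ : Type*} {R : β → γ → Prop} [DecidableEq α] (f : α → β)
    (s : Multiset α) (hs : s.Nodup) (g₀ : α → γ) {M : Multiset γ} (h : Multiset.Rel R (s.map f) M) :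
    ∃ g : α → γ, M = s.map g ∧ ∀ a ∈ s, R (f a) (g a) := by
  induction s using Multiset.induction_on generalizing M with
  | empty => exact ⟨g₀, by simpa using h, by simp⟩
  | cons a s ih =>
    rw [Multiset.map_cons, Multiset.rel_cons_left] at h
    obtain ⟨b, M', hb, hM', rfl⟩ := h
    rw [Multiset.nodup_cons] at hs
    obtain ⟨g, rfl, hg⟩ := ih hs.2 hM'
    have hne : ∀ a' ∈ s, a' ≠ a := fun a' ha' e => hs.1 (e ▸ ha')
    refine ⟨Function.update g a b, ?_, fun a' ha' => ?_⟩
    · rw [Multiset.map_cons, Function.update_self]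
      congr 1
      exact Multiset.map_congr rfl fun a' ha' => by rw [Function.update_of_ne (hne a' ha')]
    · rcases Multiset.mem_cons.1 ha' with rfl | ha'
      · rwa [Function.update_self]
      · rw [Function.update_of_ne (hne a' ha')]
        exact hg a' ha'

namespace GuardingGame

variable {G : GuardingGame}

/-- The multiset of the positions of the cops. -/
def positions (S : G.Placement) : Multiset ℕ := Finset.univ.val.map fun i => (S i : ℕ)

theorem mem_positions {S : G.Placement} {v : Fin G.order} :
    (v : ℕ) ∈ positions S ↔ ∃ i, S i = v := by
  simp [positions, Fin.ext_iff]

theorem card_positions (S : G.Placement) : (positions S).card = G.cops := by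
  simp [positions]

variable {InC : ℕ → Prop} {Adj : ℕ → ℕ → Prop} {B : ℕ}

/-- Predicates on the numbers that describe the cop-region and the edges of the game. -/
structure Describes (G : GuardingGame) (InC : ℕ → Prop) (Adj : ℕ → ℕ → Prop) : Prop where
  lt_of_inC : ∀ {u}, InC u → u < G.order
  inC_iff : ∀ v : Fin G.order, InC v ↔ v ∈ G.copRegion
  lt_of_adj : ∀ {u v}, Adj u v → u < G.order ∧ v < G.order
  adj_iff : ∀ u v : Fin G.order, Adj u v ↔ G.graph.Adj u v

theorem Describes.pawnMove_iff (hG : G.Describes InC Adj) (u v : Fin G.order) :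
    G.PawnMove u v ↔ ((v : ℕ) = u ∨ Adj u v) := by
  rw [hG.adj_iff, ← Fin.ext_iff]
  rfl

/-- Nothing is lost by forgetting which cop stands where: a matching of old and new positions can be
transported to the cops. -/
theorem Describes.rel_positions (hG : G.Describes InC Adj) {S : G.Placement}
    (hS : ∀ i, S i ∈ G.copRegion) {M : Multiset ℕ} :
    Multiset.Rel (CopStep InC Adj) (positions S) M ↔
      ∃ S', G.CopTurn S S' ∧ M = positions S' := by
  constructor
  · intro h
    obtain ⟨g, rfl, hg⟩ := exists_of_rel_map _ _ Finset.univ.nodup (fun _ => 0) h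
    have hg' : ∀ i, CopStep InC Adj (S i) (g i) := fun i => hg i (Finset.mem_univ_val i)
    refine ⟨fun i => ⟨g i, hG.lt_of_inC (hg' i).2.1⟩, ⟨fun i => ?_, fun i => ?_⟩, rfl⟩
    · rw [← hG.inC_iff]
      exact (hg' i).2.1
    · rw [hG.pawnMove_iff]
      exact (hg' i).2.2
  · rintro ⟨S', h, rfl⟩
    unfold positions
    rw [Multiset.rel_map]
    refine Multiset.rel_refl_of_refl_on fun i _ => ⟨?_, ?_, ?_⟩
    · rw [hG.inC_iff]
      exact hS i
    · rw [hG.inC_iff]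
      exact h.1 i
    · rw [← hG.pawnMove_iff]
      exact h.2 i

/-- The bound on `B` is needed in one direction only: every reply of the cops must have a code below
`B`. Conversely, each coded turn comes from an actual one. -/
theorem Describes.codedForces_iff (hG : G.Describes InC Adj) (hB : 2 ^ (G.order + G.cops) ≤ B)
    {r : Fin G.order} {S : G.Placement} (hS : ∀ i, S i ∈ G.copRegion) {x : ℕ}
    (hx : codedMultiset x = positions S) : CodedForces InC Adj B r x ↔ G.Forces r S := by
  have hlt : ∀ v : Fin G.order, (v : ℕ) < B := fun v =>
    lt_of_lt_of_le (v.2.trans_le ((Nat.le_add_right _ _).trans Nat.lt_two_pow_self.le)) hB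
  have hmove : ∀ {r : Fin G.order} {r' : ℕ}, (r' = r ∨ Adj r r') →
      ∃ v : Fin G.order, (v : ℕ) = r' ∧ G.PawnMove r v := by
    intro r r' h
    have hr' : r' < G.order := by
      rcases h with rfl | h
      · exact r.2
      · exact (hG.lt_of_adj h).2
    exact ⟨⟨r', hr'⟩, rfl, (hG.pawnMove_iff _ _).2 h⟩
  constructor
  · generalize hr : (r : ℕ) = r₀
    intro h
    induction h generalizing r S with
    | enter _ hm hfree hin =>
      subst hr
      obtain ⟨v, rfl, hv⟩ := hmove hm
      rw [hx, mem_positions, not_exists] at hfree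
      exact .enter hv hfree ((hG.inC_iff v).1 hin)
    | @move r₀ r' x _ hm hfree _ ih =>
      subst hr
      obtain ⟨v, rfl, hv⟩ := hmove hm
      rw [hx, mem_positions, not_exists] at hfree
      refine .move hv hfree fun S' hS' => ?_
      obtain ⟨y, hy, hd⟩ := exists_codedMultiset G.order (positions S') (fun u hu => by
        obtain ⟨i, -, rfl⟩ := Multiset.mem_map.1 hu
        exact (S' i).2)
      rw [card_positions] at hy
      refine ih y (hy.trans_le hB) ?_ hS'.1 hd rfl
      unfold CodedTurn
      rw [hx, hd, hG.rel_positions hS]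
      exact ⟨S', hS', rfl⟩
  · intro h
    induction h generalizing x with
    | @enter r r' S hm hfree hin =>
      refine .enter (hlt r') ((hG.pawnMove_iff _ _).1 hm) ?_ ((hG.inC_iff r').2 hin)
      rwa [hx, mem_positions, not_exists]
    | @move r r' S hm hfree _ ih =>
      refine .move (hlt r') ((hG.pawnMove_iff _ _).1 hm) ?_ fun y _ hy => ?_
      · rwa [hx, mem_positions, not_exists]
      · unfold CodedTurn at hy
        rw [hx, hG.rel_positions hS] at hy
        obtain ⟨S', hS', hy⟩ := hy
        exact ih S' hS' hS'.1 hy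

end GuardingGame

/-! ### Decidable relations of smaller arity -/

@[simp] theorem RAM.setReg_rel (s : RAM) (x v : ℕ) (w : List Bool) (a : ℕ) :
    (s.setReg x v).rel w a = s.rel w a := rfl

theorem RAM.setReg_self (s : RAM) (x v : ℕ) : (s.setReg x v).reg x = v := by simp

theorem RAM.setReg_of_ne (s : RAM) {x y : ℕ} (v : ℕ) (h : y ≠ x) :
    (s.setReg x v).reg y = s.reg y := by simp [h]

theorem Dec.rel {k a : ℕ} (b x y z : ℕ) (hb : b < a := by omega) (hx : x < k := by omega)
    (hy : y < k := by omega) (hz : z < k := by omega) (hx0 : 0 < x := by omega)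
    (hy0 : 0 < y := by omega) (hz0 : 0 < z := by omega) :
    Dec k a (fun w s => s.rel w b (s.reg x) (s.reg y) (s.reg z)) :=
  Dec.arr hb hx hy hz hx0 hy0 hz0

/-- Decidability of a binary relation. -/
def DecRel₂ (R : List Bool → ℕ → ℕ → Prop) : Prop :=
  ∀ k a x y, x < k → y < k → 0 < x → 0 < y → Dec k a (fun w s => R w (s.reg x) (s.reg y))

/-- Decidability of a set. -/
def DecRel₁ (R : List Bool → ℕ → Prop) : Prop :=
  ∀ k a x, x < k → 0 < x → Dec k a (fun w s => R w (s.reg x))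

theorem DecRel₂.dec {R : List Bool → ℕ → ℕ → Prop} (h : DecRel₂ R) {k a : ℕ} (x y : ℕ)
    (hx : x < k := by omega) (hy : y < k := by omega) (hx0 : 0 < x := by omega)
    (hy0 : 0 < y := by omega) : Dec k a (fun w s => R w (s.reg x) (s.reg y)) :=
  h k a x y hx hy hx0 hy0

theorem DecRel₁.dec {R : List Bool → ℕ → Prop} (h : DecRel₁ R) {k a : ℕ} (x : ℕ)
    (hx : x < k := by omega) (hx0 : 0 < x := by omega) : Dec k a (fun w s => R w (s.reg x)) :=
  h k a x hx hx0

/-- The binary relation stored in array `a`. -/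
def RAM.rel₂ (s : RAM) (w : List Bool) (a : ℕ) (x y : ℕ) : Prop := s.rel w a x y 0

@[simp] theorem RAM.setReg_rel₂ (s : RAM) (x v : ℕ) (w : List Bool) (a : ℕ) :
    (s.setReg x v).rel₂ w a = s.rel₂ w a := rfl

theorem Dec.rel₂ {k a : ℕ} (b x y : ℕ) (hb : b < a := by omega) (hx : x < k := by omega)
    (hy : y < k := by omega) (hx0 : 0 < x := by omega) (hy0 : 0 < y := by omega) :
    Dec k a (fun w s => s.rel₂ w b (s.reg x) (s.reg y)) :=
  (Dec.rel b x y 1).congr fun w s hv => by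
    rw [hv.reg_one]
    rfl

/-- All pairs of elements of the universe in `X` are in `Y`. -/
def SubRel₂ (w : List Bool) (X Y : ℕ → ℕ → Prop) : Prop :=
  ∀ x y, x < univSize w → y < univSize w → X x y → Y x y

/-- Binary relations are stored as ternary ones with third entry `0`, which register `1` provides.
-/
theorem DecRel₂.fix {R : List Bool → ℕ → ℕ → Prop}
    (F : List Bool → (ℕ → ℕ → Prop) → ℕ → ℕ → Prop)
    (hF : ∀ k a x y, x < k → y < k → 0 < x → 0 < y →
      Dec k (a + 1) (fun w s => F w (s.rel₂ w a) (s.reg x) (s.reg y)))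
    (sound : ∀ w X, SubRel₂ w X (R w) → SubRel₂ w (F w X) (R w))
    (complete : ∀ w X, SubRel₂ w (F w X) X → SubRel₂ w (R w) X) : DecRel₂ R := by
  have h : DecRel (fun w x y z => R w x y ∧ z = 0) := by
    refine DecRel.fix (fun w X x y z => F w (fun x y => X x y 0) x y ∧ z = 0) ?_ ?_ ?_
    · intro k a x y z hx hy hz hx0 hy0 hz0
      exact (hF k a x y hx hy hx0 hy0).and (.eq_zero z)
    · intro w X hX x y z hx hy hz h
      exact ⟨sound w _ (fun x y hx hy h => (hX x y 0 hx hy (by omega) h).1) x y hx hy h.1, h.2⟩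
    · rintro w X hX x y z hx hy hz ⟨h, rfl⟩
      exact complete w (fun x y => X x y 0) (fun x y hx hy h => hX x y 0 hx hy hz ⟨h, rfl⟩) x y hx hy h
  intro k a x y hx hy hx0 hy0
  refine (h k a x y 1 hx hy (by omega) hx0 hy0 (by omega)).congr fun w s hv => ?_
  simp [hv.reg_one]

theorem length_lt_univSize (w : List Bool) : w.length + 1 < univSize w := Nat.lt_two_pow_self

/-! ### Reading the input word -/

section Words

variable {w : List Bool} {p q : ℕ} {b : Bool} {l : List Bool}

theorem drop_eq_cons_iff : w.drop p = b :: l ↔ w[p]? = some b ∧ l = w.drop (p + 1) := by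
  constructor
  · intro h
    have hp : p < w.length := by
      by_contra hp
      rw [List.drop_of_length_le (by omega)] at h
      simp at h
    rw [List.drop_eq_getElem_cons hp] at h
    injection h with h₁ h₂
    exact ⟨by rw [List.getElem?_eq_getElem hp, h₁], h₂.symm⟩
  · rintro ⟨h, rfl⟩
    obtain ⟨hp, h⟩ := List.getElem?_eq_some_iff.1 h
    rw [List.drop_eq_getElem_cons hp, h]

theorem drop_eq_append_drop (h : w.drop p = l ++ w.drop q) (hq : q ≤ w.length) (hl : l ≠ []) :
    q = p + l.length := by
  have h' := congrArg List.length h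
  have := List.length_pos_iff.2 hl
  simp only [List.length_append, List.length_drop] at h'
  omega

theorem le_of_drop_eq_cons (h : w.drop p = b :: l) : p < w.length := by
  have h' := congrArg List.length h
  simp only [List.length_cons, List.length_drop] at h'
  omega

end Words

theorem binaryCode_zero : binaryCode 0 = [false] := by simp [binaryCode]

theorem binaryCode_even {v : ℕ} (hv : v ≠ 0) :
    binaryCode (v + v) = true :: false :: binaryCode v := by
  have : (v + v).bits = false :: v.bits := by rw [← two_mul]; exact Nat.bit0_bits v hv
  simp [binaryCode, this]

theorem binaryCode_odd (v : ℕ) : binaryCode (v + v + 1) = true :: true :: binaryCode v := by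
  have : (v + v + 1).bits = true :: v.bits := by rw [← two_mul]; exact Nat.bit1_bits v
  simp [binaryCode, this]

theorem binaryCode_ne_nil (v : ℕ) : binaryCode v ≠ [] := by simp [binaryCode]

theorem lt_two_pow_length_binaryCode (v : ℕ) : v < 2 ^ ((binaryCode v).length - 1) := by
  induction v using Nat.strong_induction_on with
  | _ v ih =>
    obtain ⟨u, rfl | rfl⟩ := Nat.even_or_odd' v
    · rcases Nat.eq_zero_or_pos u with rfl | hu
      · positivity
      · have := ih u (by omega)
        rw [two_mul, binaryCode_even hu.ne']
        have hl := List.length_pos_iff.2 (binaryCode_ne_nil u)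
        have e : (true :: false :: binaryCode u).length - 1 = (binaryCode u).length - 1 + 2 := by
          simp only [List.length_cons]
          omega
        rw [e, pow_add]
        omega
    · have := ih u (by omega)
      rw [two_mul, binaryCode_odd]
      have hl := List.length_pos_iff.2 (binaryCode_ne_nil u)
      have e : (true :: true :: binaryCode u).length - 1 = (binaryCode u).length - 1 + 2 := by
        simp only [List.length_cons]
        omega
      rw [e, pow_add]
      omega

/-- The code of the number `v` extends from position `p` to position `q` (exclusive). -/
def NumAt (w : List Bool) (p v q : ℕ) : Prop := w.drop p = binaryCode v ++ w.drop q ∧ q ≤ w.length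

theorem NumAt.eq_add {w : List Bool} {p v q : ℕ} (h : NumAt w p v q) :
    q = p + (binaryCode v).length :=
  drop_eq_append_drop h.1 h.2 (binaryCode_ne_nil v)

/-- Numbers written in the word, and their successors, lie in the universe, so quantifiers bounded
by `B` reach them. -/
theorem NumAt.val_lt {w : List Bool} {p v q : ℕ} (h : NumAt w p v q) : v + 1 < univSize w := by
  have h₁ := lt_two_pow_length_binaryCode v
  have h₂ := h.eq_add
  have h₃ := h.2
  have h₄ : 2 ^ ((binaryCode v).length - 1) ≤ 2 ^ w.length := Nat.pow_le_pow_right (by omega) (by omega)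
  have h₅ : univSize w = 2 ^ w.length * 2 := pow_succ _ _
  have h₆ : 0 < 2 ^ w.length := by positivity
  omega

theorem NumAt.lt {w : List Bool} {p v q : ℕ} (h : NumAt w p v q) : p < q := by
  have h₁ := h.eq_add
  have h₂ := List.length_pos_iff.2 (binaryCode_ne_nil v)
  omega

/-- One digit is read per unfolding, the lowest first. The clause `¬ v = 0` excludes a highest digit
`0`, which `Nat.bits` never produces. -/
theorem decRel_numAt : DecRel NumAt := by
  refine DecRel.fix (fun w X p v q => (w[p]? = some false ∧ v = 0 ∧ p + 1 = q) ∨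
    (w[p]? = some true ∧ ∃ p₁ < univSize w, ∃ p₂ < univSize w, ∃ u < univSize w,
      p + 1 = p₁ ∧ p + 2 = p₂ ∧ X p₂ u q ∧
      ((w[p₁]? = some false ∧ u + u + 0 = v ∧ ¬ v = 0) ∨
        (w[p₁]? = some true ∧ u + u + 1 = v)))) ?_ ?_ ?_
  · intro k a x y z hx hy hz hx0 hy0 hz0
    refine Dec.congr (k := k) (a := a + 1)
      (((Dec.inp (some false) x).and ((Dec.eq_zero y).and (Dec.add_const x 1 z))).or
      ((Dec.inp (some true) x).and (.ex (.ex (.ex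
        ((Dec.add_const x 1 k).and ((Dec.add_const x 2 (k + 1)).and
        ((Dec.rel a (k + 1) (k + 2) z).and
        (((Dec.inp (some false) k).and ((Dec.add (k + 2) (k + 2) 0 y).and (Dec.eq_zero y).not)).or
        ((Dec.inp (some true) k).and (Dec.add (k + 2) (k + 2) 1 y))))))))))) fun w s _ => ?_
    -- Nested quantifiers bind the registers `k`, `k + 1`, and so on; here these registers are read
    -- back as the variables.
    simp (disch := omega) only [RAM.setReg_self, RAM.setReg_of_ne, RAM.setReg_rel]
  · rintro w X hX p v q hp hv hq (⟨h₁, rfl, rfl⟩ | ⟨h₁, p₁, hp₁, p₂, hp₂, u, hu, rfl, rfl, h₂, h₃⟩)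
    · have h := drop_eq_cons_iff.2 ⟨h₁, rfl⟩
      exact ⟨by rw [h, binaryCode_zero]; rfl, le_of_drop_eq_cons h⟩
    · obtain ⟨h₄, h₅⟩ := hX _ _ _ hp₂ hu hq h₂
      rcases h₃ with ⟨h₃, rfl, h₆⟩ | ⟨h₃, rfl⟩
      · refine ⟨?_, h₅⟩
        rw [drop_eq_cons_iff.2 ⟨h₁, rfl⟩, drop_eq_cons_iff.2 ⟨h₃, rfl⟩, add_zero,
          binaryCode_even (by omega), h₄]
        rfl
      · refine ⟨?_, h₅⟩
        rw [drop_eq_cons_iff.2 ⟨h₁, rfl⟩, drop_eq_cons_iff.2 ⟨h₃, rfl⟩, binaryCode_odd, h₄]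
        rfl
  · intro w X hX p v q hp hv hq h
    induction v using Nat.strong_induction_on generalizing p with
    | _ v ih =>
      have hlen := length_lt_univSize w
      have hpq := h.eq_add
      obtain ⟨h₁, h₂⟩ := h
      refine hX p v q hp hv hq ?_
      obtain ⟨u, rfl | rfl⟩ := Nat.even_or_odd' v
      · rcases Nat.eq_zero_or_pos u with rfl | hu
        · rw [mul_zero, binaryCode_zero] at h₁ hpq
          exact Or.inl ⟨(drop_eq_cons_iff.1 h₁).1, rfl, hpq.symm⟩
        · rw [two_mul, binaryCode_even hu.ne'] at h₁ hpq
          obtain ⟨h₃, h₄⟩ := drop_eq_cons_iff.1 h₁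
          obtain ⟨h₅, h₆⟩ := drop_eq_cons_iff.1 h₄.symm
          simp only [List.length_cons] at hpq
          refine Or.inr ⟨h₃, p + 1, by omega, p + 2, by omega, u, by omega, rfl, rfl,
            ih u (by omega) (p + 2) (by omega) (by omega) ⟨h₆.symm, h₂⟩, Or.inl ⟨h₅, by omega, by omega⟩⟩
      · rw [two_mul, binaryCode_odd] at h₁ hpq
        obtain ⟨h₃, h₄⟩ := drop_eq_cons_iff.1 h₁
        obtain ⟨h₅, h₆⟩ := drop_eq_cons_iff.1 h₄.symm
        simp only [List.length_cons] at hpq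
        refine Or.inr ⟨h₃, p + 1, by omega, p + 2, by omega, u, by omega, rfl, rfl,
          ih u (by omega) (p + 2) (by omega) (by omega) ⟨h₆.symm, h₂⟩, Or.inr ⟨h₅, by omega⟩⟩

/-! ### Reading the graph -/

/-- The code of a list of out-neighbours, without the final `0`. -/
def nbrCode (l : List ℕ) : List Bool := l.flatMap fun v => true :: binaryCode v

@[simp] theorem nbrCode_nil : nbrCode [] = [] := rfl

@[simp] theorem nbrCode_cons (v : ℕ) (l : List ℕ) :
    nbrCode (v :: l) = true :: (binaryCode v ++ nbrCode l) := by
  simp [nbrCode]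

/-- The code of a vertex with given bit for the cop-region and given out-neighbours, preceded by
`1`. -/
def entryCode (e : Bool × List ℕ) : List Bool := true :: e.1 :: (nbrCode e.2 ++ [false])

theorem drop_add_of_append {w l l' : List Bool} {p : ℕ} (h : w.drop p = l ++ l') :
    w.drop (p + l.length) = l' := by
  rw [← List.drop_drop, h, List.drop_left]

theorem exists_numAt {w l : List Bool} {p v : ℕ} (h : w.drop p = binaryCode v ++ l) :
    ∃ q, NumAt w p v q ∧ w.drop q = l := by
  have hd := drop_add_of_append h
  refine ⟨p + (binaryCode v).length, ⟨by rw [h, hd], ?_⟩, hd⟩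
  have h₁ := congrArg List.length h
  have h₂ := List.length_pos_iff.2 (binaryCode_ne_nil v)
  simp only [List.length_drop, List.length_append] at h₁
  omega

/-- A strictly increasing list of out-neighbours that are at least `lo` extends from position `p`
to position `q` (exclusive). -/
def ListAt (w : List Bool) (lo p q : ℕ) : Prop :=
  ∃ l : List ℕ, l.Pairwise (· < ·) ∧ (∀ v ∈ l, lo ≤ v) ∧
    w.drop p = nbrCode l ++ false :: w.drop q ∧ q ≤ w.length

/-- The list is read from left to right. The difference `d` expresses `lo ≤ v`, and passing on `v +
1` as the next lower bound enforces strict increase. -/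
theorem decRel_listAt : DecRel ListAt := by
  refine DecRel.fix (fun w X lo p q => (w[p]? = some false ∧ p + 1 = q) ∨
    (w[p]? = some true ∧ ∃ p₁ < univSize w, ∃ v < univSize w, ∃ p₂ < univSize w,
      ∃ lo₁ < univSize w, ∃ d < univSize w, p + 1 = p₁ ∧ NumAt w p₁ v p₂ ∧ lo + d + 0 = v ∧
        v + 1 = lo₁ ∧ X lo₁ p₂ q)) ?_ ?_ ?_
  · intro k a x y z hx hy hz hx0 hy0 hz0
    refine Dec.congr (k := k) (a := a + 1)
      (((Dec.inp (some false) y).and (Dec.add_const y 1 z)).or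
      ((Dec.inp (some true) y).and (.ex (.ex (.ex (.ex (.ex
        ((Dec.add_const y 1 k).and ((decRel_numAt.dec k (k + 1) (k + 2)).and
        ((Dec.add x (k + 4) 0 (k + 1)).and ((Dec.add_const (k + 1) 1 (k + 3)).and
          (Dec.rel a (k + 3) (k + 2) z))))))))))) ) fun w s _ => ?_
    simp (disch := omega) only [RAM.setReg_self, RAM.setReg_of_ne, RAM.setReg_rel]
  · rintro w X hX lo p q hlo hp hq (⟨h₁, rfl⟩ |
      ⟨h₁, p₁, hp₁, v, hv, p₂, hp₂, lo₁, hlo₁, d, hd, rfl, h₂, h₃, rfl, h₄⟩)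
    · have h := drop_eq_cons_iff.2 ⟨h₁, rfl⟩
      exact ⟨[], by simp, by simp, h, le_of_drop_eq_cons h⟩
    · obtain ⟨l, hl, hle, hdrop, hq'⟩ := hX _ _ _ hlo₁ hp₂ hq h₄
      refine ⟨v :: l, List.pairwise_cons.2 ⟨fun u hu => hle u hu, hl⟩, ?_, ?_, hq'⟩
      · intro u hu
        rcases List.mem_cons.1 hu with rfl | hu
        · omega
        · have := hle u hu
          omega
      · rw [drop_eq_cons_iff.2 ⟨h₁, rfl⟩, h₂.1, hdrop]
        simp
  · rintro w X hX lo p q hlo hp hq ⟨l, hl, hle, hdrop, hq'⟩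
    have hlen := length_lt_univSize w
    induction l generalizing lo p with
    | nil =>
      refine hX lo p q hlo hp hq (Or.inl ⟨(drop_eq_cons_iff.1 hdrop).1, ?_⟩)
      exact (drop_eq_append_drop (l := [false]) hdrop hq' (by simp)).symm
    | cons v l ih =>
      rw [List.pairwise_cons] at hl
      rw [nbrCode_cons] at hdrop
      obtain ⟨h₁, h₂⟩ := drop_eq_cons_iff.1 hdrop
      change binaryCode v ++ nbrCode l ++ _ = _ at h₂
      rw [List.append_assoc] at h₂
      obtain ⟨p₂, h₃, h₄⟩ := exists_numAt h₂.symm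
      have hv := h₃.val_lt
      have hp₂ := h₃.2
      have hlt := h₃.lt
      have hlov := hle v (by simp)
      refine hX lo p q hlo hp hq (Or.inr ⟨h₁, p + 1, by omega, v, by omega, p₂, by omega, v + 1,
        by omega, v - lo, by omega, rfl, h₃, by omega, rfl, ?_⟩)
      exact ih (v + 1) p₂ (by omega) (by omega) hl.2 (fun u hu => hl.1 u hu) h₄

/-- The entry of vertex number `i`, or the end of the graph, is at position `q`. -/
def EntryAt (w : List Bool) (i q : ℕ) : Prop :=
  ∃ (c : ℕ) (D : List (Bool × List ℕ)), D.length = i ∧ (∀ e ∈ D, e.2.Pairwise (· < ·)) ∧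
    w = binaryCode c ++ D.flatMap entryCode ++ w.drop q ∧ q ≤ w.length

/-- The prefix that has been read grows by one entry at its right end. The step by `2` skips the
leading `1` and the region bit, which may be either letter. -/
theorem decRel_entryAt : DecRel₂ EntryAt := by
  refine DecRel₂.fix (fun w X i q =>
    (i = 0 ∧ ∃ z < univSize w, ∃ c < univSize w, z = 0 ∧ NumAt w z c q) ∨
    (∃ i₁ < univSize w, ∃ q₁ < univSize w, ∃ q₂ < univSize w, ∃ z < univSize w,
      i₁ + 1 = i ∧ X i₁ q₁ ∧ w[q₁]? = some true ∧ q₁ + 2 = q₂ ∧ z = 0 ∧ ListAt w z q₂ q)) ?_ ?_ ?_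
  · intro k a x y hx hy hx0 hy0
    refine Dec.congr (k := k) (a := a + 1)
      (((Dec.eq_zero x).and (.ex (.ex ((Dec.eq_zero k).and (decRel_numAt.dec k (k + 1) y))))).or
      (.ex (.ex (.ex (.ex ((Dec.add_const k 1 x).and ((Dec.rel₂ a k (k + 1)).and
        ((Dec.inp (some true) (k + 1)).and ((Dec.add_const (k + 1) 2 (k + 2)).and
        ((Dec.eq_zero (k + 3)).and (decRel_listAt.dec (k + 3) (k + 2) y))))))))))) fun w s _ => ?_
    simp (disch := omega) only [RAM.setReg_self, RAM.setReg_of_ne, RAM.setReg_rel₂]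
  · rintro w X hX i q hi hq (⟨rfl, z, hz, c, hc, rfl, h⟩ |
      ⟨i₁, hi₁, q₁, hq₁, q₂, hq₂, z, hz, rfl, h₁, h₂, rfl, rfl, l, hl, -, hdrop, hq'⟩)
    · exact ⟨c, [], rfl, by simp, by simpa using h.1, h.2⟩
    · obtain ⟨c, D, rfl, hD, hw, -⟩ := hX _ _ hi₁ hq₁ h₁
      -- The word has letters from `q₁ + 2` on, at least the final `0` of the list, so the skipped
      -- region bit exists.
      have hlt : q₁ + 1 < w.length := by
        have := congrArg List.length hdrop
        simp only [List.length_drop, List.length_append, List.length_cons] at this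
        omega
      refine ⟨c, D ++ [(w[q₁ + 1], l)], by simp, ?_, ?_, hq'⟩
      · intro e he
        rcases List.mem_append.1 he with he | he
        · exact hD e he
        · rw [List.mem_singleton.1 he]
          exact hl
      · have h₃ : w.drop q₁ = entryCode (w[q₁ + 1], l) ++ w.drop q := by
          rw [drop_eq_cons_iff.2 ⟨h₂, rfl⟩, List.drop_eq_getElem_cons hlt, hdrop]
          simp [entryCode]
        conv_lhs => rw [hw, h₃]
        simp
  · rintro w X hX i q hi hq ⟨c, D, rfl, hD, hw, hq'⟩
    have hlen := length_lt_univSize w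
    induction D using List.reverseRecOn generalizing q with
    | nil =>
      have hnum : NumAt w 0 c q := ⟨by simpa using hw, hq'⟩
      have := hnum.val_lt
      exact hX _ _ hi hq (Or.inl ⟨rfl, 0, by omega, c, by omega, rfl, hnum⟩)
    | append_singleton D e ih =>
      have hw' : w.drop 0 = (binaryCode c ++ D.flatMap entryCode) ++ (entryCode e ++ w.drop q) := by
        rw [List.drop_zero]
        simpa using hw
      have hdrop := drop_add_of_append hw'
      rw [Nat.zero_add] at hdrop
      set q₁ := (binaryCode c ++ D.flatMap entryCode).length with hq₁
      have h₁ : w.drop q₁ = true :: (e.1 :: (nbrCode e.2 ++ false :: w.drop q)) := by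
        rw [hdrop]
        simp [entryCode]
      obtain ⟨h₂, h₃⟩ := drop_eq_cons_iff.1 h₁
      obtain ⟨h₄, h₅⟩ := drop_eq_cons_iff.1 h₃.symm
      have hlt := le_of_drop_eq_cons h₃.symm
      rw [List.length_append, List.length_singleton] at hi
      refine hX _ _ (by simpa using hi) hq (Or.inr ⟨D.length, by omega, q₁, by omega, q₁ + 2,
        by omega, 0, by omega, by simp, ?_, h₂, rfl, rfl, e.2, hD e (by simp), by simp, h₅.symm, hq'⟩)
      refine ih q₁ (by omega) (by omega) (fun e he => hD e (by simp [he])) ?_ (by omega)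
      rw [hdrop]
      simpa using hw

/-- The list of out-neighbours that starts at position `p` contains `j`. -/
def MemberAt (w : List Bool) (j p : ℕ) : Prop :=
  ∃ (l : List ℕ) (rest : List Bool), w.drop p = nbrCode l ++ true :: (binaryCode j ++ rest)

theorem decRel_memberAt : DecRel₂ MemberAt := by
  refine DecRel₂.fix (fun w X j p => w[p]? = some true ∧ ∃ p₁ < univSize w, ∃ v < univSize w,
    ∃ p₂ < univSize w, p + 1 = p₁ ∧ NumAt w p₁ v p₂ ∧ (v = j ∨ X j p₂)) ?_ ?_ ?_
  · intro k a x y hx hy hx0 hy0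
    refine Dec.congr (k := k) (a := a + 1)
      ((Dec.inp (some true) y).and (.ex (.ex (.ex ((Dec.add_const y 1 k).and
        ((decRel_numAt.dec k (k + 1) (k + 2)).and
          ((Dec.eq (k + 1) x).or (Dec.rel₂ a x (k + 2))))))))) fun w s _ => ?_
    simp (disch := omega) only [RAM.setReg_self, RAM.setReg_of_ne, RAM.setReg_rel₂]
  · rintro w X hX j p hj hp ⟨h₁, p₁, hp₁, v, hv, p₂, hp₂, rfl, h₂, rfl | h₃⟩
    · exact ⟨[], w.drop p₂, by rw [drop_eq_cons_iff.2 ⟨h₁, rfl⟩, h₂.1]; rfl⟩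
    · obtain ⟨l, rest, h⟩ := hX _ _ hj hp₂ h₃
      exact ⟨v :: l, rest, by rw [drop_eq_cons_iff.2 ⟨h₁, rfl⟩, h₂.1, h]; simp⟩
  · rintro w X hX j p hj hp ⟨l, rest, h⟩
    have hlen := length_lt_univSize w
    induction l generalizing p with
    | nil =>
      obtain ⟨h₁, h₂⟩ := drop_eq_cons_iff.1 h
      obtain ⟨p₂, h₃, h₄⟩ := exists_numAt h₂.symm
      have := h₃.lt
      have := h₃.2
      exact hX _ _ hj hp ⟨h₁, p + 1, by omega, j, hj, p₂, by omega, rfl, h₃, Or.inl rfl⟩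
    | cons v l ih =>
      rw [nbrCode_cons] at h
      obtain ⟨h₁, h₂⟩ := drop_eq_cons_iff.1 h
      change binaryCode v ++ nbrCode l ++ _ = _ at h₂
      rw [List.append_assoc] at h₂
      obtain ⟨p₂, h₃, h₄⟩ := exists_numAt h₂.symm
      have := h₃.lt
      have := h₃.2
      have := h₃.val_lt
      exact hX _ _ hj hp ⟨h₁, p + 1, by omega, v, by omega, p₂, by omega, rfl, h₃,
        Or.inr (ih p₂ (by omega) h₄)⟩

/-- Vertex number `i` lies in the cop-region. -/
def InCAt (w : List Bool) (i : ℕ) : Prop :=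
  ∃ q < univSize w, ∃ q₁ < univSize w, EntryAt w i q ∧ w[q]? = some true ∧ q + 1 = q₁ ∧
    w[q₁]? = some true

theorem decRel_inCAt : DecRel₁ InCAt := by
  intro k a x hx hx0
  refine Dec.congr (k := k) (a := a) (.ex (.ex ((decRel_entryAt.dec x k).and
    ((Dec.inp (some true) k).and ((Dec.add_const k 1 (k + 1)).and
      (Dec.inp (some true) (k + 1))))))) fun w s _ => ?_
  simp (disch := omega) only [RAM.setReg_self, RAM.setReg_of_ne, InCAt]

/-- There is an edge from vertex number `i` to vertex number `j`. -/
def AdjAt (w : List Bool) (i j : ℕ) : Prop :=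
  ∃ q < univSize w, ∃ q₂ < univSize w, EntryAt w i q ∧ w[q]? = some true ∧ q + 2 = q₂ ∧
    MemberAt w j q₂

theorem decRel_adjAt : DecRel₂ AdjAt := by
  intro k a x y hx hy hx0 hy0
  refine Dec.congr (k := k) (a := a) (.ex (.ex ((decRel_entryAt.dec x k).and
    ((Dec.inp (some true) k).and ((Dec.add_const k 2 (k + 1)).and
      (decRel_memberAt.dec y (k + 1))))))) fun w s _ => ?_
  simp (disch := omega) only [RAM.setReg_self, RAM.setReg_of_ne, AdjAt]

theorem decRel_lt : DecRel₂ fun _ x y => x < y := by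
  intro k a x y hx hy hx0 hy0
  refine Dec.congr (k := k) (a := a) (.ex (Dec.add x k 1 y)) fun w s hv => ?_
  simp (disch := omega) only [RAM.setReg_self, RAM.setReg_of_ne]
  constructor
  · rintro ⟨d, -, h⟩
    omega
  · intro h
    have := hv.reg_lt y hy hy0
    exact ⟨s.reg y - s.reg x - 1, by omega, by omega⟩

/-- The code of a graph with `m` vertices, preceded by the number `c`, ends at position `q`
(inclusive). -/
def GraphAt (w : List Bool) (m c q : ℕ) : Prop :=
  EntryAt w m q ∧ w[q]? = some false ∧
    (∃ z < univSize w, ∃ p < univSize w, z = 0 ∧ NumAt w z c p) ∧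
    (∃ i < univSize w, InCAt w i) ∧
    ∀ i < univSize w, ∀ j < univSize w, AdjAt w i j → j < m

theorem decRel_graphAt : DecRel GraphAt := by
  intro k a x y z hx hy hz hx0 hy0 hz0
  refine Dec.congr (k := k) (a := a) ((decRel_entryAt.dec x z).and ((Dec.inp (some false) z).and
    ((Dec.ex (.ex ((Dec.eq_zero k).and (decRel_numAt.dec k y (k + 1))))).and
    ((Dec.ex (decRel_inCAt.dec k)).and (.all (.all ((decRel_adjAt.dec k (k + 1)).imp
      (decRel_lt.dec (k + 1) x)))))))) fun w s _ => ?_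
  simp (disch := omega) only [RAM.setReg_self, RAM.setReg_of_ne, GraphAt]

/-! ### Coded positions -/

/-- The multiset coded by `x` arises from the one coded by `x'` by adding `u`. -/
def InsAt (_ : List Bool) (u x' x : ℕ) : Prop := codedMultiset x = u ::ₘ codedMultiset x'

/-- The code is traversed digit by digit: insertion of `0` puts a digit `1` in front, two even codes
are halved with `u` lowered by one, and two odd codes lose an element `0` each. -/
theorem decRel_insAt : DecRel InsAt := by
  refine DecRel.fix (fun w X u x' x => (u = 0 ∧ x' + x' + 1 = x) ∨
    (∃ u₁ < univSize w, ∃ x₁' < univSize w, ∃ x₁ < univSize w, u₁ + 1 = u ∧ x₁' + x₁' + 0 = x' ∧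
      x₁ + x₁ + 0 = x ∧ X u₁ x₁' x₁) ∨
    (∃ x₁' < univSize w, ∃ x₁ < univSize w, x₁' + x₁' + 1 = x' ∧ x₁ + x₁ + 1 = x ∧
      X u x₁' x₁)) ?_ ?_ ?_
  · intro k a x y z hx hy hz hx0 hy0 hz0
    refine Dec.congr (k := k) (a := a + 1) (((Dec.eq_zero x).and (Dec.add y y 1 z)).or
      ((Dec.ex (.ex (.ex ((Dec.add_const k 1 x).and ((Dec.add (k + 1) (k + 1) 0 y).and
        ((Dec.add (k + 2) (k + 2) 0 z).and (Dec.rel a k (k + 1) (k + 2)))))))).or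
      (Dec.ex (.ex ((Dec.add k k 1 y).and ((Dec.add (k + 1) (k + 1) 1 z).and
        (Dec.rel a x k (k + 1)))))))) fun w s _ => ?_
    simp (disch := omega) only [RAM.setReg_self, RAM.setReg_of_ne, RAM.setReg_rel]
  · rintro w X hX u x' x hu hx' hx (⟨rfl, rfl⟩ |
      ⟨u₁, hu₁, x₁', hx₁', x₁, hx₁, rfl, rfl, rfl, h⟩ | ⟨x₁', hx₁', x₁, hx₁, rfl, rfl, h⟩)
    · rw [InsAt, ← two_mul, codedMultiset_odd]
    · have := hX _ _ _ hu₁ hx₁' hx₁ h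
      rw [InsAt] at this ⊢
      rw [add_zero, add_zero, ← two_mul, ← two_mul, codedMultiset_even, codedMultiset_even, this,
        Multiset.map_cons]
    · have := hX _ _ _ hu hx₁' hx₁ h
      rw [InsAt] at this ⊢
      rw [← two_mul, ← two_mul, codedMultiset_odd, codedMultiset_odd, this, Multiset.cons_swap]
  · intro w X hX u x' x hu hx' hx h
    induction x using Nat.strong_induction_on generalizing u x' with
    | _ x ih =>
      refine hX u x' x hu hx' hx ?_
      have hlt := codedMultiset_cons_lt h
      rw [InsAt] at h
      obtain ⟨y, rfl | rfl⟩ := Nat.even_or_odd' x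
      · have h0 := zero_notMem_codedMultiset_even y
        rw [h, Multiset.mem_cons, not_or] at h0
        obtain ⟨y', rfl | rfl⟩ := Nat.even_or_odd' x'
        · obtain ⟨v, rfl⟩ := Nat.exists_eq_succ_of_ne_zero (Ne.symm h0.1)
          rw [codedMultiset_even, codedMultiset_even, ← Multiset.map_cons] at h
          refine Or.inr (Or.inl ⟨v, by omega, y', by omega, y, by omega, rfl, by omega, by omega, ?_⟩)
          exact ih y (by omega) v y' (by omega) (by omega) (by omega)
            (Multiset.map_injective Nat.succ_injective h)
        · rw [codedMultiset_odd] at h0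
          exact absurd (Multiset.mem_cons_self _ _) h0.2
      · rw [codedMultiset_odd] at h
        rcases Nat.eq_zero_or_pos u with rfl | hu'
        · rw [Multiset.cons_inj_right] at h
          have := codedMultiset_injective h
          exact Or.inl ⟨rfl, by omega⟩
        · have h0 : 0 ∈ codedMultiset x' := by
            have : 0 ∈ u ::ₘ codedMultiset x' := h ▸ Multiset.mem_cons_self _ _
            exact (Multiset.mem_cons.1 this).resolve_left (by omega)
          obtain ⟨y', rfl | rfl⟩ := Nat.even_or_odd' x'
          · exact absurd h0 (zero_notMem_codedMultiset_even y')
          · rw [codedMultiset_odd, Multiset.cons_swap, Multiset.cons_inj_right] at h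
            refine Or.inr (Or.inr ⟨y', by omega, y, by omega, by omega, by omega, ?_⟩)
            exact ih y (by omega) u y' hu (by omega) (by omega) h

theorem mem_codedMultiset_iff {w : List Bool} {u x : ℕ} (hx : x < univSize w) :
    u ∈ codedMultiset x ↔ ∃ x' < univSize w, InsAt w u x' x := by
  constructor
  · intro h
    obtain ⟨M, hM⟩ := Multiset.exists_cons_of_mem h
    obtain ⟨x', hx', rfl⟩ := exists_codedMultiset_of_cons hM
    exact ⟨x', by omega, hM⟩
  · rintro ⟨x', -, h⟩
    rw [InsAt] at h
    rw [h]
    exact Multiset.mem_cons_self _ _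

/-- No matching between old and new positions is searched as a whole: the fixed point removes one
matched pair at a time, as in the constructors of `Multiset.Rel`. -/
theorem decRel_codedTurn : DecRel₂ fun w => CodedTurn (InCAt w) (AdjAt w) := by
  refine DecRel₂.fix (fun w X x y => (x = 0 ∧ y = 0) ∨
    ∃ u < univSize w, ∃ v < univSize w, ∃ x₁ < univSize w, ∃ y₁ < univSize w,
      InsAt w u x₁ x ∧ InsAt w v y₁ y ∧ (InCAt w u ∧ InCAt w v ∧ (v = u ∨ AdjAt w u v)) ∧
        X x₁ y₁) ?_ ?_ ?_
  · intro k a x y hx hy hx0 hy0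
    refine Dec.congr (k := k) (a := a + 1) (((Dec.eq_zero x).and (Dec.eq_zero y)).or
      (.ex (.ex (.ex (.ex ((decRel_insAt.dec k (k + 2) x).and
        ((decRel_insAt.dec (k + 1) (k + 3) y).and
        (((decRel_inCAt.dec k).and ((decRel_inCAt.dec (k + 1)).and
          ((Dec.eq (k + 1) k).or (decRel_adjAt.dec k (k + 1))))).and
        (Dec.rel₂ a (k + 2) (k + 3)))))))))) fun w s _ => ?_
    simp (disch := omega) only [RAM.setReg_self, RAM.setReg_of_ne, RAM.setReg_rel₂]
  · rintro w X hX x y hx hy (⟨rfl, rfl⟩ | ⟨u, hu, v, hv, x₁, hx₁, y₁, hy₁, h₁, h₂, h₃, h₄⟩)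
    · simp [CodedTurn]
    · rw [InsAt] at h₁ h₂
      rw [CodedTurn, h₁, h₂]
      exact .cons h₃ (hX _ _ hx₁ hy₁ h₄)
  · intro w X hX x y hx hy h
    rw [CodedTurn] at h
    generalize hM : codedMultiset x = M at h
    generalize hN : codedMultiset y = N at h
    induction h generalizing x y with
    | zero =>
      exact hX _ _ hx hy (Or.inl ⟨codedMultiset_eq_zero hM, codedMultiset_eq_zero hN⟩)
    | @cons u v M N huv _ ih =>
      obtain ⟨x₁, hx₁, rfl⟩ := exists_codedMultiset_of_cons hM
      obtain ⟨y₁, hy₁, rfl⟩ := exists_codedMultiset_of_cons hN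
      have hu := (codedMultiset_cons_lt hM).2
      have hv := (codedMultiset_cons_lt hN).2
      exact hX _ _ hx hy (Or.inr ⟨u, by omega, v, by omega, x₁, by omega, y₁, by omega, hM, hN, huv,
        ih x₁ y₁ (by omega) (by omega) rfl rfl⟩)

/-- This is the computation of the attractor: the operator is one turn of Robber followed by all
replies of the cops. -/
theorem decRel_codedForces :
    DecRel₂ fun w => CodedForces (InCAt w) (AdjAt w) (univSize w) := by
  refine DecRel₂.fix (fun w X r x => ∃ r' < univSize w, (r' = r ∨ AdjAt w r r') ∧
    ¬ (∃ x' < univSize w, InsAt w r' x' x) ∧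
    (InCAt w r' ∨ ∀ y < univSize w, CodedTurn (InCAt w) (AdjAt w) x y → X r' y)) ?_ ?_ ?_
  · intro k a x y hx hy hx0 hy0
    refine Dec.congr (k := k) (a := a + 1) (.ex (((Dec.eq k x).or (decRel_adjAt.dec x k)).and
      ((Dec.ex (decRel_insAt.dec k (k + 1) y)).not.and ((decRel_inCAt.dec k).or
      (.all ((decRel_codedTurn.dec y (k + 1)).imp (Dec.rel₂ a k (k + 1)))))))) fun w s _ => ?_
    simp (disch := omega) only [RAM.setReg_self, RAM.setReg_of_ne, RAM.setReg_rel₂]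
  · rintro w X hX r x hr hx ⟨r', hr', h₁, h₂, h₃⟩
    rw [← mem_codedMultiset_iff hx] at h₂
    rcases h₃ with h₃ | h₃
    · exact .enter hr' h₁ h₂ h₃
    · exact .move hr' h₁ h₂ fun y hy h => hX _ _ hr' hy (h₃ y hy h)
  · intro w X hX r x hr hx h
    induction h with
    | enter hr' h₁ h₂ h₃ =>
      rw [mem_codedMultiset_iff hx] at h₂
      exact hX _ _ hr hx ⟨_, hr', h₁, h₂, Or.inl h₃⟩
    | move hr' h₁ h₂ _ ih =>
      rw [mem_codedMultiset_iff hx] at h₂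
      exact hX _ _ hr hx ⟨_, hr', h₁, h₂, Or.inr fun y hy h => ih y hy h hr' hy⟩

/-- The number `x` codes the positions of `k` cops in the cop-region. -/
def CopsAt (w : List Bool) (k x : ℕ) : Prop :=
  (codedMultiset x).card = k ∧ ∀ u ∈ codedMultiset x, InCAt w u

theorem decRel_copsAt : DecRel₂ CopsAt := by
  refine DecRel₂.fix (fun w X k x => (k = 0 ∧ x = 0) ∨
    ∃ k₁ < univSize w, ∃ u < univSize w, ∃ x₁ < univSize w, k₁ + 1 = k ∧ InCAt w u ∧
      InsAt w u x₁ x ∧ X k₁ x₁) ?_ ?_ ?_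
  · intro k a x y hx hy hx0 hy0
    refine Dec.congr (k := k) (a := a + 1) (((Dec.eq_zero x).and (Dec.eq_zero y)).or
      (.ex (.ex (.ex ((Dec.add_const k 1 x).and ((decRel_inCAt.dec (k + 1)).and
        ((decRel_insAt.dec (k + 1) (k + 2) y).and (Dec.rel₂ a k (k + 2))))))))) fun w s _ => ?_
    simp (disch := omega) only [RAM.setReg_self, RAM.setReg_of_ne, RAM.setReg_rel₂]
  · rintro w X hX k x hk hx (⟨rfl, rfl⟩ | ⟨k₁, hk₁, u, hu, x₁, hx₁, rfl, h₁, h₂, h₃⟩)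
    · simp [CopsAt]
    · obtain ⟨rfl, h₄⟩ := hX _ _ hk₁ hx₁ h₃
      rw [InsAt] at h₂
      refine ⟨by rw [h₂, Multiset.card_cons], fun v hv => ?_⟩
      rw [h₂] at hv
      rcases Multiset.mem_cons.1 hv with rfl | hv
      · exact h₁
      · exact h₄ v hv
  · rintro w X hX k x hk hx ⟨h₁, h₂⟩
    induction k generalizing x with
    | zero =>
      exact hX _ _ hk hx (Or.inl ⟨rfl, codedMultiset_eq_zero (Multiset.card_eq_zero.1 h₁)⟩)
    | succ k ih =>
      obtain ⟨u, hu⟩ := Multiset.card_pos_iff_exists_mem.1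
        (h₁ ▸ k.succ_pos : 0 < (codedMultiset x).card)
      obtain ⟨M, hM⟩ := Multiset.exists_cons_of_mem hu
      obtain ⟨x₁, hx₁, rfl⟩ := exists_codedMultiset_of_cons hM
      have hlt := (codedMultiset_cons_lt hM).2
      rw [hM, Multiset.card_cons, Nat.add_right_cancel_iff] at h₁
      refine hX _ _ hk hx (Or.inr ⟨k, by omega, u, by omega, x₁, by omega, rfl, h₂ u hu, hM,
        ih x₁ (by omega) (by omega) h₁ fun v hv => h₂ v ?_⟩)
      · rw [hM]
        exact Multiset.mem_cons_of_mem hv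

/-- The word ends, from position `p` on, with the codes of `k` vertices of the cop-region, and `x`
codes the multiset of these vertices. -/
def TailAt (w : List Bool) (p k x : ℕ) : Prop :=
  ∃ l : List ℕ, w.drop p = l.flatMap binaryCode ∧ l.length = k ∧ codedMultiset x = l ∧
    ∀ v ∈ l, InCAt w v

theorem decRel_tailAt : DecRel TailAt := by
  refine DecRel.fix (fun w X p k x => (w[p]? = none ∧ k = 0 ∧ x = 0) ∨
    ∃ v < univSize w, ∃ p₁ < univSize w, ∃ k₁ < univSize w, ∃ x₁ < univSize w, NumAt w p v p₁ ∧
      InCAt w v ∧ X p₁ k₁ x₁ ∧ k₁ + 1 = k ∧ InsAt w v x₁ x) ?_ ?_ ?_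
  · intro k a x y z hx hy hz hx0 hy0 hz0
    refine Dec.congr (k := k) (a := a + 1)
      (((Dec.inp none x).and ((Dec.eq_zero y).and (Dec.eq_zero z))).or
      (.ex (.ex (.ex (.ex ((decRel_numAt.dec x k (k + 1)).and ((decRel_inCAt.dec k).and
        ((Dec.rel a (k + 1) (k + 2) (k + 3)).and ((Dec.add_const (k + 2) 1 y).and
          (decRel_insAt.dec k (k + 3) z)))))))))) fun w s _ => ?_
    simp (disch := omega) only [RAM.setReg_self, RAM.setReg_of_ne, RAM.setReg_rel]
  · rintro w X hX p k x hp hk hx (⟨h₁, rfl, rfl⟩ |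
      ⟨v, hv, p₁, hp₁, k₁, hk₁, x₁, hx₁, h₁, h₂, h₃, rfl, h₄⟩)
    · refine ⟨[], ?_, rfl, by simp, by simp⟩
      rw [List.flatMap_nil, List.drop_eq_nil_iff]
      simpa using h₁
    · obtain ⟨l, h₅, rfl, h₆, h₇⟩ := hX _ _ _ hp₁ hk₁ hx₁ h₃
      rw [InsAt] at h₄
      refine ⟨v :: l, by rw [h₁.1, h₅, List.flatMap_cons], rfl, by rw [h₄, h₆]; rfl, ?_⟩
      intro u hu
      rcases List.mem_cons.1 hu with rfl | hu
      · exact h₂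
      · exact h₇ u hu
  · rintro w X hX p k x hp hk hx ⟨l, h₁, rfl, h₂, h₃⟩
    have hlen := length_lt_univSize w
    induction l generalizing p x with
    | nil =>
      refine hX _ _ _ hp hk hx (Or.inl ⟨?_, rfl, codedMultiset_eq_zero h₂⟩)
      rw [List.flatMap_nil, List.drop_eq_nil_iff] at h₁
      simpa using h₁
    | cons v l ih =>
      rw [List.flatMap_cons] at h₁
      obtain ⟨p₁, h₄, h₅⟩ := exists_numAt h₁
      have hM : codedMultiset x = v ::ₘ (l : Multiset ℕ) := h₂
      obtain ⟨x₁, hx₁, hx₁'⟩ := exists_codedMultiset_of_cons hM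
      have hv := h₄.val_lt
      have hp₁ := h₄.2
      rw [List.length_cons] at hk
      refine hX _ _ _ hp hk hx (Or.inr ⟨v, by omega, p₁, by omega, l.length, by omega, x₁, by omega,
        h₄, h₃ v (by simp), ?_, rfl, by rw [InsAt, hM, hx₁']⟩)
      exact ih p₁ x₁ (by omega) (by omega) h₅ (by omega) hx₁' fun u hu => h₃ u (by simp [hu])

/-! ### Unique readability of the codes -/

theorem nat_bits_injective : Function.Injective Nat.bits := by
  intro a b h
  refine Nat.eq_of_testBit_eq fun i => ?_
  rw [Nat.testBit_eq_inth, Nat.testBit_eq_inth, h]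

theorem flatMap_digits_append_inj {l l' : List Bool} {s t : List Bool}
    (h : l.flatMap (fun b => [true, b]) ++ false :: s =
      l'.flatMap (fun b => [true, b]) ++ false :: t) : l = l' ∧ s = t := by
  induction l generalizing l' with
  | nil => cases l' <;> simp_all
  | cons b l ih =>
    cases l' with
    | nil => simp at h
    | cons b' l' =>
      simp only [List.flatMap_cons, List.cons_append, List.nil_append, List.cons.injEq,
        true_and] at h
      obtain ⟨rfl, rfl⟩ := ih h.2
      exact ⟨by rw [h.1], rfl⟩

theorem binaryCode_append_inj {a b : ℕ} {s t : List Bool}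
    (h : binaryCode a ++ s = binaryCode b ++ t) : a = b ∧ s = t := by
  simp only [binaryCode, List.append_assoc, List.singleton_append] at h
  obtain ⟨h₁, rfl⟩ := flatMap_digits_append_inj h
  exact ⟨nat_bits_injective h₁, rfl⟩

theorem nbrCode_append_inj {l l' : List ℕ} {s t : List Bool}
    (h : nbrCode l ++ false :: s = nbrCode l' ++ false :: t) : l = l' ∧ s = t := by
  induction l generalizing l' with
  | nil => cases l' <;> simp_all
  | cons a l ih =>
    cases l' with
    | nil => simp at h
    | cons b l' =>
      simp only [nbrCode_cons, List.cons_append, List.append_assoc, List.cons.injEq,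
        true_and] at h
      obtain ⟨rfl, h₁⟩ := binaryCode_append_inj h
      obtain ⟨rfl, rfl⟩ := ih h₁
      exact ⟨rfl, rfl⟩

/-- Both sides are read in step. The `0` that ends the list cannot match the `1` before an item, so
the reading of `l'` and `j` never leaves `l`. -/
theorem mem_of_nbrCode_append {l l' : List ℕ} {j : ℕ} {s t : List Bool}
    (h : nbrCode l ++ false :: s = nbrCode l' ++ true :: (binaryCode j ++ t)) : j ∈ l := by
  induction l' generalizing l with
  | nil =>
    cases l with
    | nil => simp at h
    | cons a l =>
      simp only [nbrCode_cons, nbrCode_nil, List.nil_append, List.cons_append, List.append_assoc,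
        List.cons.injEq, true_and] at h
      simp [(binaryCode_append_inj h).1]
  | cons b l' ih =>
    cases l with
    | nil => simp at h
    | cons a l =>
      simp only [nbrCode_cons, List.cons_append, List.append_assoc, List.cons.injEq,
        true_and] at h
      exact List.mem_cons_of_mem _ (ih (binaryCode_append_inj h).2)

theorem entryCode_append_inj {e e' : Bool × List ℕ} {s t : List Bool}
    (h : entryCode e ++ s = entryCode e' ++ t) : e = e' ∧ s = t := by
  simp only [entryCode, List.cons_append, List.append_assoc, List.cons.injEq, true_and] at h
  obtain ⟨h₁, h₂⟩ := nbrCode_append_inj h.2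
  exact ⟨Prod.ext h.1 h₁, h₂⟩

/-- Every entry begins with `1`, so reading entries cannot pass the `0` at the end of `D`. -/
theorem entries_append_eq {D D' : List (Bool × List ℕ)} {s t : List Bool}
    (h : D'.flatMap entryCode ++ s = D.flatMap entryCode ++ false :: t) :
    ∃ D₂, D = D' ++ D₂ ∧ s = D₂.flatMap entryCode ++ false :: t := by
  induction D' generalizing D with
  | nil => exact ⟨D, rfl, h⟩
  | cons e D' ih =>
    cases D with
    | nil => simp [entryCode] at h
    | cons e' D =>
      simp only [List.flatMap_cons, List.append_assoc] at h
      obtain ⟨rfl, h₁⟩ := entryCode_append_inj h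
      obtain ⟨D₂, rfl, h₂⟩ := ih h₁
      exact ⟨D₂, rfl, h₂⟩

/-! ### Words that begin with the code of a graph -/

/-- The word begins with the number `c`, the entries `D` and a `0`, and goes on with `t`. -/
structure Encodes (w : List Bool) (c : ℕ) (D : List (Bool × List ℕ)) (t : List Bool) : Prop where
  eq : w = binaryCode c ++ D.flatMap entryCode ++ false :: t
  sorted : ∀ e ∈ D, e.2.Pairwise (· < ·)

namespace Encodes

variable {w t : List Bool} {c : ℕ} {D : List (Bool × List ℕ)}

/-- `EntryAt` speaks of some number and some entries; unique readability identifies them with `c`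
and an initial part of `D`. -/
theorem exists_of_entryAt (h : Encodes w c D t) {i q : ℕ} (hi : EntryAt w i q) :
    ∃ D₁ D₂, D = D₁ ++ D₂ ∧ D₁.length = i ∧ w.drop q = D₂.flatMap entryCode ++ false :: t := by
  obtain ⟨c', D₁, hD₁, -, hw, -⟩ := hi
  have h₁ : binaryCode c' ++ (D₁.flatMap entryCode ++ w.drop q) =
      binaryCode c ++ (D.flatMap entryCode ++ false :: t) := by
    rw [← List.append_assoc, ← List.append_assoc, ← hw]
    exact h.eq
  obtain ⟨D₂, h₂, h₃⟩ := entries_append_eq (binaryCode_append_inj h₁).2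
  exact ⟨D₁, D₂, h₂, hD₁, h₃⟩

theorem entryAt (h : Encodes w c D t) {D₁ D₂ : List (Bool × List ℕ)} (hD : D = D₁ ++ D₂) :
    ∃ q, EntryAt w D₁.length q ∧ w.drop q = D₂.flatMap entryCode ++ false :: t ∧
      q = (binaryCode c ++ D₁.flatMap entryCode).length := by
  have h₁ : w.drop 0 = (binaryCode c ++ D₁.flatMap entryCode) ++
      (D₂.flatMap entryCode ++ false :: t) := by
    rw [List.drop_zero, h.eq, hD]
    simp
  have h₂ := drop_add_of_append h₁
  rw [Nat.zero_add] at h₂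
  refine ⟨_, ⟨c, D₁, rfl, fun e he => h.sorted e (by simp [hD, he]), ?_, ?_⟩, h₂, rfl⟩
  · rw [h₂]
    simpa using h₁
  · have := congrArg List.length h₁
    rw [List.drop_zero, List.length_append] at this
    omega

theorem getElem?_of_entryAt (h : Encodes w c D t) {i q : ℕ} (hi : EntryAt w i q)
    (hq : w[q]? = some true) : ∃ e r, D[i]? = some e ∧ w.drop q = entryCode e ++ r := by
  obtain ⟨D₁, D₂, rfl, rfl, h₁⟩ := h.exists_of_entryAt hi
  cases D₂ with
  | nil => simp [(drop_eq_cons_iff.1 h₁).1] at hq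
  | cons e D₂ => exact ⟨e, D₂.flatMap entryCode ++ false :: t, by simp, by rw [h₁]; simp⟩

theorem exists_entryAt (h : Encodes w c D t) {i : ℕ} {e : Bool × List ℕ} (he : D[i]? = some e) :
    ∃ q r, EntryAt w i q ∧ w.drop q = entryCode e ++ r := by
  obtain ⟨hi, rfl⟩ := List.getElem?_eq_some_iff.1 he
  obtain ⟨q, h₁, h₂, -⟩ := h.entryAt (List.take_append_drop i D).symm
  rw [List.length_take, Nat.min_eq_left hi.le] at h₁
  rw [List.drop_eq_getElem_cons hi, List.flatMap_cons, List.append_assoc] at h₂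
  exact ⟨q, _, h₁, h₂⟩

theorem inCAt_iff (h : Encodes w c D t) {i : ℕ} :
    InCAt w i ↔ ∃ e, D[i]? = some e ∧ e.1 = true := by
  constructor
  · rintro ⟨q, -, _, -, h₁, h₂, rfl, h₃⟩
    obtain ⟨e, r, h₄, h₅⟩ := h.getElem?_of_entryAt h₁ h₂
    refine ⟨e, h₄, ?_⟩
    have h₆ := (drop_eq_cons_iff.1 h₅).2
    rw [(drop_eq_cons_iff.1 h₆.symm).1] at h₃
    exact Option.some_injective _ h₃
  · rintro ⟨e, h₁, h₂⟩
    obtain ⟨q, r, h₃, h₄⟩ := h.exists_entryAt h₁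
    obtain ⟨h₅, h₆⟩ := drop_eq_cons_iff.1 h₄
    have h₇ := (drop_eq_cons_iff.1 h₆.symm).1
    have := length_lt_univSize w
    have := le_of_drop_eq_cons h₄
    exact ⟨q, by omega, q + 1, by omega, h₃, h₅, rfl, h₂ ▸ h₇⟩

theorem adjAt_iff (h : Encodes w c D t) {i j : ℕ} :
    AdjAt w i j ↔ ∃ e, D[i]? = some e ∧ j ∈ e.2 := by
  have hdrop : ∀ {q e r}, w.drop q = entryCode e ++ r →
      w[q]? = some true ∧ w.drop (q + 2) = nbrCode e.2 ++ false :: r ∧ q + 2 ≤ w.length := by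
    intro q e r h₄
    obtain ⟨h₅, h₆⟩ := drop_eq_cons_iff.1 h₄
    obtain ⟨-, h₇⟩ := drop_eq_cons_iff.1 h₆.symm
    refine ⟨h₅, ?_, le_of_drop_eq_cons h₆.symm⟩
    rw [← h₇]
    simp
  constructor
  · rintro ⟨q, -, _, -, h₁, h₂, rfl, l, r', h₃⟩
    obtain ⟨e, r, h₄, h₅⟩ := h.getElem?_of_entryAt h₁ h₂
    rw [(hdrop h₅).2.1] at h₃
    exact ⟨e, h₄, mem_of_nbrCode_append h₃⟩
  · rintro ⟨e, h₁, h₂⟩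
    obtain ⟨q, r, h₃, h₄⟩ := h.exists_entryAt h₁
    obtain ⟨h₅, h₆, h₇⟩ := hdrop h₄
    have := length_lt_univSize w
    refine ⟨q, by omega, q + 2, by omega, h₃, h₅, rfl, ?_⟩
    obtain ⟨l₁, l₂, h₈⟩ := List.append_of_mem h₂
    refine ⟨l₁, nbrCode l₂ ++ false :: r, ?_⟩
    rw [h₆, h₈]
    simp [nbrCode]

/-- The factor `2` leaves room for as many cops as vertices, and the summand `t.length` for cops
that are listed after the graph. -/
theorem length_le (h : Encodes w c D t) : 2 * D.length + t.length + 1 ≤ w.length := by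
  have : ∀ D : List (Bool × List ℕ), 2 * D.length ≤ (D.flatMap entryCode).length := by
    intro D
    induction D with
    | nil => simp
    | cons e D ih =>
      simp only [List.length_cons, List.flatMap_cons, List.length_append, entryCode]
      omega
  have := this D
  rw [h.eq]
  simp only [List.length_append, List.length_cons]
  omega

theorem numAt (h : Encodes w c D t) : NumAt w 0 c (binaryCode c).length := by
  obtain ⟨q, h₁, h₂⟩ := exists_numAt (w := w) (p := 0) (v := c)
    (l := D.flatMap entryCode ++ false :: t) (by rw [List.drop_zero, h.eq, List.append_assoc])
  have := h₁.eq_add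
  rw [Nat.zero_add] at this
  rwa [← this]

end Encodes

/-- Thus the bounded quantifier over `j` in `GraphAt` misses no out-neighbour that occurs in the
word. -/
theorem AdjAt.lt_univSize {w : List Bool} {i j : ℕ} (h : AdjAt w i j) : j < univSize w := by
  obtain ⟨q, -, p, -, -, -, -, l, r, h⟩ := h
  obtain ⟨-, h₁⟩ := drop_eq_cons_iff.1 (drop_add_of_append h)
  obtain ⟨_, h₂, -⟩ := exists_numAt h₁.symm
  have := h₂.val_lt
  omega

/-! ### Games and lists of entries -/

namespace GuardingGame

open Classical in
/-- The entries of the vertices in the adjacency list. -/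
noncomputable def entries (G : GuardingGame) : List (Bool × List ℕ) :=
  (List.finRange G.order).map fun v => (decide (v ∈ G.copRegion),
    ((List.finRange G.order).filter (fun u => G.graph.Adj v u)).map Fin.val)

theorem code_eq (G : GuardingGame) :
    G.code = binaryCode G.cops ++ G.entries.flatMap entryCode ++ [false] := by
  simp [code, entries, vertexCode, entryCode, nbrCode, List.flatMap_map, List.flatMap_assoc]

@[simp] theorem length_entries (G : GuardingGame) : G.entries.length = G.order := by
  simp [entries]

theorem encodes (G : GuardingGame) (t : List Bool) :
    Encodes (G.code ++ t) G.cops G.entries t := by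
  refine ⟨by rw [code_eq]; simp, fun e he => ?_⟩
  obtain ⟨v, -, rfl⟩ := List.mem_map.1 he
  exact List.pairwise_map.2 ((List.pairwise_lt_finRange _).filter _)

theorem describes (G : GuardingGame) (t : List Bool) :
    G.Describes (InCAt (G.code ++ t)) (AdjAt (G.code ++ t)) := by
  have h := G.encodes t
  constructor
  · intro u hu
    obtain ⟨e, he, -⟩ := h.inCAt_iff.1 hu
    simpa using (List.getElem?_eq_some_iff.1 he).1
  · intro v
    simp [h.inCAt_iff, entries]
  · intro u v huv
    obtain ⟨e, he, hv⟩ := h.adjAt_iff.1 huv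
    obtain ⟨hu, rfl⟩ := List.getElem?_eq_some_iff.1 he
    refine ⟨by simpa using hu, ?_⟩
    simp only [entries, List.getElem_map, List.mem_map] at hv
    obtain ⟨x, -, rfl⟩ := hv
    exact x.2
  · intro u v
    simp [h.adjAt_iff, entries, Fin.val_inj]

theorem graphAt (G : GuardingGame) (t : List Bool) :
    ∃ q, GraphAt (G.code ++ t) G.order G.cops q ∧ (G.code ++ t).drop (q + 1) = t ∧
      q + 1 ≤ (G.code ++ t).length := by
  have h := G.encodes t
  have hG := G.describes t
  have hlen := h.length_le
  have hB := length_lt_univSize (G.code ++ t)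
  rw [length_entries] at hlen
  obtain ⟨q, h₁, h₂, -⟩ := h.entryAt (List.append_nil _).symm
  rw [length_entries] at h₁
  obtain ⟨h₃, h₄⟩ := drop_eq_cons_iff.1 h₂
  obtain ⟨v, hv⟩ := G.copRegion_nonempty
  have hnum := h.numAt
  refine ⟨q, ⟨h₁, h₃, ⟨0, by omega, _, lt_of_le_of_lt hnum.2 (by omega), rfl, hnum⟩,
    ⟨v, by omega, (hG.inC_iff v).2 hv⟩, fun i _ j _ hij => (hG.lt_of_adj hij).2⟩, h₄.symm,
    le_of_drop_eq_cons h₂⟩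

/-- The game on the vertices `0, …, |D| - 1` with entries `D`. -/
def ofEntries (c : ℕ) (D : List (Bool × List ℕ)) (h : ∃ e ∈ D, e.1 = true) : GuardingGame where
  order := D.length
  graph := ⟨fun i j => (j : ℕ) ∈ D[i].2⟩
  copRegion := Finset.univ.filter fun i => D[i].1 = true
  copRegion_nonempty := by
    obtain ⟨e, he, h₁⟩ := h
    obtain ⟨i, hi, rfl⟩ := List.mem_iff_getElem.1 he
    exact ⟨⟨i, hi⟩, by simpa using h₁⟩
  cops := c

/-- A strictly increasing list is determined by its members; `hlt` ensures that no out-neighbour is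
lost in passing to `Fin`. -/
theorem entries_ofEntries (c : ℕ) (D : List (Bool × List ℕ)) (h : ∃ e ∈ D, e.1 = true)
    (hs : ∀ e ∈ D, e.2.Pairwise (· < ·)) (hlt : ∀ e ∈ D, ∀ j ∈ e.2, j < D.length) :
    (ofEntries c D h).entries = D := by
  refine List.ext_getElem (by rw [length_entries]; rfl) fun i h₁ h₂ => ?_
  simp only [entries, List.getElem_map]
  refine Prod.ext ?_ ?_
  · rw [Bool.eq_iff_iff, decide_eq_true_iff]
    refine (Finset.mem_filter_univ _).trans ?_
    simp only [List.getElem_finRange]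
    rfl
  · refine List.Pairwise.eq_of_mem_iff (r := (· < ·))
      (List.pairwise_map.2 ((List.pairwise_lt_finRange _).filter _)) (hs _ (List.getElem_mem h₂)) ?_
    intro j
    simp only [List.mem_map, List.mem_filter, List.mem_finRange, true_and, decide_eq_true_eq]
    constructor
    · rintro ⟨v, hv, rfl⟩
      simpa [ofEntries] using hv
    · intro hj
      exact ⟨⟨j, hlt _ (List.getElem_mem h₂) j hj⟩, by simpa [ofEntries] using hj, rfl⟩

end GuardingGame

theorem GraphAt.exists_game {w : List Bool} {m c q : ℕ} (h : GraphAt w m c q) :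
    ∃ G : GuardingGame, w = G.code ++ w.drop (q + 1) ∧ G.order = m ∧ G.cops = c := by
  obtain ⟨⟨c', D, rfl, hs, hw, hq⟩, h₁, ⟨_, -, p, -, rfl, h₂⟩, ⟨i, -, h₃⟩, h₄⟩ := h
  have hE : Encodes w c' D (w.drop (q + 1)) := by
    refine ⟨?_, hs⟩
    rw [← drop_eq_cons_iff.2 ⟨h₁, rfl⟩]
    exact hw
  -- Both numbers are read at position `0`.
  obtain rfl : c = c' := (binaryCode_append_inj (h₂.1.symm.trans hE.numAt.1)).1
  have hB := length_lt_univSize w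
  have hlen := hE.length_le
  obtain ⟨e, he, he'⟩ := hE.inCAt_iff.1 h₃
  have hlt : ∀ e ∈ D, ∀ j ∈ e.2, j < D.length := by
    intro e he j hj
    obtain ⟨i, hi, rfl⟩ := List.mem_iff_getElem.1 he
    have hadj : AdjAt w i j := hE.adjAt_iff.2 ⟨_, List.getElem?_eq_getElem hi, hj⟩
    exact h₄ i (by omega) j hadj.lt_univSize hadj
  refine ⟨.ofEntries c D ⟨e, List.mem_of_getElem? he, he'⟩, ?_, rfl, rfl⟩
  rw [GuardingGame.code_eq, GuardingGame.entries_ofEntries _ _ _ hs hlt]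
  simpa [GuardingGame.ofEntries] using hE.eq

/-! ### The decision problems -/

namespace GuardingGame

variable {G : GuardingGame}

theorem positions_eq (S : G.Placement) : positions S = (List.ofFn S).map Fin.val := by
  rw [positions, Fin.univ_val_map, List.map_ofFn]
  rfl

theorem exists_placement {l : List ℕ} (hl : l.length = G.cops)
    (h : ∀ u ∈ l, ∃ v ∈ G.copRegion, (v : ℕ) = u) :
    ∃ S : G.Placement, (∀ i, S i ∈ G.copRegion) ∧ (List.ofFn S).map Fin.val = l := by
  choose f hf hf' using h
  refine ⟨fun i => f (l[(i : ℕ)]'(by omega)) (List.getElem_mem _), fun i => hf _ _, ?_⟩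
  refine List.ext_getElem (by simp [hl]) fun i h₁ h₂ => ?_
  simp [hf']

theorem Describes.exists_of_inC {InC : ℕ → Prop} {Adj : ℕ → ℕ → Prop} (hG : G.Describes InC Adj)
    {u : ℕ} (hu : InC u) : ∃ v ∈ G.copRegion, (v : ℕ) = u :=
  ⟨⟨u, hG.lt_of_inC hu⟩, (hG.inC_iff ⟨u, hG.lt_of_inC hu⟩).1 hu, rfl⟩

theorem Describes.inC_of_mem_positions {InC : ℕ → Prop} {Adj : ℕ → ℕ → Prop}
    (hG : G.Describes InC Adj) {S : G.Placement} (hS : ∀ i, S i ∈ G.copRegion) {u : ℕ}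
    (hu : u ∈ positions S) : InC u := by
  obtain ⟨i, -, rfl⟩ := Multiset.mem_map.1 hu
  exact (hG.inC_iff _).2 (hS i)

theorem exists_codedMultiset_positions {B : ℕ} (hB : 2 ^ (G.order + G.cops) ≤ B)
    (S : G.Placement) : ∃ x < B, codedMultiset x = positions S := by
  obtain ⟨x, hx, h⟩ := exists_codedMultiset G.order (positions S) fun u hu => by
    obtain ⟨i, -, rfl⟩ := Multiset.mem_map.1 hu
    exact (S i).2
  rw [card_positions] at hx
  exact ⟨x, hx.trans_le hB, h⟩

end GuardingGame

theorem two_pow_le_univSize {w : List Bool} {n : ℕ} (h : n ≤ w.length + 1) :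
    2 ^ n ≤ univSize w :=
  Nat.pow_le_pow_right two_pos h

theorem length_le_length_flatMap_binaryCode (l : List ℕ) :
    l.length ≤ (l.flatMap binaryCode).length := by
  induction l with
  | nil => simp
  | cons a l ih =>
    have := List.length_pos_iff.2 (binaryCode_ne_nil a)
    rw [List.flatMap_cons, List.length_append, List.length_cons]
    omega

/-- The clause `c < m` costs nothing by `RobberWins.cops_lt_order`, and it gives `m + c ≤ 2 * m ≤
w.length`, so that all placements have codes in the universe. -/
theorem mem_Guard_iff (w : List Bool) :
    w ∈ Guard ↔ ∃ m < univSize w, ∃ c < univSize w, ∃ q < univSize w, ∃ q₁ < univSize w,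
      ∃ r < univSize w, GraphAt w m c q ∧ q + 1 = q₁ ∧ w[q₁]? = none ∧ c < m ∧ r < m ∧ ¬ InCAt w r ∧
        ∀ x < univSize w, CopsAt w c x →
          CodedForces (InCAt w) (AdjAt w) (univSize w) r x := by
  have hB := length_lt_univSize w
  constructor
  · rintro ⟨G, hw, hwin⟩
    have hc := hwin.cops_lt_order
    obtain ⟨r, hr, hr'⟩ := hwin
    obtain ⟨q, hq, hdrop, hlt⟩ := G.graphAt []
    have hG := G.describes []
    have hlen := (G.encodes []).length_le
    rw [List.append_nil, hw] at hq hdrop hlt hG hlen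
    rw [GuardingGame.length_entries] at hlen
    have hr₀ := r.2
    refine ⟨G.order, by omega, G.cops, by omega, q, by omega, q + 1, by omega, r, by omega, hq, rfl,
      ?_, hc, hr₀, fun h => hr ((hG.inC_iff r).1 h), fun x hx hcops => ?_⟩
    · rw [List.drop_eq_nil_iff] at hdrop
      simpa using hdrop
    · obtain ⟨S, hS, hx'⟩ := GuardingGame.exists_placement (G := G)
        (l := (codedMultiset x).toList) (by rw [Multiset.length_toList, hcops.1])
        fun u hu => hG.exists_of_inC (hcops.2 u (Multiset.mem_toList.1 hu))
      refine (hG.codedForces_iff (two_pow_le_univSize ?_) hS ?_).2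
        ((GuardingGame.robberWinsFrom_iff hr hS).1 (hr' S hS))
      · omega
      · rw [GuardingGame.positions_eq, hx', Multiset.coe_toList]
  · rintro ⟨_, -, _, -, q, -, _, -, r, -, hgraph, rfl, hend, hcm, hr, hrC, hforces⟩
    obtain ⟨G, hw, rfl, rfl⟩ := hgraph.exists_game
    have hend' : w.drop (q + 1) = [] := by
      rw [List.drop_eq_nil_iff]
      simpa using hend
    have hG := G.describes []
    have hlen := (G.encodes []).length_le
    rw [hend'] at hw
    rw [← hw] at hG hlen
    rw [GuardingGame.length_entries] at hlen
    have hB' : 2 ^ (G.order + G.cops) ≤ univSize w := two_pow_le_univSize (by omega)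
    have hr' : (⟨r, hr⟩ : Fin G.order) ∉ G.copRegion := fun h => hrC ((hG.inC_iff ⟨r, hr⟩).2 h)
    refine ⟨G, by rw [hw, List.append_nil], ⟨r, hr⟩, hr', fun S hS => ?_⟩
    obtain ⟨x, hx, hxS⟩ := GuardingGame.exists_codedMultiset_positions hB' S
    refine (GuardingGame.robberWinsFrom_iff hr' hS).2 ((hG.codedForces_iff hB' hS hxS).1
      (hforces x hx ⟨by rw [hxS, GuardingGame.card_positions], fun u hu => ?_⟩))
    rw [hxS] at hu
    exact hG.inC_of_mem_positions hS hu

theorem GuardingGamePSP.code_eq (G : GuardingGamePSP) :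
    G.code = G.toGuardingGame.code ++ (binaryCode G.robberStart ++
      ((List.ofFn G.copStart).map Fin.val).flatMap binaryCode) := by
  rw [GuardingGamePSP.code, List.append_assoc]
  congr 2
  simp only [List.flatMap_map]
  simp [List.flatMap_assoc]

/-- No comparison of `c` with `m` is needed here: the word contains a non-empty code for each cop,
which bounds `c` by the length of the part after the graph. -/
theorem mem_GuardPSP_iff (w : List Bool) :
    w ∈ GuardPSP ↔ ∃ m < univSize w, ∃ c < univSize w, ∃ q < univSize w, ∃ q₁ < univSize w,
      ∃ r < univSize w, ∃ p < univSize w, ∃ x < univSize w, GraphAt w m c q ∧ q + 1 = q₁ ∧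
        NumAt w q₁ r p ∧ r < m ∧ ¬ InCAt w r ∧ TailAt w p c x ∧
          CodedForces (InCAt w) (AdjAt w) (univSize w) r x := by
  have hB := length_lt_univSize w
  constructor
  · rintro ⟨G, hw, hwin⟩
    obtain ⟨t, ht⟩ : ∃ t, t = binaryCode G.robberStart ++
      ((List.ofFn G.copStart).map Fin.val).flatMap binaryCode := ⟨_, rfl⟩
    have hcode : G.toGuardingGame.code ++ t = w := by rw [← hw, G.code_eq, ht]
    obtain ⟨q, hq, hdrop, hlt⟩ := G.graphAt t
    have hG := G.describes t
    have hlen := (G.encodes t).length_le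
    rw [hcode] at hq hdrop hlt hG hlen
    rw [GuardingGame.length_entries] at hlen
    rw [ht] at hdrop
    obtain ⟨p, hp, hdrop'⟩ := exists_numAt hdrop
    have htail := length_le_length_flatMap_binaryCode ((List.ofFn G.copStart).map Fin.val)
    have htlen := congrArg List.length ht
    rw [List.length_map, List.length_ofFn] at htail
    rw [List.length_append] at htlen
    have hB' : 2 ^ (G.order + G.cops) ≤ univSize w := two_pow_le_univSize (by omega)
    obtain ⟨x, hx, hxS⟩ := GuardingGame.exists_codedMultiset_positions hB' G.copStart
    have hr := G.robberStart.2
    have hple := hp.2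
    refine ⟨G.order, by omega, G.cops, by omega, q, by omega, q + 1, by omega, G.robberStart,
      by omega, p, by omega, x, hx, hq, rfl, hp, hr,
      fun h => G.robberStart_notMem ((hG.inC_iff _).1 h), ⟨_, hdrop', by simp, ?_, ?_⟩,
      (hG.codedForces_iff hB' G.copStart_mem hxS).2
        ((GuardingGame.robberWinsFrom_iff G.robberStart_notMem G.copStart_mem).1 hwin)⟩
    · rw [hxS, GuardingGame.positions_eq]
    · intro v hv
      refine hG.inC_of_mem_positions G.copStart_mem ?_
      rwa [GuardingGame.positions_eq, Multiset.mem_coe]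
  · rintro ⟨_, -, _, -, q, -, _, -, r, -, p, -, x, hx, hgraph, rfl, hnum, hr, hrC,
      ⟨l, hdrop, hl, hxl, hlC⟩, hforces⟩
    obtain ⟨G, hw, rfl, rfl⟩ := hgraph.exists_game
    have hG := G.describes (w.drop (q + 1))
    have hlen := (G.encodes (w.drop (q + 1))).length_le
    rw [← hw] at hG hlen
    rw [GuardingGame.length_entries, hnum.1, hdrop, List.length_append] at hlen
    have htail := length_le_length_flatMap_binaryCode l
    have hB' : 2 ^ (G.order + G.cops) ≤ univSize w := two_pow_le_univSize (by omega)
    have hr' : (⟨r, hr⟩ : Fin G.order) ∉ G.copRegion := fun h => hrC ((hG.inC_iff ⟨r, hr⟩).2 h)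
    obtain ⟨S, hS, hSl⟩ := GuardingGame.exists_placement hl
      fun u hu => hG.exists_of_inC (hlC u hu)
    refine ⟨⟨G, S, hS, ⟨r, hr⟩, hr'⟩, ?_, (GuardingGame.robberWinsFrom_iff hr' hS).2
      ((hG.codedForces_iff (r := ⟨r, hr⟩) hB' hS ?_).1 hforces)⟩
    · rw [hw, hnum.1, hdrop, ← hSl, GuardingGamePSP.code_eq]
    · rw [hxl, GuardingGame.positions_eq, hSl]

theorem mainTheorem6 : Guard ∈ ClassE ∧ GuardPSP ∈ ClassE := by
  constructor
  -- Registers `2` to `7` hold `m`, `c`, `q`, `q₁`, `r`, `x`; in the second problem registers `7`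
  -- and `8` hold `p` and `x`.
  · refine mem_ClassE_of_dec (Dec.congr (k := 2) (a := 0) (.ex (.ex (.ex (.ex (.ex
      ((decRel_graphAt.dec 2 3 4).and ((Dec.add_const 4 1 5).and ((Dec.inp none 5).and
      ((decRel_lt.dec 3 2).and ((decRel_lt.dec 6 2).and ((decRel_inCAt.dec 6).not.and
      (.all ((decRel_copsAt.dec 3 7).imp (decRel_codedForces.dec 6 7))))))))))))))
      fun w s _ => ?_)
    simp (disch := omega) only [RAM.setReg_self, RAM.setReg_of_ne, mem_Guard_iff]
  · refine mem_ClassE_of_dec (Dec.congr (k := 2) (a := 0) (.ex (.ex (.ex (.ex (.ex (.ex (.ex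
      ((decRel_graphAt.dec 2 3 4).and ((Dec.add_const 4 1 5).and ((decRel_numAt.dec 5 6 7).and
      ((decRel_lt.dec 6 2).and ((decRel_inCAt.dec 6).not.and
      ((decRel_tailAt.dec 7 3 8).and (decRel_codedForces.dec 6 8))))))))))))))
      fun w s _ => ?_)
    simp (disch := omega) only [RAM.setReg_self, RAM.setReg_of_ne, mem_GuardPSP_iff]
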